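/- Let $G$ be a noncompact connected (real, finite-dimensional) Lie group with Lie algebra $\mathfrak g$ of left-invariant vector fields, let $\langle\cdot,\cdot\rangle$ be a scalar product on $\mathfrak g$, and let $\mathcal H\subseteq\mathfrak g$ be a linear subspace which generates $\mathfrak g$ as a Lie algebra. Let $d$ be the associated left-invariant Carnot–Carathéodory distance on $G$: $d(x,y)$ is the infimum of $\int_0^1|\gamma'(t)|\,\mathrm dt$ over all absolutely continuous curves $\gamma\colon[0,1]\to G$ from $x$ to $y$ such that $\gamma'(t)\in\mathcal H_{\gamma(t)}=\{X_{\gamma(t)}\colon X\in\mathcal H\}$ for almost every $t$, where $|X_x|=\langle X,X\rangle^{1/2}$. Let $\mu$ be a left Haar measure on $G$. For $R>0$ let $\mathcal B_R$ be the set of all open $d$-balls of radius at most $R$; $\lambda B$ denotes the ball with the same centre as $B$ and $\lambda$ times its radius. For a non-negative $w\in L^1_{\mathrm{loc}}(\mu)$ which is not almost everywhere zero, let $\mu_w$ be the measure with density $w$ with respect to $\mu$, and for $R>0$ consider the following conditions: (1) there are $\varepsilon,\delta\in(0,1)$ such that, for every $B\in\mathcal B_R$ and every Borel set $F\subseteq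 B$, $\mu(F)\le\varepsilon\mu(B)$ implies $\mu_w(F)\le\delta\mu_w(B)$; (2) $\mu_w(B)>0$ for every $B\in\mathcal B_R$, and there are $p\in[1,\infty)$ and $C>0$ such that, for every $B\in\mathcal B_R$ and every Borel set $F\subseteq B$, $$\frac{\mu_w(F)}{\mu_w(B)}\ge C\left(\frac{\mu(F)}{\mu(B)}\right)^p;$$ (3) there are $p\in(1,\infty)$ and $C>0$ such that, for every $B\in\mathcal B_R$, $$\Big(\frac1{\mu(B)}\int_B w\,\mathrm d\mu\Big)\Big(\frac1{\mu(B)}\int_B w^{-p'/p}\,\mathrm d\mu\Big)^{p/p'}\le C,\qquad p'=\tfrac{p}{p-1};$$ (4) there are $\delta,c>0$ such that, for every $B\in\mathcal B_R$, $$\mu\Big(\Big\{x\in B\colon w(x)\ge\delta \frac1{\mu(B)}\int_B w\,\mathrm d\mu\Big\}\Big)\ge c\,\mu(B).$$ Suppose that $w\in\widetilde A_{\infty,\mathrm{loc}}$, that is, $w\in L^1_{\mathrm{loc}}(\mu)$ is non-negative and not almost everywhere zero, condition (4) holds for some $R>0$, and there are $R,C>0$ such that $\mu_w(2B)\le C\mu_w(B)$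 for every $B\in\mathcal B_R$. Then $\mu_w$ is locally doubling, that is, for every $R>0$ there is $C>0$ such that $\mu_w(2B)\le C\mu_w(B)$ for every $B\in\mathcal B_R$; and conditions (1), (2), (3) and (4) hold for every $R>0$. -/

import Mathlib

open MeasureTheory
open scoped Manifold ContDiff ENNReal NNReal

/-- The smoothness `minSmoothness ℝ 3 = 3` needed for the Lie bracket on the Lie algebra of a Lie
group is at most `∞`, so that a smooth Lie group is a Lie group of that class. -/
instance leInfty_minSmoothness_real_three : ENat.LEInfty (minSmoothness ℝ 3) :=
  ⟨by rw [minSmoothness_of_isRCLikeNormedField]; exact ENat.LEInfty.out⟩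

noncomputable section

section CarnotCaratheodory

variable {E : Type*} [NormedAddCommGroup E] [NormedSpace ℝ E]
  {G : Type*} [TopologicalSpace G] [ChartedSpace E G]

/-- A curve `γ : [0,1] → G` (the values outside `[0,1]` play no role) is absolutely continuous if it
is continuous and is absolutely continuous in charts: whenever `γ` maps a subinterval `[a,b]` into
the domain of a chart, its expression in this chart is absolutely continuous on `[a,b]`. -/
def IsAbsolutelyContinuousCurve (γ : ℝ → G) : Prop :=
  ContinuousOn γ (Set.Icc 0 1) ∧
  ∀ (p : G) (a b : ℝ), 0 ≤ a → a ≤ b → b ≤ 1 →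
    (∀ t ∈ Set.Icc a b, γ t ∈ (extChartAt 𝓘(ℝ, E) p).source) →
    AbsolutelyContinuousOnInterval (fun t => extChartAt 𝓘(ℝ, E) p (γ t)) a b

variable [Group G]

/-- `γ` is an absolutely continuous curve on `[0,1]` from `x` to `y` which is horizontal, i.e. whose
derivative at almost every time `t` is the value at `γ t` of the left-invariant vector field
associated with a vector `u t` of the subspace `𝓗` of the Lie algebra. -/
structure IsHorizontalCurve (𝓗 : Submodule ℝ (GroupLieAlgebra 𝓘(ℝ, E) G)) (x y : G)
    (γ : ℝ → G) (u : ℝ → GroupLieAlgebra 𝓘(ℝ, E) G) : Prop where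
  absolutelyContinuous : IsAbsolutelyContinuousCurve (E := E) γ
  source : γ 0 = x
  target : γ 1 = y
  mem : ∀ᵐ t ∂(volume.restrict (Set.Icc (0 : ℝ) 1)), u t ∈ 𝓗
  hasDeriv : ∀ᵐ t ∂(volume.restrict (Set.Icc (0 : ℝ) 1)),
    HasMFDerivAt 𝓘(ℝ, ℝ) 𝓘(ℝ, E) γ t
      (ContinuousLinearMap.toSpanSingleton ℝ
        (mulInvariantVectorField (I := 𝓘(ℝ, E)) (u t) (γ t)))

/-- The Carnot–Carathéodory distance: the infimum of the lengths `∫₀¹ |γ'(t)| dt` of the horizontal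
curves `γ` from `x` to `y`. The scalar product on the horizontal spaces is the left-invariant one,
hence `|γ'(t)|` is the norm of the vector `u t` of the Lie algebra. -/
def ccEDist (ip : InnerProductSpace.Core ℝ (GroupLieAlgebra 𝓘(ℝ, E) G))
    (𝓗 : Submodule ℝ (GroupLieAlgebra 𝓘(ℝ, E) G)) (x y : G) : ℝ≥0∞ :=
  ⨅ (γ : ℝ → G) (u : ℝ → GroupLieAlgebra 𝓘(ℝ, E) G) (_ : IsHorizontalCurve 𝓗 x y γ u),
    ∫⁻ t in Set.Icc (0 : ℝ) 1, ENNReal.ofReal (Real.sqrt (ip.inner (u t) (u t)))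

/-- The open ball `B(x,r)` for the Carnot–Carathéodory distance. -/
def ccBall (ip : InnerProductSpace.Core ℝ (GroupLieAlgebra 𝓘(ℝ, E) G))
    (𝓗 : Submodule ℝ (GroupLieAlgebra 𝓘(ℝ, E) G)) (x : G) (r : ℝ) : Set G :=
  {y | ccEDist ip 𝓗 x y < ENNReal.ofReal r}

end CarnotCaratheodory

section Muckenhoupt

/- In this section `B x r` stands for the open ball with centre `x` and radius `r`. -/
variable {G : Type*} [MeasurableSpace G]

/-- The measure `μ_w` with density `w` with respect to `μ`. -/
def weightMeasure (μ : Measure G) (w : G → ℝ) : Measure G :=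
  μ.withDensity fun x => ENNReal.ofReal (w x)

/-- The measure `ν` is doubling on the balls of radius at most `R`. -/
def DoublingUpTo (B : G → ℝ → Set G) (ν : Measure G) (R : ℝ) : Prop :=
  ∃ C : ℝ≥0, 0 < C ∧ ∀ (x : G) (r : ℝ), 0 < r → r ≤ R → ν (B x (2 * r)) ≤ C * ν (B x r)

/-- The measure `ν` is locally doubling: it is doubling on the balls of radius at most `R`,
for every `R > 0`. -/
def LocallyDoubling (B : G → ℝ → Set G) (ν : Measure G) : Prop :=
  ∀ R : ℝ, 0 < R → DoublingUpTo B ν R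

/-- Condition (1): there are `ε, δ ∈ (0,1)` such that `μ(F) ≤ ε μ(B)` implies
`μ_w(F) ≤ δ μ_w(B)`, for all balls `B` of radius at most `R` and Borel sets `F ⊆ B`. -/
def MuckenhouptCond1 (B : G → ℝ → Set G) (μ : Measure G) (w : G → ℝ) (R : ℝ) : Prop :=
  ∃ ε δ : ℝ≥0, 0 < ε ∧ ε < 1 ∧ 0 < δ ∧ δ < 1 ∧
    ∀ (x : G) (r : ℝ), 0 < r → r ≤ R → ∀ F : Set G, MeasurableSet F → F ⊆ B x r →
      μ F ≤ ε * μ (B x r) → weightMeasure μ w F ≤ δ * weightMeasure μ w (B x r)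

/-- Condition (2): `μ_w(B) > 0` for all balls `B` of radius at most `R` (so that the quotients make
sense), and there are `p ∈ [1,∞)` and `C > 0` such that `μ_w(F)/μ_w(B) ≥ C (μ(F)/μ(B))^p` for all
these balls and all Borel sets `F ⊆ B`. -/
def MuckenhouptCond2 (B : G → ℝ → Set G) (μ : Measure G) (w : G → ℝ) (R : ℝ) : Prop :=
  (∀ (x : G) (r : ℝ), 0 < r → r ≤ R → 0 < weightMeasure μ w (B x r)) ∧
  ∃ (p : ℝ) (C : ℝ≥0), 1 ≤ p ∧ 0 < C ∧
    ∀ (x : G) (r : ℝ), 0 < r → r ≤ R → ∀ F : Set G, MeasurableSet F → F ⊆ B x r →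
      C * (μ F / μ (B x r)) ^ p ≤ weightMeasure μ w F / weightMeasure μ w (B x r)

/-- Condition (3): there are `p ∈ (1,∞)` and `C > 0` such that, `p'` being the exponent conjugate
to `p`, `(⨍_B w dμ) (⨍_B w^(-p'/p) dμ)^(p/p') ≤ C` for all balls `B` of radius at most `R`.
The averages take values in `[0,∞]`, and a negative power of `0` is `∞`. -/
def MuckenhouptCond3 (B : G → ℝ → Set G) (μ : Measure G) (w : G → ℝ) (R : ℝ) : Prop :=
  ∃ (p : ℝ) (C : ℝ≥0), 1 < p ∧ 0 < C ∧
    ∀ (x : G) (r : ℝ), 0 < r → r ≤ R →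
      (⨍⁻ y in B x r, ENNReal.ofReal (w y) ∂μ) *
        (⨍⁻ y in B x r, ENNReal.ofReal (w y) ^ (-(Real.conjExponent p / p)) ∂μ) ^
          (p / Real.conjExponent p) ≤ C

/-- Condition (4): there are `δ, c > 0` such that `μ {x ∈ B : w(x) ≥ δ ⨍_B w dμ} ≥ c μ(B)` for all
balls `B` of radius at most `R`. -/
def MuckenhouptCond4 (B : G → ℝ → Set G) (μ : Measure G) (w : G → ℝ) (R : ℝ) : Prop :=
  ∃ δ c : ℝ≥0, 0 < δ ∧ 0 < c ∧
    ∀ (x : G) (r : ℝ), 0 < r → r ≤ R →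
      c * μ (B x r) ≤
        μ {y ∈ B x r | δ * (⨍⁻ z in B x r, ENNReal.ofReal (w z) ∂μ) ≤ ENNReal.ofReal (w y)}

variable [TopologicalSpace G]

/-- The class `A_{∞,loc}`: the locally integrable functions which are positive (in the wide sense)
and non-zero, both up to null sets, and satisfy condition (4) for some `R > 0`. -/
structure AInftyLoc (B : G → ℝ → Set G) (μ : Measure G) (w : G → ℝ) : Prop where
  locallyIntegrable : LocallyIntegrable w μ
  nonneg : 0 ≤ᵐ[μ] w
  ne_zero : ¬ w =ᵐ[μ] 0
  cond4 : ∃ R : ℝ, 0 < R ∧ MuckenhouptCond4 B μ w R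

/-- The class `Ã_{∞,loc}`: the `w ∈ A_{∞,loc}` such that `μ_w` is doubling on the balls of radius at
most `R`, for some `R > 0`. -/
structure AInftyLocTilde (B : G → ℝ → Set G) (μ : Measure G) (w : G → ℝ) : Prop
    extends AInftyLoc B μ w where
  doubling : ∃ R : ℝ, 0 < R ∧ DoublingUpTo B (weightMeasure μ w) R

end Muckenhoupt

end

/-! The proof has a geometric half and a measure-theoretic half. The geometric half shows that the
Carnot–Carathéodory distance is finite and left-invariant, induces the topology of `G` and has
compact closed balls (`exists_metricSpace_ccBall`). Its core is Chow's theorem,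
`ccBall_mem_nhds_one`, obtained from the adjoint representation rather than from iterated
commutators of flows: the vectors `Ad_g X`, with `X` horizontal and `g` at distance less than `s`
from `1`, span the Lie algebra for every `s > 0`. Indeed the span stabilises as `s` decreases, and
the stable span is invariant under `ad X` (`conjSpan_eq_top`). A product of curves `g c(t) g⁻¹`
adapted to a basis of such vectors is then a local submersion with values in a small ball.

From there on only a connected group with a proper left-invariant distance matters. Doubling at one
scale spreads to all scales, because the elements by which centres can be right-translated at
bounded cost form an open subgroup (`exists_measure_ball_le_mul`). No volume estimate is used for
`μ`: since its balls have a measure depending only on the radius, Fubini transfers doubling from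
`μ_w` to `μ` (`DoublingUpTo.of_measure_ball_eq`).

Condition (4) says that sets of small relative `μ_w`-measure do not fill a ball in `μ`-measure. A
stopping-radius argument with Lebesgue differentiation and Vitali covering turns this into geometric
decay of the sublevel sets of `w` (`measureReal_level_inter_ball_le`), hence into a bound for the
average of `w ^ (-η)` with `η` small (`exists_lintegral_rpow_neg_ball_le`). This is (3) at small
scales, and a finite covering extends it to all scales. The same bound gives (2), by integrating `1
≤ sw + (sw) ^ (-η)` over `F`, and (2) gives (1) and (4). -/

/-! ### Absolutely continuous functions: affine changes of variable, gluing, locality. -/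

section AbsoluteContinuity

open Set Filter
open scoped Topology

variable {X Y : Type*} [PseudoMetricSpace X] [PseudoMetricSpace Y]

theorem LipschitzOnWith.comp_absolutelyContinuousOnInterval {f : ℝ → X} {g : X → Y} {K : ℝ≥0}
    {s : Set X} {a b : ℝ} (hg : LipschitzOnWith K g s) (hf : AbsolutelyContinuousOnInterval f a b)
    (hs : MapsTo f (uIcc a b) s) : AbsolutelyContinuousOnInterval (fun t => g (f t)) a b := by
  unfold AbsolutelyContinuousOnInterval at hf ⊢
  refine squeeze_zero' (Eventually.of_forall fun E => Finset.sum_nonneg fun i _ => dist_nonneg) ?_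
    (by simpa using hf.const_mul (K : ℝ))
  rw [eventually_inf_principal]
  refine Eventually.of_forall fun E hE => ?_
  rw [Finset.mul_sum]
  exact Finset.sum_le_sum fun i hi => hg.dist_le_mul _ (hs (hE.1 i hi).1) _ (hs (hE.1 i hi).2)

/-- Written with `min` and `max` only, so that monotone and antitone affine maps transport
disjointness directly. -/
theorem uIoc_disjoint_uIoc_iff {a b c d : ℝ} :
    Disjoint (uIoc a b) (uIoc c d) ↔ min (max a b) (max c d) ≤ max (min a b) (min c d) := by
  rw [uIoc, uIoc, Ioc_disjoint_Ioc]

theorem AbsolutelyContinuousOnInterval.comp_affine {f : ℝ → X} {a b c d : ℝ} (hc : c ≠ 0)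
    (hf : AbsolutelyContinuousOnInterval f (c * a + d) (c * b + d)) :
    AbsolutelyContinuousOnInterval (fun t => f (c * t + d)) a b := by
  rw [absolutelyContinuousOnInterval_iff] at hf ⊢
  intro ε hε
  obtain ⟨δ, hδ, H⟩ := hf ε hε
  have hc' : 0 < |c| := abs_pos.2 hc
  refine ⟨δ / |c|, by positivity, fun E hE hlen => ?_⟩
  refine H (E.1, fun i => (c * (E.2 i).1 + d, c * (E.2 i).2 + d)) ⟨fun i hi => ?_, ?_⟩ ?_
  · have key : ∀ x ∈ uIcc a b, c * x + d ∈ uIcc (c * a + d) (c * b + d) := by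
      intro x hx
      rw [mem_uIcc] at hx ⊢
      rcases hc.lt_or_gt with h | h
      · rcases hx with hx | hx
        · right; constructor <;> nlinarith
        · left; constructor <;> nlinarith
      · rcases hx with hx | hx
        · left; constructor <;> nlinarith
        · right; constructor <;> nlinarith
    exact ⟨key _ (hE.1 i hi).1, key _ (hE.1 i hi).2⟩
  · intro i hi j hj hij
    have := hE.2 hi hj hij
    simp only [Function.onFun] at this ⊢
    rw [uIoc_disjoint_uIoc_iff] at this ⊢
    rcases hc.lt_or_gt with h | h
    · have anti : Antitone fun x : ℝ => c * x + d := fun x y hxy => by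
        have := mul_le_mul_of_nonpos_left hxy h.le
        simpa using this
      have e := anti this
      simp only [anti.map_max, anti.map_min] at e
      simpa only [min_comm, max_comm] using e
    · have mono : Monotone fun x : ℝ => c * x + d := fun x y hxy => by
        have := mul_le_mul_of_nonneg_left hxy h.le
        simpa using this
      have e := mono this
      simpa only [mono.map_max, mono.map_min] using e
  · rw [lt_div_iff₀ hc', Finset.sum_mul] at hlen
    refine lt_of_eq_of_lt (Finset.sum_congr rfl fun i _ => ?_) hlen
    simp only [Real.dist_eq]
    rw [← abs_mul]
    congr 1
    ring

/-- Truncating each interval of a family by `min · b` and `max · b` keeps the family disjoint and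
does not increase lengths; the two truncated increments bound the original one by the triangle
inequality. -/
theorem AbsolutelyContinuousOnInterval.union {f : ℝ → X} {a b c : ℝ} (hab : a ≤ b) (hbc : b ≤ c)
    (h₁ : AbsolutelyContinuousOnInterval f a b) (h₂ : AbsolutelyContinuousOnInterval f b c) :
    AbsolutelyContinuousOnInterval f a c := by
  rw [absolutelyContinuousOnInterval_iff] at h₁ h₂ ⊢
  intro ε hε
  obtain ⟨δ₁, hδ₁, H₁⟩ := h₁ (ε / 2) (half_pos hε)
  obtain ⟨δ₂, hδ₂, H₂⟩ := h₂ (ε / 2) (half_pos hε)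
  refine ⟨min δ₁ δ₂, lt_min hδ₁ hδ₂, fun E hE hlen => ?_⟩
  have hac := hab.trans hbc
  have mem : ∀ i ∈ Finset.range E.1, (a ≤ (E.2 i).1 ∧ (E.2 i).1 ≤ c) ∧
      (a ≤ (E.2 i).2 ∧ (E.2 i).2 ≤ c) := by
    intro i hi
    have := hE.1 i hi
    rwa [uIcc_of_le hac] at this
  have K₁ := H₁ (E.1, fun i => (min (E.2 i).1 b, min (E.2 i).2 b)) ⟨fun i hi => by
      have := mem i hi
      rw [uIcc_of_le hab]
      exact ⟨⟨le_min this.1.1 hab, min_le_right _ _⟩, ⟨le_min this.2.1 hab, min_le_right _ _⟩⟩,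
    fun i hi j hj hij => by
      have := hE.2 hi hj hij
      simp only [Function.onFun] at this ⊢
      refine this.mono ?_ ?_ <;>
      · intro x
        simp only [mem_uIoc]
        grind⟩
    (lt_of_le_of_lt (Finset.sum_le_sum fun i _ => by
      simp only [Real.dist_eq]; exact abs_inf_sub_inf_le_abs _ _ _) (hlen.trans_le (min_le_left _ _)))
  have K₂ := H₂ (E.1, fun i => (max (E.2 i).1 b, max (E.2 i).2 b)) ⟨fun i hi => by
      have := mem i hi
      rw [uIcc_of_le hbc]
      exact ⟨⟨le_max_right _ _, max_le this.1.2 hbc⟩, ⟨le_max_right _ _, max_le this.2.2 hbc⟩⟩,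
    fun i hi j hj hij => by
      have := hE.2 hi hj hij
      simp only [Function.onFun] at this ⊢
      refine this.mono ?_ ?_ <;>
      · intro x
        simp only [mem_uIoc]
        grind⟩
    (lt_of_le_of_lt (Finset.sum_le_sum fun i _ => by
      simp only [Real.dist_eq]; exact abs_sup_sub_sup_le_abs _ _ _) (hlen.trans_le (min_le_right _ _)))
  refine lt_of_le_of_lt ?_ ((add_lt_add K₁ K₂).trans_eq (add_halves ε))
  rw [← Finset.sum_add_distrib]
  refine Finset.sum_le_sum fun i _ => ?_
  simp only
  rcases le_total (E.2 i).1 b with h | h <;> rcases le_total (E.2 i).2 b with h' | h' <;>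
    simp [h, h']
  · exact dist_triangle _ _ _
  · rw [add_comm]; exact dist_triangle _ _ _

theorem AbsolutelyContinuousOnInterval.congr {f g : ℝ → X} {a b : ℝ}
    (hf : AbsolutelyContinuousOnInterval f a b) (h : EqOn f g (uIcc a b)) :
    AbsolutelyContinuousOnInterval g a b := by
  unfold AbsolutelyContinuousOnInterval at hf ⊢
  refine hf.congr' ?_
  rw [EventuallyEq, eventually_inf_principal]
  refine Eventually.of_forall fun E hE => Finset.sum_congr rfl fun i hi => ?_
  rw [h (hE.1 i hi).1, h (hE.1 i hi).2]

/-- By compactness a finite subdivision has each piece inside one neighbourhood, and the pieces are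
glued. This allows changing charts along a curve. -/
theorem AbsolutelyContinuousOnInterval.of_forall_exists_nhds {f : ℝ → X} {a b : ℝ} (hab : a ≤ b)
    (h : ∀ t ∈ Icc a b, ∃ V ∈ 𝓝 t, ∀ c d, a ≤ c → c ≤ d → d ≤ b → Icc c d ⊆ V →
      AbsolutelyContinuousOnInterval f c d) : AbsolutelyContinuousOnInterval f a b := by
  choose! V hV hf using h
  obtain ⟨t, t0, tmono, ⟨n, hn⟩, ht⟩ := exists_monotone_Icc_subset_open_cover_Icc (ι := Icc a b)
    (c := fun x => Subtype.val ⁻¹' interior (V x)) hab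
    (fun x => isOpen_interior.preimage continuous_subtype_val)
    (fun x _ => mem_iUnion.2 ⟨x, mem_interior_iff_mem_nhds.2 (hV x.1 x.2)⟩)
  have key : ∀ k, AbsolutelyContinuousOnInterval f a (t k) := by
    intro k
    induction k with
    | zero =>
      have : ((t 0 : Icc a b) : ℝ) = a := t0
      rw [this]
      refine (LipschitzOnWith.absolutelyContinuousOnInterval (K := 0) ?_)
      rw [uIcc_self]
      simp [LipschitzOnWith]
    | succ k ih =>
      refine ih.union (t k).2.1 (tmono k.le_succ) ?_
      obtain ⟨x, hx⟩ := ht k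
      refine hf x x.2 _ _ (t k).2.1 (tmono k.le_succ) (t (k + 1)).2.2 fun y hy => ?_
      exact interior_subset (hx (show (⟨y, (t k).2.1.trans hy.1, hy.2.trans (t (k+1)).2.2⟩ : Icc a b)
        ∈ Icc (t k) (t (k + 1)) from hy))
  have := key n
  rwa [hn n le_rfl] at this

end AbsoluteContinuity

/-! ### Horizontal curves on arbitrary intervals: reparametrisation, concatenation, length. -/

section HorizontalCurves

open Set Filter
open scoped Topology

variable {E : Type*} [NormedAddCommGroup E] [NormedSpace ℝ E]
  {G : Type*} [TopologicalSpace G] [ChartedSpace E G] [Group G]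

/-- The curve `γ` is absolutely continuous and horizontal, with control `u`, on `[a,b]`. -/
structure HorizontalOn (𝓗 : Submodule ℝ (GroupLieAlgebra 𝓘(ℝ, E) G))
    (γ : ℝ → G) (u : ℝ → GroupLieAlgebra 𝓘(ℝ, E) G) (a b : ℝ) : Prop where
  continuousOn : ContinuousOn γ (Icc a b)
  ac : ∀ (p : G) (c d : ℝ), a ≤ c → c ≤ d → d ≤ b →
    (∀ t ∈ Icc c d, γ t ∈ (extChartAt 𝓘(ℝ, E) p).source) →
    AbsolutelyContinuousOnInterval (fun t => extChartAt 𝓘(ℝ, E) p (γ t)) c d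
  mem : ∀ᵐ t ∂(volume.restrict (Icc a b)), u t ∈ 𝓗
  hasDeriv : ∀ᵐ t ∂(volume.restrict (Icc a b)),
    HasMFDerivAt 𝓘(ℝ, ℝ) 𝓘(ℝ, E) γ t
      (ContinuousLinearMap.toSpanSingleton ℝ
        (mulInvariantVectorField (I := 𝓘(ℝ, E)) (u t) (γ t)))

/-- The norm of a vector of the Lie algebra. -/
noncomputable def coreNorm (ip : InnerProductSpace.Core ℝ (GroupLieAlgebra 𝓘(ℝ, E) G))
    (v : GroupLieAlgebra 𝓘(ℝ, E) G) : ℝ :=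
  Real.sqrt (ip.inner v v)

/-- The length on `[a,b]` of a curve with control `u`. -/
noncomputable def controlLength (ip : InnerProductSpace.Core ℝ (GroupLieAlgebra 𝓘(ℝ, E) G))
    (u : ℝ → GroupLieAlgebra 𝓘(ℝ, E) G) (a b : ℝ) : ℝ≥0∞ :=
  ∫⁻ t in Icc a b, ENNReal.ofReal (coreNorm ip (u t))

theorem isHorizontalCurve_iff {𝓗 : Submodule ℝ (GroupLieAlgebra 𝓘(ℝ, E) G)} {x y : G}
    {γ : ℝ → G} {u : ℝ → GroupLieAlgebra 𝓘(ℝ, E) G} :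
    IsHorizontalCurve 𝓗 x y γ u ↔ HorizontalOn 𝓗 γ u 0 1 ∧ γ 0 = x ∧ γ 1 = y :=
  ⟨fun h => ⟨⟨h.1.1, h.1.2, h.4, h.5⟩, h.2, h.3⟩,
    fun ⟨h, h0, h1⟩ => ⟨⟨h.1, h.2⟩, h0, h1, h.3, h.4⟩⟩

theorem coreNorm_smul (ip : InnerProductSpace.Core ℝ (GroupLieAlgebra 𝓘(ℝ, E) G)) (c : ℝ)
    (v : GroupLieAlgebra 𝓘(ℝ, E) G) : coreNorm ip (c • v) = |c| * coreNorm ip v := by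
  have h1 : ∀ x y, ip.inner (c • x) y = c * ip.inner x y := fun x y => by
    simpa using ip.smul_left x y c
  have h2 : ip.inner v (c • v) = c * ip.inner v v := by
    have e := ip.conj_inner_symm v (c • v)
    rw [h1] at e
    simpa using e.symm
  rw [coreNorm, coreNorm, h1, h2, ← mul_assoc, Real.sqrt_mul (mul_self_nonneg c),
    Real.sqrt_mul_self_eq_abs]

variable {𝓗 : Submodule ℝ (GroupLieAlgebra 𝓘(ℝ, E) G)}
  {γ γ' : ℝ → G} {u u' : ℝ → GroupLieAlgebra 𝓘(ℝ, E) G} {a b c d : ℝ}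

theorem HorizontalOn.mono (h : HorizontalOn 𝓗 γ u a b) (hc : a ≤ c) (hd : d ≤ b) :
    HorizontalOn 𝓗 γ u c d where
  continuousOn := h.continuousOn.mono (Icc_subset_Icc hc hd)
  ac p s t hs hst ht := h.ac p s t (hc.trans hs) hst (ht.trans hd)
  mem := ae_restrict_of_ae_restrict_of_subset (Icc_subset_Icc hc hd) h.mem
  hasDeriv := ae_restrict_of_ae_restrict_of_subset (Icc_subset_Icc hc hd) h.hasDeriv

theorem ae_affine {P : ℝ → Prop} (hc : c ≠ 0) (h : ∀ᵐ t, P t) : ∀ᵐ t, P (c * t + d) := by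
  have h1 : ∀ᵐ t, P (t + d) :=
    (measurePreserving_add_right volume d).quasiMeasurePreserving.ae h
  have h2 : Measure.QuasiMeasurePreserving (fun t : ℝ => c * t) :=
    ⟨measurable_const_mul c, by
      rw [Real.map_volume_mul_left hc]; exact Measure.smul_absolutelyContinuous⟩
  exact h2.ae h1

theorem ae_restrict_affine {P : ℝ → Prop} {s t : Set ℝ} (hs : MeasurableSet s)
    (ht : MeasurableSet t) (hc : c ≠ 0) (hst : MapsTo (fun x => c * x + d) s t)
    (h : ∀ᵐ x ∂(volume.restrict t), P x) : ∀ᵐ x ∂(volume.restrict s), P (c * x + d) := by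
  rw [ae_restrict_iff' ht] at h
  rw [ae_restrict_iff' hs]
  filter_upwards [ae_affine (d := d) hc h] with x hx hxs using hx (hst hxs)

theorem uIcc_affine (c d s t : ℝ) :
    (fun x => c * x + d) '' uIcc s t = uIcc (c * s + d) (c * t + d) := by
  have := (image_const_mul_uIcc c s t)
  rw [← image_add_const_uIcc, ← this, image_image]

/-- The sign of `c` is free, hence the unordered interval in `himg`: negative `c` reverses curves,
which gives the symmetry of the distance. -/
theorem HorizontalOn.comp_affine (hc : c ≠ 0)
    {s t : ℝ} (hst : s ≤ t) (himg : uIcc (c * s + d) (c * t + d) = Icc a b)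
    (h : HorizontalOn 𝓗 γ u a b) :
    HorizontalOn 𝓗 (fun x => γ (c * x + d)) (fun x => c • u (c * x + d)) s t := by
  have hmaps : MapsTo (fun x => c * x + d) (Icc s t) (Icc a b) := by
    rw [← himg, ← uIcc_affine, uIcc_of_le hst]; exact mapsTo_image _ _
  refine ⟨?_, ?_, ?_, ?_⟩
  · exact h.continuousOn.comp (by fun_prop) hmaps
  · intro p s' t' hs' hst' ht' hsrc
    have A := AbsolutelyContinuousOnInterval.comp_affine (a := s') (b := t') (d := d)
      (f := fun x => extChartAt 𝓘(ℝ, E) p (γ x)) hc ?_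
    · exact A
    have hm : uIcc (c * s' + d) (c * t' + d) =
        Icc (min (c * s' + d) (c * t' + d)) (max (c * s' + d) (c * t' + d)) := rfl
    have hsub : uIcc (c * s' + d) (c * t' + d) ⊆ Icc a b := by
      rw [← uIcc_affine, uIcc_of_le hst']
      rintro _ ⟨x, hx, rfl⟩
      exact hmaps ⟨hs'.trans hx.1, hx.2.trans ht'⟩
    have B := h.ac p (min (c * s' + d) (c * t' + d)) (max (c * s' + d) (c * t' + d))
      (hsub ⟨le_rfl, min_le_max⟩).1 min_le_max (hsub ⟨min_le_max, le_rfl⟩).2 (by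
        intro x hx
        rw [← hm, ← uIcc_affine, uIcc_of_le hst'] at hx
        obtain ⟨y, hy, rfl⟩ := hx
        exact hsrc y hy)
    exact B.mono (by rw [uIcc_of_le (min_le_max (a := c * s' + d)), hm])
  · filter_upwards [ae_restrict_affine measurableSet_Icc measurableSet_Icc hc hmaps h.mem] with x hx
    exact 𝓗.smul_mem c hx
  · filter_upwards [ae_restrict_affine measurableSet_Icc measurableSet_Icc hc hmaps h.hasDeriv]
      with x hx
    have hd : HasDerivAt (fun x : ℝ => c * x + d) c x := by
      simpa using ((hasDerivAt_id x).const_mul c).add_const d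
    have := HasMFDerivAt.comp x hx hd.hasFDerivAt.hasMFDerivAt
    have e : ContinuousLinearMap.toSpanSingleton ℝ
          (mulInvariantVectorField (I := 𝓘(ℝ, E)) (c • u (c * x + d)) (γ (c * x + d))) =
        (ContinuousLinearMap.toSpanSingleton ℝ
          (mulInvariantVectorField (I := 𝓘(ℝ, E)) (u (c * x + d)) (γ (c * x + d)))).comp
          (ContinuousLinearMap.toSpanSingleton ℝ c) := by
      ext
      simp [mulInvariantVectorField_smul]
    rw [e]
    exact this

theorem controlLength_comp_affine (ip : InnerProductSpace.Core ℝ (GroupLieAlgebra 𝓘(ℝ, E) G))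
    (u : ℝ → GroupLieAlgebra 𝓘(ℝ, E) G) (hc : c ≠ 0) {s t : ℝ} (hst : s ≤ t)
    (himg : uIcc (c * s + d) (c * t + d) = Icc a b) :
    controlLength ip (fun x => c • u (c * x + d)) s t = controlLength ip u a b := by
  have hd : ∀ x ∈ Icc s t, HasDerivWithinAt (fun x : ℝ => c * x + d) c (Icc s t) x := fun x _ => by
    simpa using (((hasDerivAt_id x).const_mul c).add_const d).hasDerivWithinAt
  -- The control `u` need not be measurable; this change of variables asks nothing of the integrand.
  have := lintegral_image_eq_lintegral_abs_deriv_mul measurableSet_Icc hd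
    (fun x _ y _ hxy => by simpa [hc] using hxy) (fun x => ENNReal.ofReal (coreNorm ip (u x)))
  rw [← uIcc_of_le hst, uIcc_affine, himg, uIcc_of_le hst] at this
  rw [controlLength, controlLength, this]
  refine lintegral_congr fun x => ?_
  rw [coreNorm_smul, ENNReal.ofReal_mul (abs_nonneg c)]

/-- Open intervals suffice because endpoints are null. In a concatenation the derivative may fail to
exist at the junction time. -/
theorem ae_restrict_Icc_union {P : ℝ → Prop} (hab : a ≤ b) (hbc : b ≤ c)
    (h₁ : ∀ᵐ t ∂(volume.restrict (Ioo a b)), P t) (h₂ : ∀ᵐ t ∂(volume.restrict (Ioo b c)), P t) :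
    ∀ᵐ t ∂(volume.restrict (Icc a c)), P t := by
  rw [restrict_Ioo_eq_restrict_Icc] at h₁ h₂
  rw [← Icc_union_Icc_eq_Icc hab hbc, ae_restrict_union_iff]
  exact ⟨h₁, h₂⟩

/-- Concatenation of horizontal curves. -/
theorem HorizontalOn.union (hab : a ≤ b) (hbc : b ≤ c) (h : HorizontalOn 𝓗 γ u a b)
    (h' : HorizontalOn 𝓗 γ' u' b c) (hb : γ b = γ' b) :
    HorizontalOn 𝓗 (fun t => if t ≤ b then γ t else γ' t) (fun t => if t < b then u t else u' t)
      a c := by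
  have e1 : ∀ t ≤ b, (if t ≤ b then γ t else γ' t) = γ t := fun t ht => if_pos ht
  have e2 : ∀ t, b ≤ t → (if t ≤ b then γ t else γ' t) = γ' t := fun t ht => by
    rcases ht.eq_or_lt with rfl | ht
    · simp [hb]
    · exact if_neg ht.not_ge
  refine ⟨?_, ?_, ?_, ?_⟩
  · rw [← Icc_union_Icc_eq_Icc hab hbc]
    exact (h.continuousOn.congr fun t ht => e1 t ht.2).union_of_isClosed
      (h'.continuousOn.congr fun t ht => e2 t ht.1) isClosed_Icc isClosed_Icc
  · intro p s t hs hst ht hsrc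
    have A1 : ∀ s' t', a ≤ s' → s' ≤ t' → t' ≤ b → Icc s' t' ⊆ Icc s t →
        AbsolutelyContinuousOnInterval
          (fun t => extChartAt 𝓘(ℝ, E) p (if t ≤ b then γ t else γ' t)) s' t' := by
      intro s' t' hs' hst' ht' hsub
      refine (h.ac p s' t' hs' hst' ht' fun x hx => ?_).congr fun x hx => ?_
      · have := hsrc x (hsub hx)
        rwa [e1 x (hx.2.trans ht')] at this
      · rw [uIcc_of_le hst'] at hx
        simp only [e1 x (hx.2.trans ht')]
    have A2 : ∀ s' t', b ≤ s' → s' ≤ t' → t' ≤ c → Icc s' t' ⊆ Icc s t →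
        AbsolutelyContinuousOnInterval
          (fun t => extChartAt 𝓘(ℝ, E) p (if t ≤ b then γ t else γ' t)) s' t' := by
      intro s' t' hs' hst' ht' hsub
      refine (h'.ac p s' t' hs' hst' ht' fun x hx => ?_).congr fun x hx => ?_
      · have := hsrc x (hsub hx)
        rwa [e2 x (hs'.trans hx.1)] at this
      · rw [uIcc_of_le hst'] at hx
        simp only [e2 x (hs'.trans hx.1)]
    rcases le_total t b with htb | htb
    · exact A1 s t hs hst htb subset_rfl
    rcases le_total b s with hbs | hbs
    · exact A2 s t hbs hst ht subset_rfl
    exact (A1 s b hs hbs le_rfl (Icc_subset_Icc_right htb)).union hbs htb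
      (A2 b t le_rfl htb ht (Icc_subset_Icc_left hbs))
  · refine ae_restrict_Icc_union hab hbc ?_ ?_
    · filter_upwards [ae_restrict_of_ae_restrict_of_subset Ioo_subset_Icc_self h.mem,
        ae_restrict_mem measurableSet_Ioo] with t ht htb
      rwa [if_pos htb.2]
    · filter_upwards [ae_restrict_of_ae_restrict_of_subset Ioo_subset_Icc_self h'.mem,
        ae_restrict_mem measurableSet_Ioo] with t ht htb
      rwa [if_neg htb.1.le.not_gt]
  · refine ae_restrict_Icc_union hab hbc ?_ ?_
    · filter_upwards [ae_restrict_of_ae_restrict_of_subset Ioo_subset_Icc_self h.hasDeriv,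
        ae_restrict_mem measurableSet_Ioo] with t ht htb
      rw [if_pos htb.2, if_pos htb.2.le]
      refine ht.congr_of_eventuallyEq ?_
      filter_upwards [Iio_mem_nhds htb.2] with x hx using if_pos (le_of_lt hx)
    · filter_upwards [ae_restrict_of_ae_restrict_of_subset Ioo_subset_Icc_self h'.hasDeriv,
        ae_restrict_mem measurableSet_Ioo] with t ht htb
      rw [if_neg htb.1.le.not_gt, if_neg htb.1.not_ge]
      refine ht.congr_of_eventuallyEq ?_
      filter_upwards [Ioi_mem_nhds htb.1] with x hx using if_neg (not_le.2 hx)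

theorem controlLength_add (ip : InnerProductSpace.Core ℝ (GroupLieAlgebra 𝓘(ℝ, E) G))
    (u : ℝ → GroupLieAlgebra 𝓘(ℝ, E) G) (hab : a ≤ b) (hbc : b ≤ c) :
    controlLength ip u a c = controlLength ip u a b + controlLength ip u b c := by
  simp only [controlLength]
  rw [setLIntegral_congr (Ico_ae_eq_Icc (a := a) (b := b)).symm,
    ← lintegral_union measurableSet_Icc, Ico_union_Icc_eq_Icc hab hbc]
  exact Set.disjoint_left.2 fun x hx hx' => hx.2.not_ge hx'.1

theorem controlLength_mono (ip : InnerProductSpace.Core ℝ (GroupLieAlgebra 𝓘(ℝ, E) G))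
    (u : ℝ → GroupLieAlgebra 𝓘(ℝ, E) G) (hc : a ≤ c) (hd : d ≤ b) :
    controlLength ip u c d ≤ controlLength ip u a b :=
  lintegral_mono_set (Icc_subset_Icc hc hd)

theorem controlLength_ite (ip : InnerProductSpace.Core ℝ (GroupLieAlgebra 𝓘(ℝ, E) G))
    (u u' : ℝ → GroupLieAlgebra 𝓘(ℝ, E) G) (hab : a ≤ b) (hbc : b ≤ c) :
    controlLength ip (fun t => if t < b then u t else u' t) a c =
      controlLength ip u a b + controlLength ip u' b c := by
  rw [controlLength_add ip _ hab hbc]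
  congr 1
  · simp only [controlLength]
    rw [← setLIntegral_congr (Ico_ae_eq_Icc (a := a) (b := b)),
      ← setLIntegral_congr (Ico_ae_eq_Icc (a := a) (b := b))]
    exact setLIntegral_congr_fun measurableSet_Ico fun t ht => by simp only [if_pos ht.2]
  · exact setLIntegral_congr_fun measurableSet_Icc fun t ht => by simp only [if_neg ht.1.not_gt]

end HorizontalCurves

/-! ### The Carnot–Carathéodory distance: triangle inequality, symmetry, left invariance. -/

section CCDistance

open Set Filter
open scoped Topology

variable {E : Type*} [NormedAddCommGroup E] [NormedSpace ℝ E]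
  {G : Type*} [TopologicalSpace G] [ChartedSpace E G] [Group G]

variable {𝓗 : Submodule ℝ (GroupLieAlgebra 𝓘(ℝ, E) G)}
  {γ γ' : ℝ → G} {u u' : ℝ → GroupLieAlgebra 𝓘(ℝ, E) G} {a b c d : ℝ}
  (ip : InnerProductSpace.Core ℝ (GroupLieAlgebra 𝓘(ℝ, E) G))

theorem ccEDist_le_controlLength {x y : G} (h : HorizontalOn 𝓗 γ u 0 1) (hx : γ 0 = x)
    (hy : γ 1 = y) : ccEDist ip 𝓗 x y ≤ controlLength ip u 0 1 :=
  iInf_le_of_le γ (iInf_le_of_le u (iInf_le_of_le (isHorizontalCurve_iff.2 ⟨h, hx, hy⟩) le_rfl))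

theorem exists_horizontalOn_of_ccEDist_lt {x y : G} {r : ℝ≥0∞} (h : ccEDist ip 𝓗 x y < r) :
    ∃ γ u, HorizontalOn 𝓗 γ u 0 1 ∧ γ 0 = x ∧ γ 1 = y ∧ controlLength ip u 0 1 < r := by
  simp only [ccEDist, iInf_lt_iff] at h
  obtain ⟨γ, u, hγ, hr⟩ := h
  obtain ⟨h1, h2, h3⟩ := isHorizontalCurve_iff.1 hγ
  exact ⟨γ, u, h1, h2, h3, hr⟩

theorem le_ccEDist {x y : G} {r : ℝ≥0∞} (h : ∀ γ u, HorizontalOn 𝓗 γ u 0 1 → γ 0 = x → γ 1 = y →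
    r ≤ controlLength ip u 0 1) : r ≤ ccEDist ip 𝓗 x y := by
  by_contra! hlt
  obtain ⟨γ, u, h1, h2, h3, h4⟩ := exists_horizontalOn_of_ccEDist_lt ip hlt
  exact h4.not_ge (h γ u h1 h2 h3)

theorem ccEDist_le_of_horizontalOn (hab : a < b) (h : HorizontalOn 𝓗 γ u a b) :
    ccEDist ip 𝓗 (γ a) (γ b) ≤ controlLength ip u a b := by
  have hc : b - a ≠ 0 := (sub_pos.2 hab).ne'
  have himg : uIcc ((b - a) * 0 + a) ((b - a) * 1 + a) = Icc a b := by
    rw [mul_zero, zero_add, mul_one, sub_add_cancel, uIcc_of_le hab.le]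
  rw [← controlLength_comp_affine ip u hc zero_le_one himg]
  exact ccEDist_le_controlLength ip (h.comp_affine hc zero_le_one himg) (by simp) (by simp)

theorem ccEDist_comm_le (x y : G) : ccEDist ip 𝓗 x y ≤ ccEDist ip 𝓗 y x := by
  refine le_ccEDist ip fun γ u h hx hy => ?_
  have himg : uIcc ((-1 : ℝ) * 0 + 1) ((-1) * 1 + 1) = Icc 0 1 := by
    norm_num [uIcc_of_ge]
  rw [← controlLength_comp_affine ip u (c := -1) (by norm_num) zero_le_one himg]
  exact ccEDist_le_controlLength ip (h.comp_affine (by norm_num) zero_le_one himg)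
    (by simpa using hy) (by simpa using hx)

theorem ccEDist_comm (x y : G) : ccEDist ip 𝓗 x y = ccEDist ip 𝓗 y x :=
  (ccEDist_comm_le ip x y).antisymm (ccEDist_comm_le ip y x)

theorem ccEDist_triangle (x y z : G) :
    ccEDist ip 𝓗 x z ≤ ccEDist ip 𝓗 x y + ccEDist ip 𝓗 y z := by
  by_contra! hlt
  have hne : ccEDist ip 𝓗 x y ≠ ⊤ ∧ ccEDist ip 𝓗 y z ≠ ⊤ := by
    have := (hlt.trans_le le_top).ne
    simpa using this
  obtain ⟨r, hr, hlt⟩ := ENNReal.lt_iff_exists_add_pos_lt.1 hlt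
  have hr2 : ((r / 2 : ℝ≥0) : ℝ≥0∞) ≠ 0 := by simpa using hr.ne'
  obtain ⟨γ, u, h, hx, hy, hl⟩ :=
    exists_horizontalOn_of_ccEDist_lt ip (ENNReal.lt_add_right hne.1 hr2)
  obtain ⟨γ', u', h', hy', hz', hl'⟩ :=
    exists_horizontalOn_of_ccEDist_lt ip (ENNReal.lt_add_right hne.2 hr2)
  -- The second curve is shifted to `[1,2]`, so that the concatenation lives on `[0,2]` and is
  -- rescaled afterwards.
  have himg : uIcc ((1 : ℝ) * 1 + (-1)) (1 * 2 + (-1)) = Icc 0 1 := by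
    norm_num [uIcc_of_le]
  have H := h.union zero_le_one one_le_two
    (h'.comp_affine (c := 1) (d := -1) one_ne_zero one_le_two himg) (by simp [hy, hy'])
  have K := ccEDist_le_of_horizontalOn ip zero_lt_two H
  rw [controlLength_ite ip _ _ zero_le_one one_le_two,
    controlLength_comp_affine ip u' one_ne_zero one_le_two himg] at K
  norm_num [hx, hz'] at K
  refine absurd (K.trans_lt (ENNReal.add_lt_add hl hl')) ?_
  rw [not_lt]
  calc _ = ccEDist ip 𝓗 x y + ccEDist ip 𝓗 y z + (((r / 2 : ℝ≥0) : ℝ≥0∞) + (r / 2 : ℝ≥0)) := by ring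
    _ = ccEDist ip 𝓗 x y + ccEDist ip 𝓗 y z + r := by
      rw [← ENNReal.coe_add, add_halves]
    _ ≤ _ := hlt.le

theorem ccEDist_self (x : G) : ccEDist ip 𝓗 x x = 0 := by
  refine le_antisymm ?_ zero_le
  have h : HorizontalOn 𝓗 (fun _ => x) (fun _ => 0) 0 1 := by
    refine ⟨continuousOn_const, fun p c d _ _ _ _ => ?_, ?_, ?_⟩
    · exact (LipschitzWith.const _ : LipschitzWith 0 _).lipschitzOnWith.absolutelyContinuousOnInterval
    · exact Eventually.of_forall fun _ => 𝓗.zero_mem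
    · refine Eventually.of_forall fun t => ?_
      have e : ContinuousLinearMap.toSpanSingleton ℝ
          (mulInvariantVectorField (I := 𝓘(ℝ, E)) (0 : GroupLieAlgebra 𝓘(ℝ, E) G) x) = 0 := by
        ext
        simp only [mulInvariantVectorField, map_zero]
        exact smul_zero _
      rw [e]
      exact hasMFDerivAt_const _ _
  refine (ccEDist_le_controlLength ip h rfl rfl).trans ?_
  have : coreNorm ip (0 : GroupLieAlgebra 𝓘(ℝ, E) G) = 0 := by
    have := coreNorm_smul ip 0 (0 : GroupLieAlgebra 𝓘(ℝ, E) G)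
    simpa using this
  simp [controlLength, this]

variable [LieGroup 𝓘(ℝ, E) ∞ G]

theorem mfderiv_mul_left_mulInvariantVectorField (v : GroupLieAlgebra 𝓘(ℝ, E) G) (g h : G) :
    mfderiv 𝓘(ℝ, E) 𝓘(ℝ, E) (g * ·) h (mulInvariantVectorField (I := 𝓘(ℝ, E)) v h) =
      mulInvariantVectorField (I := 𝓘(ℝ, E)) v (g * h) := by
  have D : ((g * h) * ·) = (fun x : G => g * x) ∘ (fun x => h * x) := by
    ext x; simp [mul_assoc]
  have hd : ∀ g h : G, MDifferentiableAt 𝓘(ℝ, E) 𝓘(ℝ, E) (g * ·) h := fun g h =>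
    (contMDiff_mul_left (I := 𝓘(ℝ, E)) (n := ∞)).contMDiffAt.mdifferentiableAt (by simp)
  simp only [mulInvariantVectorField]
  rw [D, mfderiv_comp (I' := 𝓘(ℝ, E)) _ (hd _ _) (hd _ _)]
  -- The chain rule produces the derivative at `h * 1` instead of `h`. Every tangent space is `E` by
  -- definition, so the base point can be rewritten in a map with values in `E →L[ℝ] E`.
  exact (congrArg (fun k : G => (show E →L[ℝ] E from mfderiv 𝓘(ℝ, E) 𝓘(ℝ, E) (g * ·) k)
    (mfderiv 𝓘(ℝ, E) 𝓘(ℝ, E) (h * ·) (1 : G) v)) (mul_one h)).symm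

/-- The control is unchanged because the fields are left-invariant. Absolute continuity is checked
near each time: read in charts, the translation is `C¹`, hence locally Lipschitz. -/
theorem HorizontalOn.mul_left (h : HorizontalOn 𝓗 γ u a b) (g : G) :
    HorizontalOn 𝓗 (fun t => g * γ t) u a b := by
  have hsm : ContMDiff 𝓘(ℝ, E) 𝓘(ℝ, E) ∞ (g * · : G → G) := contMDiff_mul_left
  refine ⟨hsm.continuous.comp_continuousOn h.continuousOn, ?_, h.mem, ?_⟩
  · intro p c d hc hcd hd hsrc
    refine AbsolutelyContinuousOnInterval.of_forall_exists_nhds hcd fun t ht => ?_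
    have htab : t ∈ Icc a b := ⟨hc.trans ht.1, ht.2.trans hd⟩
    set φ := extChartAt 𝓘(ℝ, E) (γ t) with hφ
    have hψ : ContDiffAt ℝ 1 (fun x => extChartAt 𝓘(ℝ, E) p (g * φ.symm x)) (φ (γ t)) := by
      rw [← contMDiffAt_iff_contDiffAt]
      have h1 : ContMDiffAt 𝓘(ℝ, E) 𝓘(ℝ, E) 1 φ.symm (φ (γ t)) :=
        (contMDiffOn_extChartAt_symm (n := 1) (γ t)).contMDiffAt (extChartAt_target_mem_nhds (γ t))
      have h2 : ContMDiffAt 𝓘(ℝ, E) 𝓘(ℝ, E) 1 (g * ·) (φ.symm (φ (γ t))) :=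
        (hsm.of_le (by exact_mod_cast le_top)).contMDiffAt
      have h3 : ContMDiffAt 𝓘(ℝ, E) 𝓘(ℝ, E) 1 (extChartAt 𝓘(ℝ, E) p)
          (g * φ.symm (φ (γ t))) := by
        refine contMDiffAt_extChartAt' ?_
        rw [extChartAt_to_inv, ← extChartAt_source 𝓘(ℝ, E)]
        exact hsrc t ht
      exact h3.comp (φ (γ t)) (h2.comp (φ (γ t)) h1)
    obtain ⟨K, N, hN, hK⟩ := hψ.exists_lipschitzOnWith
    have hev : ∀ᶠ s in 𝓝[Icc a b] t, γ s ∈ φ.source ∧ φ (γ s) ∈ N := by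
      have h1 := h.continuousOn t htab
      exact h1.eventually ((show ∀ᶠ y in 𝓝 (γ t), y ∈ φ.source from
        extChartAt_source_mem_nhds (γ t)).and ((continuousAt_extChartAt (γ t)).eventually_mem hN))
    rw [eventually_nhdsWithin_iff] at hev
    refine ⟨_, hev, fun s s' hs hss' hs' hsub => ?_⟩
    have hmem : ∀ y ∈ Icc s s', γ y ∈ φ.source ∧ φ (γ y) ∈ N := fun y hy =>
      hsub hy ⟨hc.trans (hs.trans hy.1), (hy.2.trans hs').trans hd⟩
    have hac := h.ac (γ t) s s' (hc.trans hs) hss' (hs'.trans hd) fun y hy => (hmem y hy).1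
    rw [← uIcc_of_le hss'] at hmem
    refine (hK.comp_absolutelyContinuousOnInterval hac fun y hy => (hmem y hy).2).congr ?_
    intro y hy
    simp only
    rw [φ.left_inv (hmem y hy).1]
  · filter_upwards [h.hasDeriv] with t ht
    have h1 : MDifferentiableAt 𝓘(ℝ, E) 𝓘(ℝ, E) (g * ·) (γ t) :=
      hsm.contMDiffAt.mdifferentiableAt (by simp)
    have := h1.hasMFDerivAt.comp t ht
    have e : ContinuousLinearMap.toSpanSingleton ℝ
          (mulInvariantVectorField (I := 𝓘(ℝ, E)) (u t) (g * γ t)) =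
        (mfderiv 𝓘(ℝ, E) 𝓘(ℝ, E) (g * ·) (γ t)).comp (ContinuousLinearMap.toSpanSingleton ℝ
          (mulInvariantVectorField (I := 𝓘(ℝ, E)) (u t) (γ t))) := by
      rw [← mfderiv_mul_left_mulInvariantVectorField]
      ext
      simp
    rw [e]
    exact this

theorem ccEDist_mul_left_le (g x y : G) : ccEDist ip 𝓗 (g * x) (g * y) ≤ ccEDist ip 𝓗 x y :=
  le_ccEDist ip fun _ _ h hx hy =>
    ccEDist_le_controlLength ip (h.mul_left g) (by rw [hx]) (by rw [hy])

theorem ccEDist_mul_left (g x y : G) : ccEDist ip 𝓗 (g * x) (g * y) = ccEDist ip 𝓗 x y := by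
  refine (ccEDist_mul_left_le ip g x y).antisymm ?_
  simpa using ccEDist_mul_left_le ip (𝓗 := 𝓗) g⁻¹ (g * x) (g * y)

end CCDistance

/-! ### Left-invariant fields read in the chart at the identity. -/

section ChartAtOne

open Set Filter
open scoped Topology

variable {E : Type*} [NormedAddCommGroup E] [NormedSpace ℝ E]
  {G : Type*} [TopologicalSpace G] [ChartedSpace E G] [Group G]

variable (E G) in
/-- The group law read in the chart at the identity. -/
noncomputable def chartMul (p : E × E) : E :=
  extChartAt 𝓘(ℝ, E) (1 : G)
    ((extChartAt 𝓘(ℝ, E) (1 : G)).symm p.1 * (extChartAt 𝓘(ℝ, E) (1 : G)).symm p.2)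

variable (E G) in
/-- The derivative at the identity of the left translations, in the chart at the identity. -/
noncomputable def chartLeft (x : E) : E →L[ℝ] E :=
  fderiv ℝ (fun y => chartMul E G (x, y)) (extChartAt 𝓘(ℝ, E) (1 : G) 1)

variable [LieGroup 𝓘(ℝ, E) ∞ G]

theorem contDiffAt_chartMul {p : E × E} (h1 : p.1 ∈ (extChartAt 𝓘(ℝ, E) (1 : G)).target)
    (h2 : p.2 ∈ (extChartAt 𝓘(ℝ, E) (1 : G)).target)
    (h3 : (extChartAt 𝓘(ℝ, E) (1 : G)).symm p.1 * (extChartAt 𝓘(ℝ, E) (1 : G)).symm p.2 ∈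
      (extChartAt 𝓘(ℝ, E) (1 : G)).source) : ContDiffAt ℝ ∞ (chartMul E G) p := by
  rw [← contMDiffAt_iff_contDiffAt]
  have hs : ∀ x ∈ (extChartAt 𝓘(ℝ, E) (1 : G)).target,
      ContMDiffAt 𝓘(ℝ, E) 𝓘(ℝ, E) ∞ (extChartAt 𝓘(ℝ, E) (1 : G)).symm x := fun x hx =>
    (contMDiffOn_extChartAt_symm (n := ∞) (1 : G)).contMDiffAt
      ((isOpen_extChartAt_target (1 : G)).mem_nhds hx)
  have ha : ContMDiffAt 𝓘(ℝ, E × E) 𝓘(ℝ, E) ∞ (fun p : E × E =>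
      (extChartAt 𝓘(ℝ, E) (1 : G)).symm p.1) p :=
    (hs _ h1).comp p contDiffAt_fst.contMDiffAt
  have hb : ContMDiffAt 𝓘(ℝ, E × E) 𝓘(ℝ, E) ∞ (fun p : E × E =>
      (extChartAt 𝓘(ℝ, E) (1 : G)).symm p.2) p :=
    (hs _ h2).comp p contDiffAt_snd.contMDiffAt
  have hφ : ContMDiffAt 𝓘(ℝ, E) 𝓘(ℝ, E) ∞ (extChartAt 𝓘(ℝ, E) (1 : G))
      ((extChartAt 𝓘(ℝ, E) (1 : G)).symm p.1 * (extChartAt 𝓘(ℝ, E) (1 : G)).symm p.2) :=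
    contMDiffAt_extChartAt' (by rwa [← extChartAt_source 𝓘(ℝ, E)])
  exact hφ.comp p (ha.mul hb)

theorem contDiffAt_chartMul_left {x : E} (hx : x ∈ (extChartAt 𝓘(ℝ, E) (1 : G)).target) :
    ContDiffAt ℝ ∞ (chartMul E G) (x, extChartAt 𝓘(ℝ, E) (1 : G) 1) := by
  refine contDiffAt_chartMul hx (mem_extChartAt_target (1 : G)) ?_
  simpa using (extChartAt 𝓘(ℝ, E) (1 : G)).map_target hx

omit [LieGroup 𝓘(ℝ, E) ∞ G] in
theorem chartMul_one_left {x : E} (hx : x ∈ (extChartAt 𝓘(ℝ, E) (1 : G)).target) :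
    chartMul E G (extChartAt 𝓘(ℝ, E) (1 : G) 1, x) = x := by
  rw [chartMul, extChartAt_to_inv, one_mul, (extChartAt 𝓘(ℝ, E) (1 : G)).right_inv hx]

/-- Expressing the partial derivative through the full derivative of the group law makes its
smoothness in `x` visible. -/
theorem chartLeft_eq {x : E} (hx : x ∈ (extChartAt 𝓘(ℝ, E) (1 : G)).target) :
    chartLeft E G x = (fderiv ℝ (chartMul E G) (x, extChartAt 𝓘(ℝ, E) (1 : G) 1)).comp
      (ContinuousLinearMap.inr ℝ E E) := by
  have h := ((contDiffAt_chartMul_left hx).differentiableAt (by simp)).hasFDerivAt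
  exact (h.comp _ (hasFDerivAt_prodMk_right x _)).fderiv

theorem contDiffAt_chartLeft {x : E} (hx : x ∈ (extChartAt 𝓘(ℝ, E) (1 : G)).target) :
    ContDiffAt ℝ ∞ (chartLeft E G) x := by
  have h1 : ContDiffAt ℝ ∞ (fun x : E => (fderiv ℝ (chartMul E G)
      (x, extChartAt 𝓘(ℝ, E) (1 : G) 1)).comp (ContinuousLinearMap.inr ℝ E E)) x := by
    have h2 : ContDiffAt ℝ ∞ (fderiv ℝ (chartMul E G)) (x, extChartAt 𝓘(ℝ, E) (1 : G) 1) :=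
      (contDiffAt_chartMul_left hx).fderiv_right (by simp)
    exact (h2.comp x (contDiffAt_id.prodMk contDiffAt_const)).clm_comp contDiffAt_const
  refine h1.congr_of_eventuallyEq ?_
  filter_upwards [(isOpen_extChartAt_target (1 : G)).mem_nhds hx] with y hy using chartLeft_eq hy

omit [LieGroup 𝓘(ℝ, E) ∞ G] in
theorem mfderiv_one_eq_fderiv {f : G → E} (hf : MDifferentiableAt 𝓘(ℝ, E) 𝓘(ℝ, E) f 1) :
    mfderiv 𝓘(ℝ, E) 𝓘(ℝ, E) f 1 = fderiv ℝ (f ∘ (extChartAt 𝓘(ℝ, E) (1 : G)).symm)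
      (extChartAt 𝓘(ℝ, E) (1 : G) 1) := by
  refine hf.mfderiv.trans ?_
  simp only [writtenInExtChartAt, extChartAt_model_space_eq_id, PartialEquiv.refl_coe,
    modelWithCornersSelf_coe, range_id, fderivWithin_univ]
  rfl

theorem mfderiv_extChartAt_mulInvariantVectorField (v : GroupLieAlgebra 𝓘(ℝ, E) G) {g : G}
    (hg : g ∈ (extChartAt 𝓘(ℝ, E) (1 : G)).source) :
    mfderiv 𝓘(ℝ, E) 𝓘(ℝ, E) (extChartAt 𝓘(ℝ, E) (1 : G)) g
      (mulInvariantVectorField (I := 𝓘(ℝ, E)) v g) =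
    chartLeft E G (extChartAt 𝓘(ℝ, E) (1 : G) g) v := by
  have hL : MDifferentiableAt 𝓘(ℝ, E) 𝓘(ℝ, E) (g * ·) (1 : G) :=
    (contMDiff_mul_left (I := 𝓘(ℝ, E)) (n := ∞)).contMDiffAt.mdifferentiableAt (by simp)
  have hφ : ∀ k : G, k = g → MDifferentiableAt 𝓘(ℝ, E) 𝓘(ℝ, E) (extChartAt 𝓘(ℝ, E) (1 : G)) k :=
    fun k hk => by
      rw [hk]
      exact (contMDiffAt_extChartAt' (n := ∞)
        (by rwa [← extChartAt_source 𝓘(ℝ, E)])).mdifferentiableAt (by simp)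
  have e := mfderiv_comp (I' := 𝓘(ℝ, E)) (1 : G) (hφ _ (mul_one g)) hL
  have hcomp : MDifferentiableAt 𝓘(ℝ, E) 𝓘(ℝ, E)
      (extChartAt 𝓘(ℝ, E) (1 : G) ∘ (g * ·)) (1 : G) := (hφ _ (mul_one g)).comp _ hL
  rw [mfderiv_one_eq_fderiv hcomp] at e
  have e2 : (extChartAt 𝓘(ℝ, E) (1 : G) ∘ (g * ·)) ∘ (extChartAt 𝓘(ℝ, E) (1 : G)).symm =
      fun y => chartMul E G (extChartAt 𝓘(ℝ, E) (1 : G) g, y) := by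
    ext y
    simp only [chartMul, (extChartAt 𝓘(ℝ, E) (1 : G)).left_inv hg, Function.comp_apply]
  rw [e2] at e
  refine Eq.trans ?_ (congrArg (fun T : E →L[ℝ] E => T v) e).symm
  exact (congrArg (fun k : G => (show E →L[ℝ] E from
    mfderiv 𝓘(ℝ, E) 𝓘(ℝ, E) (extChartAt 𝓘(ℝ, E) (1 : G)) k)
    (mfderiv 𝓘(ℝ, E) 𝓘(ℝ, E) (g * ·) (1 : G) v)) (mul_one g)).symm

/-- In the chart a horizontal curve solves `x' = chartLeft x u`, the form in which length controls
displacement. -/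
theorem HasMFDerivAt.hasDerivAt_chart {γ : ℝ → G} {t : ℝ} {v : GroupLieAlgebra 𝓘(ℝ, E) G}
    (h : HasMFDerivAt 𝓘(ℝ, ℝ) 𝓘(ℝ, E) γ t (ContinuousLinearMap.toSpanSingleton ℝ
        (mulInvariantVectorField (I := 𝓘(ℝ, E)) v (γ t))))
    (ht : γ t ∈ (extChartAt 𝓘(ℝ, E) (1 : G)).source) :
    HasDerivAt (fun s => extChartAt 𝓘(ℝ, E) (1 : G) (γ s))
      (chartLeft E G (extChartAt 𝓘(ℝ, E) (1 : G) (γ t)) v) t := by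
  have hφ : MDifferentiableAt 𝓘(ℝ, E) 𝓘(ℝ, E) (extChartAt 𝓘(ℝ, E) (1 : G)) (γ t) :=
    (contMDiffAt_extChartAt' (n := ∞)
        (by rwa [← extChartAt_source 𝓘(ℝ, E)])).mdifferentiableAt (by simp)
  have := hφ.hasMFDerivAt.comp t h
  rw [hasMFDerivAt_iff_hasFDerivAt] at this
  rw [hasDerivAt_iff_hasFDerivAt]
  refine HasFDerivAt.congr_fderiv this (ContinuousLinearMap.ext fun s => ?_)
  rw [← mfderiv_extChartAt_mulInvariantVectorField v ht]
  exact (mfderiv 𝓘(ℝ, E) 𝓘(ℝ, E) (extChartAt 𝓘(ℝ, E) (1 : G)) (γ t)).map_smul s _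

end ChartAtOne

/-! ### Short horizontal curves stay near their origin; balls are relatively compact. -/

section LengthBounds

open Set Filter
open scoped Topology Pointwise

/-- The scalar product bears no relation to the norm of `E`; finite dimension makes them comparable.
-/
theorem InnerProductSpace.Core.exists_norm_map_le {V W : Type*} [AddCommGroup V] [Module ℝ V]
    [FiniteDimensional ℝ V] [NormedAddCommGroup W] [NormedSpace ℝ W]
    (ip : InnerProductSpace.Core ℝ V) (f : V →ₗ[ℝ] W) :
    ∃ C : ℝ, 0 < C ∧ ∀ v, ‖f v‖ ≤ C * Real.sqrt (ip.inner v v) := by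
  let _ : NormedAddCommGroup V := ip.toNormedAddCommGroup
  let _ : InnerProductSpace ℝ V := InnerProductSpace.ofCore ip.toCore
  obtain ⟨C, hC, h⟩ := (LinearMap.toContinuousLinearMap f).bound
  exact ⟨C, hC, h⟩

/-- A norming functional reduces the vector-valued inequality to the fundamental theorem of calculus
for real absolutely continuous functions. -/
theorem AbsolutelyContinuousOnInterval.ofReal_norm_sub_le {E : Type*} [NormedAddCommGroup E]
    [NormedSpace ℝ E] {f : ℝ → E} {a b : ℝ} (hab : a ≤ b)
    (hf : AbsolutelyContinuousOnInterval f a b) {g : ℝ → ℝ≥0∞}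
    (hg : ∀ᵐ t ∂(volume.restrict (Icc a b)), ∃ f', HasDerivAt f f' t ∧ ENNReal.ofReal ‖f'‖ ≤ g t) :
    ENNReal.ofReal ‖f b - f a‖ ≤ ∫⁻ t in Icc a b, g t := by
  obtain ⟨l, hl1, hl2⟩ := exists_dual_vector'' ℝ (f b - f a)
  have hac : AbsolutelyContinuousOnInterval (fun t => l (f t)) a b :=
    (l.lipschitz.lipschitzOnWith (s := univ)).comp_absolutelyContinuousOnInterval hf
      (mapsTo_univ _ _)
  have h1 := hac.integral_deriv_eq_sub
  have h2 : ‖f b - f a‖ = ∫ t in a..b, deriv (fun t => l (f t)) t := by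
    rw [h1, ← map_sub, hl2]; rfl
  rw [h2, intervalIntegral.integral_of_le hab, ← integral_Icc_eq_integral_Ioc]
  refine (ENNReal.ofReal_le_ofReal (le_abs_self _)).trans ?_
  rw [← Real.norm_eq_abs, ofReal_norm]
  refine (enorm_integral_le_lintegral_enorm _).trans ?_
  refine lintegral_mono_ae ?_
  filter_upwards [hg] with t ⟨f', hf', ht⟩
  have hd : HasDerivAt (fun t => l (f t)) (l f') t := l.hasFDerivAt.comp_hasDerivAt t hf'
  rw [hd.deriv, ← ofReal_norm]
  refine le_trans (ENNReal.ofReal_le_ofReal ?_) ht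
  exact (l.le_opNorm f').trans (mul_le_of_le_one_left (norm_nonneg _) hl1)

theorem ContinuousOn.exists_first_exit {X : Type*} [TopologicalSpace X] {γ : ℝ → X} {a b t : ℝ}
    {W : Set X} (hγ : ContinuousOn γ (Icc a b)) (hW : IsOpen W) (ha : γ a ∈ W) (ht : t ∈ Icc a b)
    (htW : γ t ∉ W) : ∃ τ ∈ Ioc a b, γ τ ∉ W ∧ ∀ s ∈ Ico a τ, γ s ∈ W := by
  have hcl : IsClosed (Icc a b ∩ γ ⁻¹' Wᶜ) := hγ.preimage_isClosed_of_isClosed isClosed_Icc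
    hW.isClosed_compl
  have hbdd : BddBelow (Icc a b ∩ γ ⁻¹' Wᶜ) := ⟨a, fun s hs => hs.1.1⟩
  have hmem := hcl.csInf_mem ⟨t, ht, htW⟩ hbdd
  refine ⟨_, ⟨lt_of_le_of_ne hmem.1.1 ?_, hmem.1.2⟩, hmem.2, fun s hs => ?_⟩
  · intro h
    exact hmem.2 (h ▸ ha)
  · by_contra hsW
    exact (csInf_le hbdd ⟨⟨hs.1, hs.2.le.trans hmem.1.2⟩, hsW⟩).not_gt hs.2

theorem ContinuousOn.mem_of_forall_Ico {X : Type*} [TopologicalSpace X] {γ : ℝ → X} {a b τ : ℝ}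
    {C : Set X} (hγ : ContinuousOn γ (Icc a b)) (hC : IsClosed C) (hτ : τ ∈ Ioc a b)
    (h : ∀ s ∈ Ico a τ, γ s ∈ C) : γ τ ∈ C := by
  have h1 : ContinuousWithinAt γ (Ico a τ) τ := (hγ τ (Ioc_subset_Icc_self hτ)).mono
    fun s hs => ⟨hs.1, hs.2.le.trans hτ.2⟩
  have h2 : τ ∈ closure (Ico a τ) := by
    rw [closure_Ico hτ.1.ne]; exact right_mem_Icc.2 hτ.1.le
  exact hC.closure_subset (closure_mono (image_subset_iff.2 h) (h1.mem_closure_image h2))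

variable {E : Type*} [NormedAddCommGroup E] [NormedSpace ℝ E] [FiniteDimensional ℝ E]
  {G : Type*} [TopologicalSpace G] [ChartedSpace E G] [Group G] [LieGroup 𝓘(ℝ, E) ∞ G]
  [T2Space G]

/-- Short horizontal curves starting at the identity remain close to it. -/
theorem exists_forall_horizontalOn_one_mem
    (ip : InnerProductSpace.Core ℝ (GroupLieAlgebra 𝓘(ℝ, E) G))
    (𝓗 : Submodule ℝ (GroupLieAlgebra 𝓘(ℝ, E) G)) {U : Set G} (hU : U ∈ 𝓝 (1 : G)) :
    ∃ r : ℝ, 0 < r ∧ ∀ (γ : ℝ → G) (u : ℝ → GroupLieAlgebra 𝓘(ℝ, E) G) (a b : ℝ),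
      HorizontalOn 𝓗 γ u a b → γ a = 1 → controlLength ip u a b < ENNReal.ofReal r →
      ∀ t ∈ Icc a b, γ t ∈ U := by
  set φ := extChartAt 𝓘(ℝ, E) (1 : G) with hφ
  have : FiniteDimensional ℝ (GroupLieAlgebra 𝓘(ℝ, E) G) := inferInstanceAs (FiniteDimensional ℝ E)
  obtain ⟨C, hC, hip⟩ := InnerProductSpace.Core.exists_norm_map_le (W := E)
    (V := GroupLieAlgebra 𝓘(ℝ, E) G) ip LinearMap.id
  have hz : φ 1 ∈ φ.target := mem_extChartAt_target (1 : G)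
  have hLc : ContinuousAt (chartLeft E G) (φ 1) := (contDiffAt_chartLeft hz).continuousAt
  have hM : ∀ᶠ x in 𝓝 (φ 1), ‖chartLeft E G x‖ < ‖chartLeft E G (φ 1)‖ + 1 :=
    hLc.norm.eventually_lt_const (lt_add_one _)
  set M := ‖chartLeft E G (φ 1)‖ + 1 with hMdef
  have hMpos : 0 < M := by positivity
  have hUev : ∀ᶠ x in 𝓝 (φ 1), φ.symm x ∈ U :=
    (continuousAt_extChartAt_symm (I := 𝓘(ℝ, E)) (1 : G)).eventually_mem (by simpa [φ] using hU)
  have hT : ∀ᶠ x in 𝓝 (φ 1), x ∈ φ.target := (isOpen_extChartAt_target (1 : G)).mem_nhds hz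
  obtain ⟨ρ, hρ, hball⟩ := Metric.eventually_nhds_iff_ball.1 (hM.and (hUev.and hT))
  have hWo : IsOpen (φ.source ∩ φ ⁻¹' Metric.ball (φ 1) ρ) :=
    (continuousOn_extChartAt (1 : G)).isOpen_inter_preimage (isOpen_extChartAt_source (1 : G))
      Metric.isOpen_ball
  have hWU : φ.source ∩ φ ⁻¹' Metric.ball (φ 1) ρ ⊆ U := fun g hg => by
    have := (hball _ hg.2).2.1
    rwa [φ.left_inv hg.1] at this
  -- While the curve stays in the chart ball of radius `ρ` its speed is at most `M * C` times the
  -- norm of `u`, so this length keeps it within `ρ / 2` of the centre.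
  refine ⟨ρ / (2 * (M * C)), by positivity, fun γ u a b h ha hlen t ht => ?_⟩
  by_contra htU
  have haW : γ a ∈ φ.source ∩ φ ⁻¹' Metric.ball (φ 1) ρ := by
    rw [ha]
    exact ⟨mem_extChartAt_source (1 : G), Metric.mem_ball_self hρ⟩
  obtain ⟨τ, hτ, hτW, hin⟩ := h.continuousOn.exists_first_exit hWo haW ht fun hW => htU (hWU hW)
  have hbd : ∀ s ∈ Ico a τ, ‖φ (γ s) - φ 1‖ ≤ ρ / 2 := by
    intro s hs
    have hsb : s ≤ b := hs.2.le.trans hτ.2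
    have hsrc : ∀ x ∈ Icc a s, γ x ∈ φ.source ∩ φ ⁻¹' Metric.ball (φ 1) ρ := fun x hx =>
      hin x ⟨hx.1, hx.2.trans_lt hs.2⟩
    have hac := h.ac 1 a s le_rfl hs.1 hsb fun x hx => (hsrc x hx).1
    have hm := h.mono le_rfl hsb
    have hle := hac.ofReal_norm_sub_le hs.1
      (g := fun x => ENNReal.ofReal (M * C) * ENNReal.ofReal (coreNorm ip (u x))) (by
        filter_upwards [hm.hasDeriv, ae_restrict_mem measurableSet_Icc] with x hx hxm
        refine ⟨_, hx.hasDerivAt_chart (hsrc x hxm).1, ?_⟩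
        rw [← ENNReal.ofReal_mul (by positivity)]
        refine ENNReal.ofReal_le_ofReal ?_
        refine ((chartLeft E G _).le_opNorm (u x)).trans ?_
        rw [mul_assoc]
        exact mul_le_mul (hball _ (hsrc x hxm).2).1.le (hip (u x)) (norm_nonneg _) hMpos.le)
    rw [lintegral_const_mul' _ _ ENNReal.ofReal_ne_top, ha] at hle
    have h3 : controlLength ip u a s < ENNReal.ofReal (ρ / (2 * (M * C))) :=
      (controlLength_mono ip u le_rfl hsb).trans_lt hlen
    have h4 : ENNReal.ofReal ‖φ (γ s) - φ 1‖ ≤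
        ENNReal.ofReal (M * C) * ENNReal.ofReal (ρ / (2 * (M * C))) := hle.trans (by gcongr; exact h3.le)
    rw [← ENNReal.ofReal_mul (by positivity), ENNReal.ofReal_le_ofReal_iff (by positivity)] at h4
    refine h4.trans_eq ?_
    field_simp
  have hsub : Metric.closedBall (φ 1) (ρ / 2) ⊆ Metric.ball (φ 1) ρ :=
    Metric.closedBall_subset_ball (by linarith)
  -- The exit point could a priori lie outside the chart domain. As `G` is Hausdorff this compact
  -- image is closed, so it contains the exit point, which is a contradiction.
  have hK : IsCompact (φ.symm '' Metric.closedBall (φ 1) (ρ / 2)) :=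
    (isCompact_closedBall _ _).image_of_continuousOn
      ((continuousOn_extChartAt_symm (1 : G)).mono fun x hx => (hball x (hsub hx)).2.2)
  obtain ⟨x, hx, hxτ⟩ := h.continuousOn.mem_of_forall_Ico hK.isClosed hτ fun s hs =>
    ⟨φ (γ s), by rw [mem_closedBall_iff_norm]; exact hbd s hs, φ.left_inv (hin s hs).1⟩
  have hxt := (hball x (hsub hx)).2.2
  refine hτW ?_
  rw [← hxτ]
  refine ⟨φ.map_target hxt, ?_⟩
  rw [mem_preimage, φ.right_inv hxt]
  exact hsub hx

theorem exists_forall_horizontalOn_mem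
    (ip : InnerProductSpace.Core ℝ (GroupLieAlgebra 𝓘(ℝ, E) G))
    (𝓗 : Submodule ℝ (GroupLieAlgebra 𝓘(ℝ, E) G)) {U : Set G} (hU : U ∈ 𝓝 (1 : G)) :
    ∃ r : ℝ, 0 < r ∧ ∀ (γ : ℝ → G) (u : ℝ → GroupLieAlgebra 𝓘(ℝ, E) G) (a b : ℝ),
      HorizontalOn 𝓗 γ u a b → controlLength ip u a b < ENNReal.ofReal r →
      ∀ t ∈ Icc a b, (γ a)⁻¹ * γ t ∈ U := by
  obtain ⟨r, hr, H⟩ := exists_forall_horizontalOn_one_mem ip 𝓗 hU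
  exact ⟨r, hr, fun γ u a b h hl t ht => H _ u a b (h.mul_left (γ a)⁻¹) (by simp) hl t ht⟩

theorem exists_ccBall_subset (ip : InnerProductSpace.Core ℝ (GroupLieAlgebra 𝓘(ℝ, E) G))
    (𝓗 : Submodule ℝ (GroupLieAlgebra 𝓘(ℝ, E) G)) {U : Set G} (hU : U ∈ 𝓝 (1 : G)) :
    ∃ r : ℝ, 0 < r ∧ ccBall ip 𝓗 1 r ⊆ U := by
  obtain ⟨r, hr, H⟩ := exists_forall_horizontalOn_one_mem ip 𝓗 hU
  refine ⟨r, hr, fun y hy => ?_⟩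
  obtain ⟨γ, u, h, h0, h1, hl⟩ := exists_horizontalOn_of_ccEDist_lt ip hy
  exact h1 ▸ H γ u 0 1 h h0 hl 1 (right_mem_Icc.2 zero_le_one)

/-- Balls for the Carnot–Carathéodory distance are relatively compact. -/
theorem exists_isCompact_ccBall_subset (ip : InnerProductSpace.Core ℝ (GroupLieAlgebra 𝓘(ℝ, E) G))
    (𝓗 : Submodule ℝ (GroupLieAlgebra 𝓘(ℝ, E) G)) (R : ℝ) :
    ∃ K : Set G, IsCompact K ∧ ccBall ip 𝓗 1 R ⊆ K := by
  have : IsTopologicalGroup G := topologicalGroup_of_lieGroup 𝓘(ℝ, E) ∞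
  have : LocallyCompactSpace G := ChartedSpace.locallyCompactSpace E G
  obtain ⟨K, hK, hK1⟩ := exists_compact_mem_nhds (1 : G)
  have hint : interior K ∈ 𝓝 (1 : G) := interior_mem_nhds.2 hK1
  obtain ⟨r, hr, H⟩ := exists_forall_horizontalOn_mem ip 𝓗 hint
  have key : ∀ n : ℕ, ∃ C : Set G, IsCompact C ∧ ∀ (γ : ℝ → G)
      (u : ℝ → GroupLieAlgebra 𝓘(ℝ, E) G) (a b : ℝ), a ≤ b → HorizontalOn 𝓗 γ u a b →
      controlLength ip u a b < (n + 1) * ENNReal.ofReal r → (γ a)⁻¹ * γ b ∈ C := by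
    intro n
    induction n with
    | zero =>
      refine ⟨K, hK, fun γ u a b hab h hl => interior_subset (H γ u a b h ?_ b
        (right_mem_Icc.2 hab))⟩
      simpa using hl
    | succ n ih =>
      obtain ⟨C, hC, hCin⟩ := ih
      -- If the displacement ends outside the interior of `K`, the curve has spent length at least
      -- `r` by its first exit, at a point of `K`. The rest is short enough for the induction
      -- hypothesis, and displacements multiply.
      refine ⟨K ∪ K * C, hK.union (hK.mul hC), fun γ u a b hab h hl => ?_⟩
      by_cases hb : (γ a)⁻¹ * γ b ∈ interior K
      · exact Or.inl (interior_subset hb)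
      right
      have hcont := (h.mul_left (γ a)⁻¹).continuousOn
      obtain ⟨τ, hτ, hτW, hin⟩ := hcont.exists_first_exit isOpen_interior
        (by simpa using mem_of_mem_nhds hint) (right_mem_Icc.2 hab) hb
      have hτK := hcont.mem_of_forall_Ico hK.isClosed hτ fun s hs => interior_subset (hin s hs)
      have hlen : ENNReal.ofReal r ≤ controlLength ip u a τ := by
        by_contra! hlt
        exact hτW (H γ u a τ (h.mono le_rfl hτ.2) hlt τ (right_mem_Icc.2 hτ.1.le))
      refine ⟨_, hτK, (γ τ)⁻¹ * γ b, hCin γ u τ b hτ.2 (h.mono hτ.1.le le_rfl) ?_, by group⟩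
      by_contra! hge
      refine hl.not_ge ?_
      rw [controlLength_add ip u hτ.1.le hτ.2]
      calc _ = ENNReal.ofReal r + (n + 1) * ENNReal.ofReal r := by push_cast; ring
        _ ≤ _ := add_le_add hlen hge
  obtain ⟨n, hn⟩ := exists_nat_gt (R / r)
  obtain ⟨C, hC, hCin⟩ := key n
  refine ⟨C, hC, fun y hy => ?_⟩
  obtain ⟨γ, u, h, h0, h1, hl⟩ := exists_horizontalOn_of_ccEDist_lt ip hy
  have := hCin γ u 0 1 zero_le_one h (hl.trans_le ?_)
  · simpa [h0, h1] using this
  · rw [div_lt_iff₀ hr] at hn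
    calc ENNReal.ofReal R ≤ ENNReal.ofReal ((n + 1) * r) :=
          ENNReal.ofReal_le_ofReal (by nlinarith)
      _ = _ := by
        rw [ENNReal.ofReal_mul (by positivity), ENNReal.ofReal_add (by positivity) zero_le_one]
        simp

end LengthBounds

/-! ### The Lie bracket in terms of the derivative of `chartLeft`. -/

section BracketInChart

open Set Filter VectorField
open scoped Topology

variable {E : Type*} [NormedAddCommGroup E] [NormedSpace ℝ E]
  {G : Type*} [TopologicalSpace G] [ChartedSpace E G] [Group G] [LieGroup 𝓘(ℝ, E) ∞ G]

omit [LieGroup 𝓘(ℝ, E) ∞ G] in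
theorem chartLeft_one : chartLeft E G (extChartAt 𝓘(ℝ, E) (1 : G) 1) =
    ContinuousLinearMap.id ℝ E := by
  have h : (fun y => chartMul E G (extChartAt 𝓘(ℝ, E) (1 : G) 1, y))
      =ᶠ[𝓝 (extChartAt 𝓘(ℝ, E) (1 : G) 1)] id := by
    filter_upwards [extChartAt_target_mem_nhds (I := 𝓘(ℝ, E)) (1 : G)] with y hy
      using chartMul_one_left hy
  rw [chartLeft, h.fderiv_eq, fderiv_id]

omit [LieGroup 𝓘(ℝ, E) ∞ G] in
theorem mfderiv_extChartAt_one : (mfderiv 𝓘(ℝ, E) 𝓘(ℝ, E) (extChartAt 𝓘(ℝ, E) (1 : G)) 1 :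
    E →L[ℝ] E) = ContinuousLinearMap.id ℝ E := by
  have hd : MDifferentiableAt 𝓘(ℝ, E) 𝓘(ℝ, E) (extChartAt 𝓘(ℝ, E) (1 : G)) 1 :=
    (contMDiffAt_extChartAt (n := ∞)).mdifferentiableAt (by simp)
  refine (mfderiv_one_eq_fderiv hd).trans ?_
  have h : (extChartAt 𝓘(ℝ, E) (1 : G)) ∘ (extChartAt 𝓘(ℝ, E) (1 : G)).symm
      =ᶠ[𝓝 (extChartAt 𝓘(ℝ, E) (1 : G) 1)] id := by
    filter_upwards [extChartAt_target_mem_nhds (I := 𝓘(ℝ, E)) (1 : G)] with y hy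
      using (extChartAt 𝓘(ℝ, E) (1 : G)).right_inv hy
  rw [h.fderiv_eq, fderiv_id]

theorem mpullbackWithin_mulInvariantVectorField_eq (v : GroupLieAlgebra 𝓘(ℝ, E) G) {x : E}
    (hx : x ∈ (extChartAt 𝓘(ℝ, E) (1 : G)).target) :
    mpullbackWithin 𝓘(ℝ, E) 𝓘(ℝ, E) (extChartAt 𝓘(ℝ, E) (1 : G)).symm
      (mulInvariantVectorField v) (range 𝓘(ℝ, E)) x = chartLeft E G x v := by
  have : IsManifold 𝓘(ℝ, E) 1 G := IsManifold.of_le (n := ∞) (by exact_mod_cast le_top)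
  rw [mpullbackWithin_apply, ContinuousLinearMap.inverse_eq
    (mfderivWithin_extChartAt_symm_comp_mfderiv_extChartAt hx)
    (mfderiv_extChartAt_comp_mfderivWithin_extChartAt_symm hx)]
  have h := mfderiv_extChartAt_mulInvariantVectorField v
    ((extChartAt 𝓘(ℝ, E) (1 : G)).map_target hx)
  rw [(extChartAt 𝓘(ℝ, E) (1 : G)).right_inv hx] at h
  exact h

theorem fderiv_chartLeft_apply (X v : E) :
    fderiv ℝ (fun x => chartLeft E G x v) (extChartAt 𝓘(ℝ, E) (1 : G) 1) X =
      fderiv ℝ (chartLeft E G) (extChartAt 𝓘(ℝ, E) (1 : G) 1) X v := by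
  have h : DifferentiableAt ℝ (chartLeft E G) (extChartAt 𝓘(ℝ, E) (1 : G) 1) :=
    (contDiffAt_chartLeft (mem_extChartAt_target (1 : G))).differentiableAt (by simp)
  rw [(h.hasFDerivAt.clm_apply (hasFDerivAt_const v _)).fderiv]
  simp

/-- Stated for plain maps `E → E`, so that the computation involves no tangent space types. -/
theorem lieBracketWithin_univ_eq_fderiv_chartLeft {A B : E → E} {X v : E}
    (hA : A =ᶠ[𝓝 (extChartAt 𝓘(ℝ, E) (1 : G) 1)] fun x => chartLeft E G x X)
    (hB : B =ᶠ[𝓝 (extChartAt 𝓘(ℝ, E) (1 : G) 1)] fun x => chartLeft E G x v) :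
    lieBracketWithin ℝ A B univ (extChartAt 𝓘(ℝ, E) (1 : G) 1) =
      fderiv ℝ (chartLeft E G) (extChartAt 𝓘(ℝ, E) (1 : G) 1) X v -
        fderiv ℝ (chartLeft E G) (extChartAt 𝓘(ℝ, E) (1 : G) 1) v X := by
  rw [lieBracketWithin_univ, hA.lieBracket_vectorField_eq hB, lieBracket_eq]
  simp only [fderiv_chartLeft_apply, chartLeft_one, ContinuousLinearMap.id_apply]

/-- The Lie bracket of the Lie algebra in the chart at the identity. -/
theorem bracket_eq_fderiv_chartLeft (X v : GroupLieAlgebra 𝓘(ℝ, E) G) :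
    (⁅X, v⁆ : GroupLieAlgebra 𝓘(ℝ, E) G) =
      (fderiv ℝ (chartLeft E G) (extChartAt 𝓘(ℝ, E) (1 : G) 1) X v -
        fderiv ℝ (chartLeft E G) (extChartAt 𝓘(ℝ, E) (1 : G) 1) v X : E) := by
  have hnh := extChartAt_target_mem_nhds (I := 𝓘(ℝ, E)) (1 : G)
  rw [GroupLieAlgebra.bracket_def, ← mlieBracketWithin_univ, mlieBracketWithin_apply]
  have e1 := (congrArg (fun T : E →L[ℝ] E => T.inverse) (mfderiv_extChartAt_one (E := E) (G := G))).trans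
    ContinuousLinearMap.inverse_id
  have e2 : ((extChartAt 𝓘(ℝ, E) (1 : G)).symm ⁻¹' univ ∩ range 𝓘(ℝ, E)) = univ := by simp
  rw [e2]
  have hV : ∀ v : GroupLieAlgebra 𝓘(ℝ, E) G, mpullbackWithin 𝓘(ℝ, E) 𝓘(ℝ, E)
      (extChartAt 𝓘(ℝ, E) (1 : G)).symm (mulInvariantVectorField v) (range 𝓘(ℝ, E))
      =ᶠ[𝓝 (extChartAt 𝓘(ℝ, E) (1 : G) 1)] fun x => chartLeft E G x v := fun v => by
    filter_upwards [hnh] with x hx using mpullbackWithin_mulInvariantVectorField_eq v hx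
  refine Eq.trans (b := (ContinuousLinearMap.id ℝ E) _)
    (congrArg (fun T : E →L[ℝ] E => T _) e1) ?_
  exact lieBracketWithin_univ_eq_fderiv_chartLeft (hV X) (hV v)

end BracketInChart

/-! ### The adjoint representation and its derivative. -/

section AdjointInChart

open Set Filter
open scoped Topology

variable {E : Type*} [NormedAddCommGroup E] [NormedSpace ℝ E]
  {G : Type*} [TopologicalSpace G] [ChartedSpace E G] [Group G]

variable (E) in
/-- Conjugation by `g`, read in the chart at the identity. -/
noncomputable def chartConj (g : G) (y : E) : E :=
  extChartAt 𝓘(ℝ, E) (1 : G) (g * (extChartAt 𝓘(ℝ, E) (1 : G)).symm y * g⁻¹)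

variable (E) in
/-- The adjoint representation, in the chart at the identity. -/
noncomputable def chartAd (g : G) : E →L[ℝ] E :=
  fderiv ℝ (chartConj E g) (extChartAt 𝓘(ℝ, E) (1 : G) 1)

theorem chartConj_one_right (g : G) : chartConj E g (extChartAt 𝓘(ℝ, E) (1 : G) 1) =
    extChartAt 𝓘(ℝ, E) (1 : G) 1 := by
  rw [chartConj, extChartAt_to_inv, mul_one, mul_inv_cancel]

variable [LieGroup 𝓘(ℝ, E) ∞ G]

theorem eventually_conj_mem_source (g : G) : ∀ᶠ y in 𝓝 (extChartAt 𝓘(ℝ, E) (1 : G) 1),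
    g * (extChartAt 𝓘(ℝ, E) (1 : G)).symm y * g⁻¹ ∈ (extChartAt 𝓘(ℝ, E) (1 : G)).source := by
  have : IsTopologicalGroup G := topologicalGroup_of_lieGroup 𝓘(ℝ, E) ∞
  have hc : ContinuousAt (fun y => g * (extChartAt 𝓘(ℝ, E) (1 : G)).symm y * g⁻¹)
      (extChartAt 𝓘(ℝ, E) (1 : G) 1) :=
    (continuousAt_const.mul (continuousAt_extChartAt_symm (1 : G))).mul continuousAt_const
  refine hc.eventually_mem ?_
  rw [extChartAt_to_inv, mul_one, mul_inv_cancel]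
  exact extChartAt_source_mem_nhds (1 : G)

theorem contDiffAt_chartConj_uncurry : ContDiffAt ℝ ∞
    (fun p : E × E => chartConj E ((extChartAt 𝓘(ℝ, E) (1 : G)).symm p.1) p.2)
    (extChartAt 𝓘(ℝ, E) (1 : G) 1, extChartAt 𝓘(ℝ, E) (1 : G) 1) := by
  set z := extChartAt 𝓘(ℝ, E) (1 : G) 1
  rw [← contMDiffAt_iff_contDiffAt]
  have hs : ContMDiffAt 𝓘(ℝ, E) 𝓘(ℝ, E) ∞ (extChartAt 𝓘(ℝ, E) (1 : G)).symm z :=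
    (contMDiffOn_extChartAt_symm (n := ∞) (1 : G)).contMDiffAt (extChartAt_target_mem_nhds (1 : G))
  have ha : ContMDiffAt 𝓘(ℝ, E × E) 𝓘(ℝ, E) ∞ (fun p : E × E =>
      (extChartAt 𝓘(ℝ, E) (1 : G)).symm p.1) (z, z) :=
    hs.comp (z, z) contDiffAt_fst.contMDiffAt
  have hb : ContMDiffAt 𝓘(ℝ, E × E) 𝓘(ℝ, E) ∞ (fun p : E × E =>
      (extChartAt 𝓘(ℝ, E) (1 : G)).symm p.2) (z, z) :=
    hs.comp (z, z) contDiffAt_snd.contMDiffAt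
  have hφ : ContMDiffAt 𝓘(ℝ, E) 𝓘(ℝ, E) ∞ (extChartAt 𝓘(ℝ, E) (1 : G))
      ((extChartAt 𝓘(ℝ, E) (1 : G)).symm z * (extChartAt 𝓘(ℝ, E) (1 : G)).symm z *
        ((extChartAt 𝓘(ℝ, E) (1 : G)).symm z)⁻¹) := by
    refine contMDiffAt_extChartAt' ?_
    simp [z]
  exact hφ.comp (z, z) ((ha.mul hb).mul ha.inv)

theorem contDiffAt_chartConj (g : G) :
    ContDiffAt ℝ ∞ (chartConj E g) (extChartAt 𝓘(ℝ, E) (1 : G) 1) := by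
  set z := extChartAt 𝓘(ℝ, E) (1 : G) 1
  rw [← contMDiffAt_iff_contDiffAt]
  have hs : ContMDiffAt 𝓘(ℝ, E) 𝓘(ℝ, E) ∞ (extChartAt 𝓘(ℝ, E) (1 : G)).symm z :=
    (contMDiffOn_extChartAt_symm (n := ∞) (1 : G)).contMDiffAt (extChartAt_target_mem_nhds (1 : G))
  have hφ : ContMDiffAt 𝓘(ℝ, E) 𝓘(ℝ, E) ∞ (extChartAt 𝓘(ℝ, E) (1 : G))
      (g * (extChartAt 𝓘(ℝ, E) (1 : G)).symm z * g⁻¹) := by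
    refine contMDiffAt_extChartAt' ?_
    simp [z]
  exact hφ.comp z ((contMDiffAt_const.mul hs).mul contMDiffAt_const)

theorem chartAd_mul (g h : G) : chartAd E (g * h) = (chartAd E g).comp (chartAd E h) := by
  have e : chartConj E (g * h) =ᶠ[𝓝 (extChartAt 𝓘(ℝ, E) (1 : G) 1)]
      chartConj E g ∘ chartConj E h := by
    filter_upwards [eventually_conj_mem_source (E := E) h] with y hy
    simp only [chartConj, Function.comp_apply, (extChartAt 𝓘(ℝ, E) (1 : G)).left_inv hy]
    congr 1
    group
  have hg := (contDiffAt_chartConj (E := E) g).differentiableAt (by simp)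
  have hh := (contDiffAt_chartConj (E := E) h).differentiableAt (by simp)
  rw [chartAd, e.fderiv_eq, fderiv_comp _ (by rwa [chartConj_one_right]) hh, chartConj_one_right]
  rfl

omit [LieGroup 𝓘(ℝ, E) ∞ G] in
theorem chartAd_one : chartAd E (1 : G) = ContinuousLinearMap.id ℝ E := by
  have h : chartConj E (1 : G) =ᶠ[𝓝 (extChartAt 𝓘(ℝ, E) (1 : G) 1)] id := by
    filter_upwards [extChartAt_target_mem_nhds (I := 𝓘(ℝ, E)) (1 : G)] with y hy
    rw [chartConj, one_mul, inv_one, mul_one, (extChartAt 𝓘(ℝ, E) (1 : G)).right_inv hy]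
    rfl
  rw [chartAd, h.fderiv_eq, fderiv_id]

/-- Differentiate `g h = (g h g⁻¹) g` in `h` at the identity: a left translation is a right
translation after a conjugation. -/
theorem chartLeft_eq_comp_chartAd {x : E} (hx : x ∈ (extChartAt 𝓘(ℝ, E) (1 : G)).target) :
    chartLeft E G x = ((fderiv ℝ (chartMul E G) (extChartAt 𝓘(ℝ, E) (1 : G) 1, x)).comp
      (ContinuousLinearMap.inl ℝ E E)).comp
        (chartAd E ((extChartAt 𝓘(ℝ, E) (1 : G)).symm x)) := by
  set z := extChartAt 𝓘(ℝ, E) (1 : G) 1 with hz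
  set g := (extChartAt 𝓘(ℝ, E) (1 : G)).symm x with hg
  have e : (fun y => chartMul E G (x, y)) =ᶠ[𝓝 z] fun y => chartMul E G (chartConj E g y, x) := by
    filter_upwards [eventually_conj_mem_source (E := E) g] with y hy
    simp only [chartMul, chartConj, (extChartAt 𝓘(ℝ, E) (1 : G)).left_inv hy]
    rw [← hg]
    congr 1
    group
  have hm : DifferentiableAt ℝ (chartMul E G) (z, x) := by
    refine (contDiffAt_chartMul (mem_extChartAt_target (1 : G)) hx ?_).differentiableAt (by simp)
    simpa [z] using (extChartAt 𝓘(ℝ, E) (1 : G)).map_target hx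
  have hc := ((contDiffAt_chartConj (E := E) g).differentiableAt (by simp)).hasFDerivAt
  have hm' : HasFDerivAt (chartMul E G) (fderiv ℝ (chartMul E G) (z, x)) (chartConj E g z, x) := by
    rw [chartConj_one_right]; exact hm.hasFDerivAt
  have h2 := hm'.comp z (hc.prodMk (hasFDerivAt_const x z))
  rw [chartLeft, e.fderiv_eq]
  refine h2.fderiv.trans ?_
  ext v
  simp [chartAd, z]

/-- Differentiate the factorisation `chartLeft_eq_comp_chartAd` at the identity. The left side gives
the mixed second derivative of the group law at `(X, 0), (0, v)`; the right side gives it at `(0,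
X), (v, 0)`, plus `T X`. By symmetry of second derivatives the difference is the antisymmetrised
derivative of `chartLeft`. -/
theorem hasFDerivAt_chartAd_apply (v : E) :
    ∃ T : E →L[ℝ] E, HasFDerivAt (fun x => chartAd E ((extChartAt 𝓘(ℝ, E) (1 : G)).symm x) v) T
      (extChartAt 𝓘(ℝ, E) (1 : G) 1) ∧
      ∀ X : E, T X = fderiv ℝ (chartLeft E G) (extChartAt 𝓘(ℝ, E) (1 : G) 1) X v -
        fderiv ℝ (chartLeft E G) (extChartAt 𝓘(ℝ, E) (1 : G) 1) v X := by
  set z := extChartAt 𝓘(ℝ, E) (1 : G) 1 with hz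
  have hzt : z ∈ (extChartAt 𝓘(ℝ, E) (1 : G)).target := mem_extChartAt_target (1 : G)
  have hnh := extChartAt_target_mem_nhds (I := 𝓘(ℝ, E)) (1 : G)
  have hms : ContDiffAt ℝ ∞ (chartMul E G) (z, z) := contDiffAt_chartMul_left hzt
  set D := fderiv ℝ (chartMul E G) with hD
  have hDd : HasFDerivAt D (fderiv ℝ D (z, z)) (z, z) :=
    ((hms.fderiv_right (m := ∞) (by simp)).differentiableAt (by simp)).hasFDerivAt
  have hsymm : ∀ a b, fderiv ℝ D (z, z) a b = fderiv ℝ D (z, z) b a :=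
    hms.isSymmSndFDerivAt (by
      rw [minSmoothness_of_isRCLikeNormedField]
      exact WithTop.coe_le_coe.2 le_top)
  have hL : ∀ X w, fderiv ℝ (chartLeft E G) z X w = fderiv ℝ D (z, z) (X, 0) (0, w) := by
    intro X w
    have e : chartLeft E G =ᶠ[𝓝 z] fun x => (D (x, z)).comp (ContinuousLinearMap.inr ℝ E E) := by
      filter_upwards [hnh] with x hx using chartLeft_eq hx
    have h1 : HasFDerivAt (fun x => D (x, z)) _ z := 
      HasFDerivAt.comp (f := fun x => (x, z)) z hDd (hasFDerivAt_prodMk_left z z)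
    rw [e.fderiv_eq, (h1.clm_comp (hasFDerivAt_const (ContinuousLinearMap.inr ℝ E E) z)).fderiv]
    simp
  have hAd : DifferentiableAt ℝ
      (fun x => chartAd E ((extChartAt 𝓘(ℝ, E) (1 : G)).symm x)) z := by
    have hk := contDiffAt_chartConj_uncurry (E := E) (G := G)
    have h1 : ContDiffAt ℝ ∞ (fun x : E => (fderiv ℝ (fun p : E × E =>
        chartConj E ((extChartAt 𝓘(ℝ, E) (1 : G)).symm p.1) p.2) (x, z)).comp
          (ContinuousLinearMap.inr ℝ E E)) z :=
      (ContDiffAt.comp (f := fun x : E => (x, z)) z (hk.fderiv_right (m := ∞) (by simp))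
        (contDiffAt_id.prodMk contDiffAt_const)).clm_comp contDiffAt_const
    refine (h1.congr_of_eventuallyEq ?_).differentiableAt (by simp)
    have h2 : ∀ᶠ p in 𝓝 (z, z), DifferentiableAt ℝ (fun p : E × E =>
        chartConj E ((extChartAt 𝓘(ℝ, E) (1 : G)).symm p.1) p.2) p :=
      ((hk.of_le (m := 1) (by exact_mod_cast le_top)).eventually (by simp)).mono
        fun p hp => hp.differentiableAt (by simp)
    have h3 : Tendsto (fun x : E => (x, z)) (𝓝 z) (𝓝 (z, z)) :=
      (continuous_id.prodMk continuous_const).tendsto z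
    filter_upwards [h3.eventually h2] with x hx
    exact (hx.hasFDerivAt.comp z (hasFDerivAt_prodMk_right x z)).fderiv
  have hAv : HasFDerivAt (fun x => chartAd E ((extChartAt 𝓘(ℝ, E) (1 : G)).symm x) v)
      ((fderiv ℝ (fun x => chartAd E ((extChartAt 𝓘(ℝ, E) (1 : G)).symm x)) z).flip v) z := by
    have := hAd.hasFDerivAt.clm_apply (hasFDerivAt_const (v : E) z)
    simpa using this
  refine ⟨_, hAv, fun X => ?_⟩
  have e : (fun x => chartLeft E G x v) =ᶠ[𝓝 z] fun x =>
      (D (z, x)).comp (ContinuousLinearMap.inl ℝ E E)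
        (chartAd E ((extChartAt 𝓘(ℝ, E) (1 : G)).symm x) v) := by
    filter_upwards [hnh] with x hx
    rw [chartLeft_eq_comp_chartAd hx]
    rfl
  have h1 : HasFDerivAt (fun x => D (z, x)) _ z := hDd.comp z (hasFDerivAt_prodMk_right z z)
  have h2 := (h1.clm_comp (hasFDerivAt_const (ContinuousLinearMap.inl ℝ E E) z)).clm_apply hAv
  have h3 := congrArg (fun T : E →L[ℝ] E => T X) (e.fderiv_eq.trans h2.fderiv)
  have hz1 : (extChartAt 𝓘(ℝ, E) (1 : G)).symm z = 1 := extChartAt_to_inv (1 : G)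
  have hR : ∀ w, D (z, z) (w, 0) = w := by
    intro w
    have h4 := congrArg (fun T : E →L[ℝ] E => T w) (chartLeft_eq_comp_chartAd hzt)
    rw [chartLeft_one, hz1, chartAd_one] at h4
    exact h4.symm
  rw [hz1, chartAd_one] at h3
  have h5 := (fderiv_chartLeft_apply (G := G) X v).symm.trans h3
  rw [hL] at h5
  rw [hL, hL, hsymm (v, 0), h5]
  simp [hR]

/-- The derivative of the adjoint representation is the Lie bracket. -/
theorem hasFDerivAt_chartAd (v : GroupLieAlgebra 𝓘(ℝ, E) G) :
    ∃ T : E →L[ℝ] E, HasFDerivAt (fun x => chartAd E ((extChartAt 𝓘(ℝ, E) (1 : G)).symm x) v) T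
      (extChartAt 𝓘(ℝ, E) (1 : G) 1) ∧
      ∀ X : GroupLieAlgebra 𝓘(ℝ, E) G, T X = (⁅X, v⁆ : GroupLieAlgebra 𝓘(ℝ, E) G) := by
  obtain ⟨T, hT, h⟩ := hasFDerivAt_chartAd_apply (E := E) (G := G) v
  exact ⟨T, hT, fun X => (h X).trans (bracket_eq_fderiv_chartLeft X v).symm⟩

end AdjointInChart

/-! ### Conjugates of horizontal vectors by nearby points span the Lie algebra. -/

section Accessibility

open Set Filter
open scoped Topology

/-- A subspace which contains a generating set of a Lie algebra and is invariant under the bracket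
with the generators is everything. -/
theorem Submodule.eq_top_of_lie_mem {L : Type*} [LieRing L] [LieAlgebra ℝ L] {𝓗 V : Submodule ℝ L}
    (h𝓗 : LieSubalgebra.lieSpan ℝ L (𝓗 : Set L) = ⊤) (hV : 𝓗 ≤ V)
    (h : ∀ X ∈ 𝓗, ∀ v ∈ V, ⁅X, v⁆ ∈ V) : V = ⊤ := by
  -- The elements preserving `V` form a subalgebra by the Jacobi identity. It contains the
  -- generators, so `V` is an ideal.
  let N : LieSubalgebra ℝ L :=
    { carrier := {Y | ∀ v ∈ V, ⁅Y, v⁆ ∈ V}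
      zero_mem' := fun v _ => by simp
      add_mem' := fun {a b} ha hb v hv => by
        rw [add_lie]; exact V.add_mem (ha v hv) (hb v hv)
      smul_mem' := fun c a ha v hv => by
        rw [smul_lie]; exact V.smul_mem c (ha v hv)
      lie_mem' := fun {a b} ha hb v hv => by
        rw [lie_lie]; exact V.sub_mem (ha _ (hb v hv)) (hb _ (ha v hv)) }
  have hN : N = ⊤ := by
    rw [eq_top_iff, ← h𝓗, LieSubalgebra.lieSpan_le]
    exact h
  let V' : LieSubalgebra ℝ L :=
    { V with lie_mem' := fun {a b} _ hb => (hN ▸ LieSubalgebra.mem_top a : a ∈ N) b hb }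
  have hV' : V' = ⊤ := by
    rw [eq_top_iff, ← h𝓗, LieSubalgebra.lieSpan_le]
    exact hV
  rw [eq_top_iff]
  intro x _
  exact (hV' ▸ LieSubalgebra.mem_top x : x ∈ V')

theorem HasDerivAt.mem_submodule {E : Type*} [NormedAddCommGroup E] [NormedSpace ℝ E]
    [FiniteDimensional ℝ E] {W : Submodule ℝ E} {f : ℝ → E} {f' : E} {x : ℝ}
    (h : HasDerivAt f f' x) (hW : ∀ᶠ t in 𝓝 x, f t ∈ W) : f' ∈ W := by
  rw [hasDerivAt_iff_tendsto_slope] at h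
  refine (Submodule.closed_of_finiteDimensional W).mem_of_tendsto h ?_
  filter_upwards [nhdsWithin_le_nhds hW] with t ht
  rw [slope_def_module]
  exact W.smul_mem _ (W.sub_mem ht hW.self_of_nhds)

variable {E : Type*} [NormedAddCommGroup E] [NormedSpace ℝ E]
  {G : Type*} [TopologicalSpace G] [ChartedSpace E G] [Group G] [LieGroup 𝓘(ℝ, E) ∞ G]
  (ip : InnerProductSpace.Core ℝ (GroupLieAlgebra 𝓘(ℝ, E) G))
  {𝓗 : Submodule ℝ (GroupLieAlgebra 𝓘(ℝ, E) G)}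

theorem ccEDist_one_mul_le (g h : G) :
    ccEDist ip 𝓗 1 (g * h) ≤ ccEDist ip 𝓗 1 g + ccEDist ip 𝓗 1 h := by
  refine (ccEDist_triangle ip 1 g (g * h)).trans_eq ?_
  congr 1
  simpa using ccEDist_mul_left ip (𝓗 := 𝓗) g 1 h

theorem ccEDist_one_inv (g : G) : ccEDist ip 𝓗 1 g⁻¹ = ccEDist ip 𝓗 1 g := by
  have := ccEDist_mul_left ip (𝓗 := 𝓗) g 1 g⁻¹
  rw [mul_inv_cancel, mul_one] at this
  rw [← this, ccEDist_comm]

/-- The differential equation makes the derivative in the chart at `1` continuous; a `C¹` curve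
there is `C¹`, hence absolutely continuous, in every chart. -/
theorem HorizontalOn.of_hasMFDerivAt {c : ℝ → G} {X : GroupLieAlgebra 𝓘(ℝ, E) G} (hX : X ∈ 𝓗)
    {a b : ℝ} {J : Set ℝ} (hJ : IsOpen J) (hab : Icc a b ⊆ J)
    (hsrc : ∀ t ∈ J, c t ∈ (extChartAt 𝓘(ℝ, E) (1 : G)).source)
    (hc : ∀ t ∈ J, HasMFDerivAt 𝓘(ℝ, ℝ) 𝓘(ℝ, E) c t (ContinuousLinearMap.toSpanSingleton ℝ
      (mulInvariantVectorField (I := 𝓘(ℝ, E)) X (c t)))) :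
    HorizontalOn 𝓗 c (fun _ => X) a b := by
  have hd : ∀ t ∈ J, HasDerivAt (fun s => extChartAt 𝓘(ℝ, E) (1 : G) (c s))
      (chartLeft E G (extChartAt 𝓘(ℝ, E) (1 : G) (c t)) X) t := fun t ht =>
    (hc t ht).hasDerivAt_chart (hsrc t ht)
  have hC1 : ContDiffOn ℝ 1 (fun s => extChartAt 𝓘(ℝ, E) (1 : G) (c s)) J := by
    rw [show (1 : WithTop ℕ∞) = 0 + 1 from (zero_add 1).symm,
      contDiffOn_succ_iff_deriv_of_isOpen hJ]
    refine ⟨fun t ht => (hd t ht).differentiableAt.differentiableWithinAt, by simp, ?_⟩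
    rw [contDiffOn_zero]
    have : ContinuousOn (fun t => chartLeft E G (extChartAt 𝓘(ℝ, E) (1 : G) (c t)) X) J := by
      intro t ht
      have h1 : ContinuousAt (chartLeft E G) (extChartAt 𝓘(ℝ, E) (1 : G) (c t)) :=
        (contDiffAt_chartLeft ((extChartAt 𝓘(ℝ, E) (1 : G)).map_source (hsrc t ht))).continuousAt
      have h2 : ContinuousAt (fun s => chartLeft E G (extChartAt 𝓘(ℝ, E) (1 : G) (c s))) t :=
        ContinuousAt.comp (f := fun s => extChartAt 𝓘(ℝ, E) (1 : G) (c s)) h1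
          (hd t ht).continuousAt
      exact (h2.clm_apply continuousAt_const).continuousWithinAt
    exact this.congr fun t ht => (hd t ht).deriv
  refine ⟨fun t ht => (hc t (hab ht)).continuousAt.continuousWithinAt, ?_,
    Eventually.of_forall fun _ => hX, ?_⟩
  · intro p s t hs hst ht hp
    have hsub : Icc s t ⊆ J := (Icc_subset_Icc hs ht).trans hab
    have hpsi : ContDiffOn ℝ 1 (fun x => extChartAt 𝓘(ℝ, E) p (c x)) (Icc s t) := by
      intro x hx
      have h1 : ContDiffAt ℝ 1 (fun y => extChartAt 𝓘(ℝ, E) p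
          ((extChartAt 𝓘(ℝ, E) (1 : G)).symm y)) (extChartAt 𝓘(ℝ, E) (1 : G) (c x)) := by
        rw [← contMDiffAt_iff_contDiffAt]
        have hm := (extChartAt 𝓘(ℝ, E) (1 : G)).map_source (hsrc x (hsub hx))
        have hs : ContMDiffAt 𝓘(ℝ, E) 𝓘(ℝ, E) 1 (extChartAt 𝓘(ℝ, E) (1 : G)).symm
            (extChartAt 𝓘(ℝ, E) (1 : G) (c x)) :=
          ((contMDiffOn_extChartAt_symm (n := ∞) (1 : G)).contMDiffAt
            ((isOpen_extChartAt_target (1 : G)).mem_nhds hm)).of_le (by exact_mod_cast le_top)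
        have hφ : ContMDiffAt 𝓘(ℝ, E) 𝓘(ℝ, E) 1 (extChartAt 𝓘(ℝ, E) p)
            ((extChartAt 𝓘(ℝ, E) (1 : G)).symm (extChartAt 𝓘(ℝ, E) (1 : G) (c x))) := by
          rw [(extChartAt 𝓘(ℝ, E) (1 : G)).left_inv (hsrc x (hsub hx))]
          exact (contMDiffAt_extChartAt' (n := ∞)
            (by rw [← extChartAt_source 𝓘(ℝ, E)]; exact hp x hx)).of_le (by exact_mod_cast le_top)
        exact hφ.comp _ hs
      have h2 := h1.comp_contDiffWithinAt x ((hC1 x (hsub hx)).mono hsub)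
      refine h2.congr (fun y hy => ?_) ?_
      · simp only [Function.comp_apply, (extChartAt 𝓘(ℝ, E) (1 : G)).left_inv (hsrc y (hsub hy))]
      · simp only [Function.comp_apply, (extChartAt 𝓘(ℝ, E) (1 : G)).left_inv (hsrc x (hsub hx))]
    rw [← uIcc_of_le hst] at hpsi
    exact hpsi.absolutelyContinuousOnInterval
  · filter_upwards [ae_restrict_mem measurableSet_Icc] with t ht using hc t (hab ht)

omit [LieGroup 𝓘(ℝ, E) ∞ G] in
theorem controlLength_const (X : GroupLieAlgebra 𝓘(ℝ, E) G) (a b : ℝ) :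
    controlLength ip (fun _ => X) a b =
      ENNReal.ofReal (coreNorm ip X) * ENNReal.ofReal (b - a) := by
  simp [controlLength]

variable [FiniteDimensional ℝ E]

/-- The local one-parameter subgroup generated by a horizontal vector. -/
theorem exists_horizontal_integralCurve {X : GroupLieAlgebra 𝓘(ℝ, E) G} (hX : X ∈ 𝓗) :
    ∃ c : ℝ → G, c 0 = 1 ∧ ContinuousAt c 0 ∧
      HasStrictDerivAt (fun s => extChartAt 𝓘(ℝ, E) (1 : G) (c s)) (X : E) 0 ∧
      ∀ r : ℝ, 0 < r → ∀ᶠ t in 𝓝 (0 : ℝ), c t ∈ ccBall ip 𝓗 1 r := by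
  have : IsManifold 𝓘(ℝ, E) 1 G := IsManifold.of_le (n := ∞) (by exact_mod_cast le_top)
  have : CompleteSpace E := FiniteDimensional.complete ℝ E
  have hsm : ContMDiffAt 𝓘(ℝ, E) 𝓘(ℝ, E).tangent 1
      (fun g : G => (⟨g, mulInvariantVectorField X g⟩ : TangentBundle 𝓘(ℝ, E) G)) 1 :=
    (contMDiffAt_mulInvariantVectorField X).of_le (by
      rw [minSmoothness_of_isRCLikeNormedField]; norm_num)
  obtain ⟨c, hc0, hc⟩ := exists_isMIntegralCurveAt_of_contMDiffAt_boundaryless 0 hsm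
  have hcont : ContinuousAt c 0 := hc.continuousAt
  have hsrc : ∀ᶠ t in 𝓝 (0 : ℝ), c t ∈ (extChartAt 𝓘(ℝ, E) (1 : G)).source :=
    hcont.eventually_mem (by rw [hc0]; exact extChartAt_source_mem_nhds (1 : G))
  have hev : ∀ᶠ t in 𝓝 (0 : ℝ), c t ∈ (extChartAt 𝓘(ℝ, E) (1 : G)).source ∧
      HasMFDerivAt 𝓘(ℝ, ℝ) 𝓘(ℝ, E) c t (ContinuousLinearMap.toSpanSingleton ℝ
        (mulInvariantVectorField (I := 𝓘(ℝ, E)) X (c t))) := by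
    filter_upwards [hsrc, hc] with t h1 h2
    refine ⟨h1, ?_⟩
    have e : ContinuousLinearMap.toSpanSingleton ℝ
        (mulInvariantVectorField (I := 𝓘(ℝ, E)) X (c t)) =
        (1 : ℝ →L[ℝ] ℝ).smulRight (mulInvariantVectorField (I := 𝓘(ℝ, E)) X (c t)) := by
      ext; rfl
    rw [e]; exact h2
  obtain ⟨ε, hε, hball⟩ := Metric.eventually_nhds_iff_ball.1 hev
  refine ⟨c, hc0, hcont, ?_, fun r hr => ?_⟩
  · have hder : ∀ᶠ t in 𝓝 (0 : ℝ), HasDerivAt (fun s => extChartAt 𝓘(ℝ, E) (1 : G) (c s))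
        (chartLeft E G (extChartAt 𝓘(ℝ, E) (1 : G) (c t)) X) t :=
      hev.mono fun t ht => ht.2.hasDerivAt_chart ht.1
    have h1 : ContinuousAt (chartLeft E G) (extChartAt 𝓘(ℝ, E) (1 : G) (c 0)) := by
      rw [hc0]; exact (contDiffAt_chartLeft (mem_extChartAt_target (1 : G))).continuousAt
    have h2 : ContinuousAt (fun s => chartLeft E G (extChartAt 𝓘(ℝ, E) (1 : G) (c s))) 0 :=
      ContinuousAt.comp (f := fun s => extChartAt 𝓘(ℝ, E) (1 : G) (c s)) h1
        hder.self_of_nhds.continuousAt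
    have h3 := hasStrictDerivAt_of_hasDerivAt_of_continuousAt hder
      (h2.clm_apply (continuousAt_const (y := (X : E))))
    rw [hc0, chartLeft_one] at h3
    exact h3
  · have hlim : ∀ᶠ t in 𝓝 (0 : ℝ), coreNorm ip X * |t| < r := by
      have : Tendsto (fun t : ℝ => coreNorm ip X * |t|) (𝓝 0) (𝓝 (coreNorm ip X * |0|)) :=
        (continuous_const.mul continuous_abs).tendsto 0
      exact this.eventually_lt_const (by simpa using hr)
    filter_upwards [hlim, Metric.ball_mem_nhds (0 : ℝ) hε] with t ht htε
    have hnn : 0 ≤ coreNorm ip X := Real.sqrt_nonneg _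
    have hH : ∀ a b : ℝ, a ∈ Metric.ball (0 : ℝ) ε → b ∈ Metric.ball (0 : ℝ) ε →
        HorizontalOn 𝓗 c (fun _ => X) a b := fun a b ha hb =>
      HorizontalOn.of_hasMFDerivAt hX Metric.isOpen_ball
        ((convex_ball (0 : ℝ) ε).ordConnected.out ha hb)
        (fun t ht => (hball t ht).1) (fun t ht => (hball t ht).2)
    have h0 := Metric.mem_ball_self (x := (0 : ℝ)) hε
    show ccEDist ip 𝓗 1 (c t) < ENNReal.ofReal r
    rcases lt_trichotomy t 0 with h | rfl | h
    · have := ccEDist_le_of_horizontalOn ip h (hH t 0 htε h0)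
      rw [hc0, ccEDist_comm, controlLength_const, ← ENNReal.ofReal_mul hnn] at this
      refine this.trans_lt ((ENNReal.ofReal_lt_ofReal_iff hr).2 ?_)
      rwa [abs_of_neg h, ← zero_sub] at ht
    · rw [hc0, ccEDist_self]; simpa using hr
    · have := ccEDist_le_of_horizontalOn ip h (hH 0 t h0 htε)
      rw [hc0, controlLength_const, ← ENNReal.ofReal_mul hnn] at this
      refine this.trans_lt ((ENNReal.ofReal_lt_ofReal_iff hr).2 ?_)
      rwa [abs_of_pos h, ← sub_zero t] at ht

variable (𝓗) in
/-- The span of the conjugates of horizontal vectors by elements at distance less than `s` of the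
identity. -/
noncomputable def conjSpan (s : ℝ) : Submodule ℝ E :=
  Submodule.span ℝ {w | ∃ g ∈ ccBall ip 𝓗 1 s, ∃ X : GroupLieAlgebra 𝓘(ℝ, E) G, X ∈ 𝓗 ∧
    chartAd E g X = w}

omit [LieGroup 𝓘(ℝ, E) ∞ G] [FiniteDimensional ℝ E] in
theorem conjSpan_mono {s t : ℝ} (h : s ≤ t) : conjSpan ip 𝓗 s ≤ conjSpan ip 𝓗 t :=
  Submodule.span_mono fun _ ⟨g, hg, X, hX, hw⟩ =>
    ⟨g, lt_of_lt_of_le hg (ENNReal.ofReal_le_ofReal h), X, hX, hw⟩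

omit [FiniteDimensional ℝ E] in
theorem chartAd_mem_conjSpan {s t r : ℝ} (hs : 0 ≤ s) (ht : 0 ≤ t) (hst : s + t ≤ r) {g : G}
    (hg : g ∈ ccBall ip 𝓗 1 s) {v : E} (hv : v ∈ conjSpan ip 𝓗 t) :
    chartAd E g v ∈ conjSpan ip 𝓗 r := by
  induction hv using Submodule.span_induction with
  | mem w hw =>
    obtain ⟨h, hh, X, hX, rfl⟩ := hw
    refine Submodule.subset_span ⟨g * h, ?_, X, hX, by rw [chartAd_mul]; rfl⟩
    refine lt_of_le_of_lt (ccEDist_one_mul_le ip g h) ?_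
    refine (ENNReal.add_lt_add hg hh).trans_le ?_
    rw [← ENNReal.ofReal_add hs ht]
    exact ENNReal.ofReal_le_ofReal hst
  | zero => simp
  | add x y _ _ hx hy => rw [map_add]; exact Submodule.add_mem _ hx hy
  | smul a x _ hx => rw [map_smul]; exact Submodule.smul_mem _ _ hx

/-- The spans increase with `s`, so one of minimal dimension equals all the smaller ones.
Differentiating `Ad_{c(t)} v` along horizontal curves then shows that it is stable under the bracket
with `𝓗`. -/
theorem conjSpan_eq_top (h𝓗 : LieSubalgebra.lieSpan ℝ (GroupLieAlgebra 𝓘(ℝ, E) G)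
      (𝓗 : Set (GroupLieAlgebra 𝓘(ℝ, E) G)) = ⊤) {s : ℝ} (hs : 0 < s) :
    conjSpan ip 𝓗 s = ⊤ := by
  have hex : ∃ n, ∃ s : ℝ, 0 < s ∧ Module.finrank ℝ (conjSpan ip 𝓗 s) = n := ⟨_, 1, one_pos, rfl⟩
  classical
  obtain ⟨s₀, hs₀, hn⟩ := Nat.find_spec hex
  have hstab : ∀ t : ℝ, 0 < t → t ≤ s₀ → conjSpan ip 𝓗 t = conjSpan ip 𝓗 s₀ := fun t ht hts =>
    Submodule.eq_of_le_of_finrank_le (conjSpan_mono ip hts) (by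
      rw [hn]; exact Nat.find_min' hex ⟨t, ht, rfl⟩)
  set W := conjSpan ip 𝓗 s₀ with hW
  have hlie : ∀ X : GroupLieAlgebra 𝓘(ℝ, E) G, X ∈ 𝓗 → ∀ v : GroupLieAlgebra 𝓘(ℝ, E) G,
      (v : E) ∈ W → ((⁅X, v⁆ : GroupLieAlgebra 𝓘(ℝ, E) G) : E) ∈ W := by
    intro X hX v hv
    obtain ⟨c, hc0, hcont, hcd, hcb⟩ := exists_horizontal_integralCurve ip hX
    obtain ⟨T, hT, hTX⟩ := hasFDerivAt_chartAd (G := G) v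
    have hder : HasDerivAt (fun t => chartAd E (c t) v)
        ((⁅X, v⁆ : GroupLieAlgebra 𝓘(ℝ, E) G) : E) 0 := by
      rw [← hTX X]
      have hT' : HasFDerivAt (fun x => chartAd E ((extChartAt 𝓘(ℝ, E) (1 : G)).symm x) v) T
          (extChartAt 𝓘(ℝ, E) (1 : G) (c 0)) := by rwa [hc0]
      refine (hT'.comp_hasDerivAt (0 : ℝ) hcd.hasDerivAt).congr_of_eventuallyEq ?_
      have hsrc : ∀ᶠ t in 𝓝 (0 : ℝ), c t ∈ (extChartAt 𝓘(ℝ, E) (1 : G)).source :=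
        hcont.eventually_mem (by rw [hc0]; exact extChartAt_source_mem_nhds (1 : G))
      filter_upwards [hsrc] with t ht
      simp only [Function.comp_apply, (extChartAt 𝓘(ℝ, E) (1 : G)).left_inv ht]
    refine HasDerivAt.mem_submodule (W := W) hder ?_
    filter_upwards [hcb (s₀ / 2) (half_pos hs₀)] with t ht
    -- Halving the radius loses nothing by stability, and leaves room for conjugating by `c t`,
    -- itself within `s₀ / 2` of the identity.
    rw [← hstab (s₀ / 2) (half_pos hs₀) (half_le_self hs₀.le)] at hv
    exact chartAd_mem_conjSpan ip (half_pos hs₀).le (half_pos hs₀).le (add_halves s₀).le ht hv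
  have hle : ∀ X : GroupLieAlgebra 𝓘(ℝ, E) G, X ∈ 𝓗 → (X : E) ∈ W := fun X hX => by
    refine Submodule.subset_span ⟨1, ?_, X, hX, by rw [chartAd_one]; rfl⟩
    show ccEDist ip 𝓗 1 1 < _
    rw [ccEDist_self]; simpa using hs₀
  let W' : Submodule ℝ (GroupLieAlgebra 𝓘(ℝ, E) G) := W
  have hWtop : W' = ⊤ := Submodule.eq_top_of_lie_mem h𝓗 hle hlie
  have hW2 : W = ⊤ := hWtop
  rw [eq_top_iff, ← hW2, ← hstab (min s s₀) (lt_min hs hs₀) (min_le_right _ _)]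
  exact conjSpan_mono ip (min_le_left _ _)

end Accessibility

/-! ### Chow's theorem. -/

section Chow

open Set Filter
open scoped Topology

variable {E : Type*} [NormedAddCommGroup E] [NormedSpace ℝ E]
  {G : Type*} [TopologicalSpace G] [ChartedSpace E G] [Group G] [LieGroup 𝓘(ℝ, E) ∞ G]
  (ip : InnerProductSpace.Core ℝ (GroupLieAlgebra 𝓘(ℝ, E) G))
  {𝓗 : Submodule ℝ (GroupLieAlgebra 𝓘(ℝ, E) G)}

theorem hasStrictFDerivAt_chartMul_one : HasStrictFDerivAt (chartMul E G)
    (ContinuousLinearMap.fst ℝ E E + ContinuousLinearMap.snd ℝ E E)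
    (extChartAt 𝓘(ℝ, E) (1 : G) 1, extChartAt 𝓘(ℝ, E) (1 : G) 1) := by
  set z := extChartAt 𝓘(ℝ, E) (1 : G) 1 with hz
  have hzt : z ∈ (extChartAt 𝓘(ℝ, E) (1 : G)).target := mem_extChartAt_target (1 : G)
  have h := (contDiffAt_chartMul_left (E := E) (G := G) hzt).hasStrictFDerivAt (by simp)
  convert! h using 1
  have h1 := chartLeft_eq (E := E) (G := G) hzt
  rw [chartLeft_one] at h1
  have h2 := chartLeft_eq_comp_chartAd (E := E) (G := G) hzt
  rw [chartLeft_one, extChartAt_to_inv, chartAd_one] at h2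
  refine ContinuousLinearMap.ext fun ⟨a, b⟩ => ?_
  have e1 := congrArg (fun T : E →L[ℝ] E => T b) h1
  have e2 := congrArg (fun T : E →L[ℝ] E => T a) h2
  have e : ((a, b) : E × E) = (a, 0) + (0, b) := by simp
  rw [e, map_add, map_add]
  simp only [ContinuousLinearMap.comp_apply, ContinuousLinearMap.id_apply,
    ContinuousLinearMap.inl_apply, ContinuousLinearMap.inr_apply] at e1 e2
  rw [← e1, ← e2]
  simp

/-- Strict differentiability, in the chart at the identity, of a product of maps. -/
theorem HasStrictFDerivAt.chart_mul {F : Type*} [NormedAddCommGroup F] [NormedSpace ℝ F]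
    {f g : F → G} {x : F} {f' g' : F →L[ℝ] E} (hfc : ContinuousAt f x) (hgc : ContinuousAt g x)
    (hf1 : f x = 1) (hg1 : g x = 1)
    (hf : HasStrictFDerivAt (fun y => extChartAt 𝓘(ℝ, E) (1 : G) (f y)) f' x)
    (hg : HasStrictFDerivAt (fun y => extChartAt 𝓘(ℝ, E) (1 : G) (g y)) g' x) :
    HasStrictFDerivAt (fun y => extChartAt 𝓘(ℝ, E) (1 : G) (f y * g y)) (f' + g') x := by
  have hm : HasStrictFDerivAt (chartMul E G)
      (ContinuousLinearMap.fst ℝ E E + ContinuousLinearMap.snd ℝ E E)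
      (extChartAt 𝓘(ℝ, E) (1 : G) (f x), extChartAt 𝓘(ℝ, E) (1 : G) (g x)) := by
    rw [hf1, hg1]; exact hasStrictFDerivAt_chartMul_one
  have h := HasStrictFDerivAt.comp (f := fun y => (extChartAt 𝓘(ℝ, E) (1 : G) (f y),
    extChartAt 𝓘(ℝ, E) (1 : G) (g y))) x hm (hf.prodMk hg)
  have e : (ContinuousLinearMap.fst ℝ E E + ContinuousLinearMap.snd ℝ E E).comp (f'.prod g') =
      f' + g' := by ext; simp
  rw [e] at h
  refine h.congr_of_eventuallyEq ?_
  have hs := extChartAt_source_mem_nhds (I := 𝓘(ℝ, E)) (1 : G)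
  filter_upwards [hfc.eventually_mem (by rwa [hf1]), hgc.eventually_mem (by rwa [hg1])]
    with y h1 h2
  simp only [chartMul, (extChartAt 𝓘(ℝ, E) (1 : G)).left_inv h1,
    (extChartAt 𝓘(ℝ, E) (1 : G)).left_inv h2]

/-- The curve is `g c(t) g⁻¹`, which moves in the possibly non-horizontal direction `Ad_g X`. Each
of its three factors costs at most `s`. -/
theorem exists_curve_of_conj [FiniteDimensional ℝ E] {s : ℝ} (hs : 0 < s) {g : G}
    (hg : g ∈ ccBall ip 𝓗 1 s) {X : GroupLieAlgebra 𝓘(ℝ, E) G} (hX : X ∈ 𝓗) :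
    ∃ σ : ℝ → G, σ 0 = 1 ∧ ContinuousAt σ 0 ∧
      HasStrictDerivAt (fun t => extChartAt 𝓘(ℝ, E) (1 : G) (σ t)) (chartAd E g X) 0 ∧
      ∀ᶠ t in 𝓝 (0 : ℝ), ccEDist ip 𝓗 1 (σ t) ≤ ENNReal.ofReal (3 * s) := by
  have : IsTopologicalGroup G := topologicalGroup_of_lieGroup 𝓘(ℝ, E) ∞
  obtain ⟨c, hc0, hcont, hcd, hcb⟩ := exists_horizontal_integralCurve ip hX
  refine ⟨fun t => g * c t * g⁻¹, by simp [hc0],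
    (continuousAt_const.mul hcont).mul continuousAt_const, ?_, ?_⟩
  · have hk : HasStrictFDerivAt (chartConj E g) (chartAd E g)
        (extChartAt 𝓘(ℝ, E) (1 : G) (c 0)) := by
      rw [hc0]
      exact (contDiffAt_chartConj (E := E) g).hasStrictFDerivAt (by simp)
    refine (hk.comp_hasStrictDerivAt (0 : ℝ) hcd).congr_of_eventuallyEq ?_
    have hsrc : ∀ᶠ t in 𝓝 (0 : ℝ), c t ∈ (extChartAt 𝓘(ℝ, E) (1 : G)).source :=
      hcont.eventually_mem (by rw [hc0]; exact extChartAt_source_mem_nhds (1 : G))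
    filter_upwards [hsrc] with t ht
    simp only [Function.comp_apply, chartConj, (extChartAt 𝓘(ℝ, E) (1 : G)).left_inv ht]
  · filter_upwards [hcb s hs] with t ht
    have h1 := ccEDist_one_mul_le ip (𝓗 := 𝓗) (g * c t) g⁻¹
    have h2 := ccEDist_one_mul_le ip (𝓗 := 𝓗) g (c t)
    rw [ccEDist_one_inv] at h1
    calc _ ≤ ENNReal.ofReal s + ENNReal.ofReal s + ENNReal.ofReal s :=
          h1.trans (add_le_add (h2.trans (add_le_add (le_of_lt hg) (le_of_lt ht))) (le_of_lt hg))
      _ = _ := by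
        rw [← ENNReal.ofReal_add hs.le hs.le, ← ENNReal.ofReal_add (by positivity) hs.le]
        congr 1; ring

/-- Chow's theorem: the balls for the Carnot–Carathéodory distance are neighbourhoods of their
centre. -/
theorem ccBall_mem_nhds_one [FiniteDimensional ℝ E]
    (h𝓗 : LieSubalgebra.lieSpan ℝ (GroupLieAlgebra 𝓘(ℝ, E) G)
      (𝓗 : Set (GroupLieAlgebra 𝓘(ℝ, E) G)) = ⊤) {r : ℝ} (hr : 0 < r) :
    ccBall ip 𝓗 1 r ∈ 𝓝 (1 : G) := by
  have : IsTopologicalGroup G := topologicalGroup_of_lieGroup 𝓘(ℝ, E) ∞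
  have : CompleteSpace E := FiniteDimensional.complete ℝ E
  -- A product of `finrank` curves, each reaching distance at most `3 * s`, stays strictly below
  -- `r`; the extra `1` gives strictness and covers dimension zero.
  set s : ℝ := r / (3 * (Module.finrank ℝ E + 1)) with hs_def
  have hs : 0 < s := by positivity
  have hspan := conjSpan_eq_top ip h𝓗 hs
  obtain ⟨ι, b, hbmem⟩ : ∃ (ι : Type _) (b : Module.Basis ι ℝ E), ∀ i, b i ∈ {w |
      ∃ g ∈ ccBall ip 𝓗 1 s, ∃ X : GroupLieAlgebra 𝓘(ℝ, E) G, X ∈ 𝓗 ∧ chartAd E g X = w} :=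
    ⟨_, Module.Basis.ofSpan hspan.ge,
      fun i => Module.Basis.ofSpan_subset hspan.ge (mem_range_self i)⟩
  have hb : ∀ i, ∃ σ : ℝ → G, σ 0 = 1 ∧ ContinuousAt σ 0 ∧
      HasStrictDerivAt (fun t => extChartAt 𝓘(ℝ, E) (1 : G) (σ t)) (b i) 0 ∧
      ∀ᶠ t in 𝓝 (0 : ℝ), ccEDist ip 𝓗 1 (σ t) ≤ ENNReal.ofReal (3 * s) := by
    intro i
    obtain ⟨g, hg, X, hX, hw⟩ := hbmem i
    obtain ⟨σ, h⟩ := exists_curve_of_conj ip hs hg hX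
    exact ⟨σ, by rw [← hw]; exact h⟩
  choose σ hσ0 hσc hσd hσb using hb
  have : Fintype ι := FiniteDimensional.fintypeBasisIndex b
  let x' := fun i => LinearMap.toContinuousLinearMap (b.coord i)
  -- `Φ` is the ordered product of the `σ i` at the coordinates of `x`. Over the full list its
  -- derivative at `0` is the identity, hence `Φ` is open at `0`.
  have key : ∀ l : List ι, ∃ Φ : E → G, Φ 0 = 1 ∧ ContinuousAt Φ 0 ∧
      HasStrictFDerivAt (fun x => extChartAt 𝓘(ℝ, E) (1 : G) (Φ x))
        ((l.map fun i => (x' i).smulRight (b i)).sum) 0 ∧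
      ∀ᶠ x in 𝓝 (0 : E), ccEDist ip 𝓗 1 (Φ x) ≤ ENNReal.ofReal (l.length * (3 * s)) := by
    intro l
    induction l with
    | nil =>
      refine ⟨fun _ => 1, rfl, continuousAt_const, ?_, ?_⟩
      · simpa using hasStrictFDerivAt_const _ _
      · simp [ccEDist_self]
    | cons i l ih =>
      obtain ⟨Φ, h1, h2, h3, h4⟩ := ih
      have hx0 : x' i 0 = 0 := map_zero _
      have hxc : ContinuousAt (fun x => x' i x) 0 := (x' i).continuous.continuousAt
      have hc : ContinuousAt (fun x => σ i (x' i x)) 0 :=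
        ContinuousAt.comp (f := fun x => x' i x) (by rw [hx0]; exact hσc i) hxc
      refine ⟨fun x => σ i (x' i x) * Φ x, by simp [hσ0, h1], hc.mul h2, ?_, ?_⟩
      · rw [List.map_cons, List.sum_cons]
        refine HasStrictFDerivAt.chart_mul hc h2 (by simp [hσ0]) h1 ?_ h3
        have hd : HasStrictFDerivAt (fun t => extChartAt 𝓘(ℝ, E) (1 : G) (σ i t))
            (ContinuousLinearMap.toSpanSingleton ℝ (b i)) (x' i 0) := by
          rw [hx0]; exact (hσd i).hasStrictFDerivAt
        exact HasStrictFDerivAt.comp (f := fun x => x' i x) 0 hd (x' i).hasStrictFDerivAt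
      · have h5 : ∀ᶠ x in 𝓝 (0 : E), ccEDist ip 𝓗 1 (σ i (x' i x)) ≤ ENNReal.ofReal (3 * s) := by
          have ht : Tendsto (fun x => x' i x) (𝓝 0) (𝓝 0) := by
            have := hxc.tendsto
            rwa [hx0] at this
          exact ht.eventually (hσb i)
        filter_upwards [h4, h5] with x hx4 hx5
        refine (ccEDist_one_mul_le ip _ _).trans ((add_le_add hx5 hx4).trans_eq ?_)
        rw [← ENNReal.ofReal_add (by positivity) (by positivity)]
        congr 1
        push_cast [List.length_cons]
        ring
  obtain ⟨Φ, h1, h2, h3, h4⟩ := key (Finset.univ : Finset ι).toList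
  have hsum : (((Finset.univ : Finset ι).toList.map fun i => (x' i).smulRight (b i)).sum : E →L[ℝ] E) =
      ContinuousLinearMap.id ℝ E := by
    rw [Finset.sum_map_toList]
    ext v
    simp only [sum_apply, ContinuousLinearMap.smulRight_apply,
      ContinuousLinearMap.id_apply, x', LinearMap.coe_toContinuousLinearMap', Module.Basis.coord_apply]
    exact b.sum_repr v
  rw [hsum] at h3
  have hopen := h3.map_nhds_eq_of_surj (by rw [LinearMap.range_eq_top]; exact Function.surjective_id)
  have hlen : ENNReal.ofReal (((Finset.univ : Finset ι).toList.length : ℕ) * (3 * s)) < ENNReal.ofReal r := by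
    rw [Finset.length_toList, Finset.card_univ, ← Module.finrank_eq_card_basis b]
    rw [ENNReal.ofReal_lt_ofReal_iff hr]
    have e : ((Module.finrank ℝ E : ℝ) + 1) * (3 * s) = r := by
      rw [hs_def]; field_simp
    nlinarith
  have hsrc : ∀ᶠ x in 𝓝 (0 : E), Φ x ∈ (extChartAt 𝓘(ℝ, E) (1 : G)).source :=
    h2.eventually_mem (by rw [h1]; exact extChartAt_source_mem_nhds (1 : G))
  have himg : (fun x => extChartAt 𝓘(ℝ, E) (1 : G) (Φ x)) ''
      {x | ccEDist ip 𝓗 1 (Φ x) ≤ ENNReal.ofReal (((Finset.univ : Finset ι).toList.length : ℕ) * (3 * s)) ∧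
        Φ x ∈ (extChartAt 𝓘(ℝ, E) (1 : G)).source} ∈ 𝓝 (extChartAt 𝓘(ℝ, E) (1 : G) 1) := by
    have := image_mem_map (m := fun x => extChartAt 𝓘(ℝ, E) (1 : G) (Φ x)) (h4.and hsrc)
    rw [hopen, h1] at this
    exact this
  filter_upwards [(continuousAt_extChartAt (I := 𝓘(ℝ, E)) (1 : G)).preimage_mem_nhds himg,
    extChartAt_source_mem_nhds (I := 𝓘(ℝ, E)) (1 : G)] with g ⟨x, hx, hxg⟩ hg
  have : Φ x = g := (extChartAt 𝓘(ℝ, E) (1 : G)).injOn hx.2 hg hxg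
  rw [← this]
  exact hx.1.trans_lt hlen

end Chow

/-! ### The distance as a proper metric compatible with the topology. -/

section CCMetric

open Set Filter
open scoped Topology

variable {E : Type*} [NormedAddCommGroup E] [NormedSpace ℝ E] [FiniteDimensional ℝ E]
  {G : Type*} [t : TopologicalSpace G] [ChartedSpace E G] [Group G] [LieGroup 𝓘(ℝ, E) ∞ G]
  (ip : InnerProductSpace.Core ℝ (GroupLieAlgebra 𝓘(ℝ, E) G))
  {𝓗 : Submodule ℝ (GroupLieAlgebra 𝓘(ℝ, E) G)}

/-- The points at finite distance from `1` form a subgroup, open by Chow's theorem, hence also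
closed and equal to `G`. -/
theorem ccEDist_ne_top [ConnectedSpace G]
    (h𝓗 : LieSubalgebra.lieSpan ℝ (GroupLieAlgebra 𝓘(ℝ, E) G)
      (𝓗 : Set (GroupLieAlgebra 𝓘(ℝ, E) G)) = ⊤) (x y : G) : ccEDist ip 𝓗 x y ≠ ⊤ := by
  have : IsTopologicalGroup G := topologicalGroup_of_lieGroup 𝓘(ℝ, E) ∞
  let S : Subgroup G :=
    { carrier := {g | ccEDist ip 𝓗 1 g < ⊤}
      one_mem' := by simp [ccEDist_self]
      mul_mem' := fun {a b} ha hb =>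
        (ccEDist_one_mul_le ip a b).trans_lt (ENNReal.add_lt_top.2 ⟨ha, hb⟩)
      inv_mem' := fun {a} ha => by
        simpa [ccEDist_one_inv] using ha }
  have hS : IsOpen (S : Set G) := S.isOpen_of_mem_nhds (g := 1) (by
    filter_upwards [ccBall_mem_nhds_one ip h𝓗 one_pos] with g hg
    exact lt_of_lt_of_le (show ccEDist ip 𝓗 1 g < _ from hg) le_top)
  have huniv : (S : Set G) = univ :=
    IsClopen.eq_univ ⟨S.isClosed_of_isOpen hS, hS⟩ ⟨1, S.one_mem⟩
  have h : x⁻¹ * y ∈ (S : Set G) := huniv ▸ mem_univ _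
  have e := ccEDist_mul_left ip (𝓗 := 𝓗) x⁻¹ x y
  rw [inv_mul_cancel] at e
  rw [← e]
  exact ne_of_lt h

omit [FiniteDimensional ℝ E] in
theorem mem_ccBall_iff {x y : G} {r : ℝ} : y ∈ ccBall ip 𝓗 x r ↔ x⁻¹ * y ∈ ccBall ip 𝓗 1 r := by
  have e := ccEDist_mul_left ip (𝓗 := 𝓗) x⁻¹ x y
  rw [inv_mul_cancel] at e
  simp only [ccBall, mem_ofPred_eq, e]

/-- The Carnot–Carathéodory distance is a left-invariant proper distance inducing the topology. -/
theorem exists_metricSpace_ccBall [T2Space G] [ConnectedSpace G]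
    (h𝓗 : LieSubalgebra.lieSpan ℝ (GroupLieAlgebra 𝓘(ℝ, E) G)
      (𝓗 : Set (GroupLieAlgebra 𝓘(ℝ, E) G)) = ⊤) :
    ∃ m : MetricSpace G, t = m.toUniformSpace.toTopologicalSpace ∧
      (∀ g x y : G, m.dist (g * x) (g * y) = m.dist x y) ∧
      (∀ (x : G) (r : ℝ), IsCompact (Metric.closedBall x r)) ∧
      ∀ (x : G) (r : ℝ), Metric.ball x r = ccBall ip 𝓗 x r := by
  have : IsTopologicalGroup G := topologicalGroup_of_lieGroup 𝓘(ℝ, E) ∞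
  have hfin : ∀ x y, ccEDist ip 𝓗 x y ≠ ⊤ := ccEDist_ne_top ip h𝓗
  have hlt : ∀ x y r, (ccEDist ip 𝓗 x y).toReal < r ↔ y ∈ ccBall ip 𝓗 x r := fun x y r =>
    (ENNReal.lt_ofReal_iff_toReal_lt (hfin x y)).symm
  have hopen : ∀ s : Set G, IsOpen s ↔
      ∀ x ∈ s, ∃ ε > 0, ∀ y, (ccEDist ip 𝓗 x y).toReal < ε → y ∈ s := by
    intro s
    rw [isOpen_iff_mem_nhds]
    refine forall₂_congr fun x _ => ⟨fun h => ?_, fun ⟨ε, hε, h⟩ => ?_⟩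
    · have hU : (fun y => x * y) ⁻¹' s ∈ 𝓝 (1 : G) :=
        (continuous_const_mul x).continuousAt.preimage_mem_nhds (by rwa [mul_one])
      obtain ⟨r, hr, hsub⟩ := exists_ccBall_subset ip 𝓗 hU
      refine ⟨r, hr, fun y hy => ?_⟩
      have := hsub ((mem_ccBall_iff ip).1 ((hlt _ _ _).1 hy))
      simpa using this
    · have hx : (fun y => x⁻¹ * y) ⁻¹' ccBall ip 𝓗 1 ε ∈ 𝓝 x :=
        (continuous_const_mul x⁻¹).continuousAt.preimage_mem_nhds
          (by rw [inv_mul_cancel]; exact ccBall_mem_nhds_one ip h𝓗 hε)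
      filter_upwards [hx] with y hy
      exact h y ((hlt _ _ _).2 ((mem_ccBall_iff ip).2 hy))
  -- This constructor keeps the given topology, which makes the first claim hold by `rfl`.
  let m : MetricSpace G := MetricSpace.ofDistTopology (fun x y => (ccEDist ip 𝓗 x y).toReal)
    (fun x => by simp [ccEDist_self]) (fun x y => by rw [ccEDist_comm])
    (fun x y z => by
      rw [← ENNReal.toReal_add (hfin x y) (hfin y z)]
      exact ENNReal.toReal_mono (ENNReal.add_ne_top.2 ⟨hfin x y, hfin y z⟩)
        (ccEDist_triangle ip x y z))
    hopen (fun x y hxy => by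
      by_contra hne
      have hU : ({x⁻¹ * y}ᶜ : Set G) ∈ 𝓝 (1 : G) := by
        refine isOpen_compl_singleton.mem_nhds ?_
        simp only [mem_compl_iff, mem_singleton_iff]
        intro h
        exact hne (inv_mul_eq_one.1 h.symm)
      obtain ⟨r, hr, hsub⟩ := exists_ccBall_subset ip 𝓗 hU
      exact hsub ((mem_ccBall_iff ip).1 ((hlt _ _ _).1 (hxy.trans_lt hr))) rfl)
  have hdist : ∀ x y, m.dist x y = (ccEDist ip 𝓗 x y).toReal := fun _ _ => rfl
  have hballs : ∀ (x : G) (r : ℝ), @Metric.ball G m.toPseudoMetricSpace x r = ccBall ip 𝓗 x r := fun x r => by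
    ext y
    rw [← hlt, ← hdist]
    exact Metric.mem_ball'
  refine ⟨m, rfl, fun g x y => ?_, fun x r => ?_, hballs⟩
  · rw [hdist, hdist, ccEDist_mul_left]
  · obtain ⟨K, hK, hsub⟩ := exists_isCompact_ccBall_subset ip 𝓗 (r + 1)
    have hcl : IsClosed (@Metric.closedBall G m.toPseudoMetricSpace x r) := Metric.isClosed_closedBall
    have hxK : IsCompact ((fun y => x * y) '' K) := hK.image (continuous_const_mul x)
    refine hxK.of_isClosed_subset hcl fun y hy => ?_
    have h1 : y ∈ @Metric.ball G m.toPseudoMetricSpace x (r + 1) :=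
      Metric.closedBall_subset_ball (lt_add_one r) hy
    rw [hballs] at h1
    exact ⟨x⁻¹ * y, hsub ((mem_ccBall_iff ip).1 h1), by simp⟩

end CCMetric

/-! ### Doubling measures on groups with a proper left-invariant metric. -/

section InvariantDoubling

open Set Filter Metric
open scoped Topology Pointwise

variable {X : Type*} [MetricSpace X] [MeasurableSpace X]

omit [MeasurableSpace X] in
theorem exists_finset_ball_subset_iUnion [Group X] [IsIsometricSMul X X] [ProperSpace X]
    {s : ℝ} (hs : 0 < s) (R : ℝ) : ∃ F : Finset X, (∀ y ∈ F, dist y 1 ≤ R) ∧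
      ∀ x : X, ball x R ⊆ ⋃ y ∈ F, ball (x * y) s := by
  obtain ⟨t, ht1, ht, hcov⟩ := (isCompact_closedBall (1 : X) R).finite_cover_balls hs
  refine ⟨ht.toFinset, fun y hy => ht1 (ht.mem_toFinset.1 hy), fun x z hz => ?_⟩
  have hz' : x⁻¹ * z ∈ closedBall (1 : X) R := by
    rw [mem_closedBall, ← dist_mul_left x, mul_inv_cancel_left, mul_one]
    exact (mem_ball.1 hz).le
  obtain ⟨y, hy, hzy⟩ := mem_iUnion₂.1 (hcov hz')
  refine mem_iUnion₂.2 ⟨y, ht.mem_toFinset.2 hy, ?_⟩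
  rw [mem_ball, ← dist_mul_left x, mul_inv_cancel_left] at hzy
  exact hzy

/-- On a connected proper metric group, a measure which is doubling at one scale `s` satisfies
comparisons of balls of radius `R` with balls of radius `s`, uniformly in the centre. -/
theorem exists_measure_ball_le_mul [Group X] [ContinuousMul X] [IsIsometricSMul X X] [ProperSpace X]
    [ConnectedSpace X] {ν : Measure X} {s : ℝ} (hs : 0 < s) {C : ℝ≥0}
    (h : ∀ x, ν (ball x (2 * s)) ≤ C * ν (ball x s)) (R : ℝ) :
    ∃ K : ℝ≥0, ∀ x, ν (ball x R) ≤ K * ν (ball x s) := by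
  -- Uniformity in `x` makes `T` multiplicative. It holds near `1` by doubling, as `dist (x * y) x =
  -- dist y 1`, and connectedness gives every `y`.
  let T : X → Prop := fun y => ∃ K : ℝ≥0, ∀ x, ν (ball (x * y) s) ≤ K * ν (ball x s)
  have hmul : ∀ {a b}, T a → T b → T (a * b) := by
    rintro a b ⟨K, hK⟩ ⟨L, hL⟩
    refine ⟨L * K, fun x => ?_⟩
    rw [← mul_assoc x, ENNReal.coe_mul, mul_assoc (L : ℝ≥0∞)]
    exact (hL _).trans (mul_le_mul_right (hK x) _)
  have hnear : ∀ y, dist y 1 < s → T y := fun y hy => ⟨C, fun x => by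
    refine (measure_mono (ball_subset_ball' ?_)).trans (h x)
    have : dist (x * y) x = dist y 1 := by
      simpa using dist_mul_left x y 1
    linarith⟩
  let S : Subgroup X :=
    { carrier := {y | T y ∧ T y⁻¹}
      one_mem' := ⟨hnear _ (by simpa using hs), hnear _ (by simpa using hs)⟩
      mul_mem' := fun {a b} ha hb => ⟨hmul ha.1 hb.1, by
        rw [mul_inv_rev]; exact hmul hb.2 ha.2⟩
      inv_mem' := fun {a} ha => ⟨ha.2, by rw [inv_inv]; exact ha.1⟩ }
  have hS : IsOpen (S : Set X) := S.isOpen_of_mem_nhds (g := 1) (by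
    filter_upwards [ball_mem_nhds (1 : X) hs] with y hy
    refine ⟨hnear y hy, hnear _ ?_⟩
    have : dist y⁻¹ 1 = dist y 1 := by
      have := dist_mul_left y y⁻¹ 1
      rw [mul_inv_cancel, mul_one] at this
      rw [← this, dist_comm]
    rw [this]; exact hy)
  have huniv : (S : Set X) = univ :=
    IsClopen.eq_univ ⟨S.isClosed_of_isOpen hS, hS⟩ ⟨1, S.one_mem⟩
  have hT : ∀ y, T y := fun y => (show y ∈ (S : Set X) from huniv ▸ mem_univ y).1
  choose K hK using hT
  obtain ⟨F, -, hF⟩ := exists_finset_ball_subset_iUnion (X := X) hs R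
  refine ⟨∑ y ∈ F, K y, fun x => ?_⟩
  calc ν (ball x R) ≤ ∑ y ∈ F, ν (ball (x * y) s) :=
        (measure_mono (hF x)).trans (measure_biUnion_finset_le _ _)
    _ ≤ ∑ y ∈ F, (K y : ℝ≥0∞) * ν (ball x s) := Finset.sum_le_sum fun y _ => hK y x
    _ = _ := by rw [← Finset.sum_mul, ENNReal.ofNNReal_finsetSum]

theorem DoublingUpTo.locallyDoubling [Group X] [ContinuousMul X] [IsIsometricSMul X X]
    [ProperSpace X] [ConnectedSpace X] {ν : Measure X} {s : ℝ} (hs : 0 < s)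
    (h : DoublingUpTo ball ν s) : LocallyDoubling ball ν := by
  intro R hR
  obtain ⟨C, hC, hd⟩ := h
  obtain ⟨K, hK⟩ := exists_measure_ball_le_mul hs (fun x => hd x s hs le_rfl) (2 * R)
  refine ⟨max C K, hC.trans_le (le_max_left _ _), fun x r hr hrR => ?_⟩
  rcases le_total r s with h | h
  · exact (hd x r hr h).trans (by gcongr; exact le_max_left _ _)
  · calc ν (ball x (2 * r)) ≤ ν (ball x (2 * R)) := measure_mono (ball_subset_ball (by linarith))
      _ ≤ K * ν (ball x s) := hK x
      _ ≤ _ := by gcongr; exact le_max_right _ _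

theorem DoublingUpTo.measure_ball_two_pow_le {ν : Measure X} {R : ℝ} {C : ℝ≥0}
    (h : ∀ (x : X) (r : ℝ), 0 < r → r ≤ R → ν (ball x (2 * r)) ≤ C * ν (ball x r)) (x : X) {r : ℝ}
    (hr : 0 < r) (n : ℕ) (hn : 2 ^ n * r ≤ 2 * R) : ν (ball x (2 ^ n * r)) ≤ C ^ n * ν (ball x r) := by
  induction n with
  | zero => simp
  | succ n ih =>
    have h1 : 2 ^ n * r ≤ R := by rw [pow_succ] at hn; linarith
    have h0 : 0 < 2 ^ n * r := by positivity
    have h2 : (2 : ℝ) ^ (n + 1) * r = 2 * (2 ^ n * r) := by ring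
    rw [h2, pow_succ']
    refine (h x _ h0 h1).trans ?_
    rw [mul_assoc]
    gcongr
    exact ih (by linarith)

/-- Doubling inflates any null ball to radius `R` around the same centre. The set of centres of null
balls is therefore open and closed; if non-empty it is everything, and `ν` vanishes. -/
theorem DoublingUpTo.measure_ball_pos [ConnectedSpace X] [SecondCountableTopology X] {ν : Measure X}
    {R : ℝ} (hR : 0 < R) (h : DoublingUpTo ball ν R) (hν : ν ≠ 0) (x : X) {r : ℝ} (hr : 0 < r) :
    0 < ν (ball x r) := by
  obtain ⟨C, -, hd⟩ := h
  by_contra hx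
  have hx : ν (ball x r) = 0 := by simpa using hx
  let U : Set X := {y | ∃ ρ > 0, ν (ball y ρ) = 0}
  have hUR : ∀ y ∈ U, ν (ball y R) = 0 := by
    rintro y ⟨ρ, hρ, hy⟩
    -- Capping at `R` keeps every radius in the range where doubling is available.
    have key : ∀ n : ℕ, ν (ball y (min R (2 ^ n * ρ))) = 0 := by
      intro n
      induction n with
      | zero =>
        exact measure_mono_null (ball_subset_ball (by simp)) hy
      | succ n ih =>
        have h0 : 0 < min R (2 ^ n * ρ) := lt_min hR (by positivity)
        have := hd y _ h0 (min_le_left _ _)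
        rw [ih, mul_zero, nonpos_iff_eq_zero] at this
        refine measure_mono_null (ball_subset_ball ?_) this
        rw [mul_min_of_nonneg _ _ (by norm_num), pow_succ]
        exact min_le_min (by linarith) (by linarith)
    obtain ⟨n, hn⟩ := pow_unbounded_of_one_lt (R / ρ) (one_lt_two)
    have := key n
    rwa [min_eq_left] at this
    rw [div_lt_iff₀ hρ] at hn
    exact hn.le
  have hopen : IsOpen U := by
    rw [Metric.isOpen_iff]
    rintro y ⟨ρ, hρ, hy⟩
    refine ⟨ρ / 2, by positivity, fun z hz => ⟨ρ / 2, by positivity, ?_⟩⟩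
    exact measure_mono_null (ball_subset_ball' (by rw [mem_ball] at hz; linarith)) hy
  have hclosed : IsClosed U := by
    refine isClosed_of_closure_subset fun y hy => ?_
    obtain ⟨z, hz, hyz⟩ := mem_closure_iff.1 hy (R / 2) (by positivity)
    exact ⟨R / 2, by positivity,
      measure_mono_null (ball_subset_ball' (by linarith)) (hUR z hz)⟩
  have huniv : U = univ := IsClopen.eq_univ ⟨hclosed, hopen⟩ ⟨x, r, hr, hx⟩
  apply hν
  rw [← Measure.measure_univ_eq_zero]
  refine measure_null_of_locally_null _ fun y _ => ?_
  obtain ⟨ρ, hρ, hy⟩ := (show y ∈ U from huniv ▸ mem_univ y)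
  exact ⟨ball y ρ, mem_nhdsWithin_of_mem_nhds (ball_mem_nhds y hρ), hy⟩

/-- A measure all of whose balls of the same radius have the same measure is doubling at small
scales as soon as there is some measure which is. -/
theorem DoublingUpTo.of_measure_ball_eq [SecondCountableTopology X] [BorelSpace X]
    {μ ν : Measure X} [SFinite μ] [SFinite ν] {R : ℝ} (h : DoublingUpTo ball ν R)
    (hpos : ∀ x r, 0 < r → 0 < ν (ball x r)) (hfin : ∀ x r, ν (ball x r) < ⊤)
    {V : ℝ → ℝ≥0∞} (hV : ∀ x r, μ (ball x r) = V r) : DoublingUpTo ball μ (R / 4) := by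
  obtain ⟨C, hC, hd⟩ := h
  refine ⟨C ^ 3, by positivity, fun x r hr hrR => ?_⟩
  have hmeas : MeasurableSet {p : X × X | dist p.2 p.1 < r} :=
    (isOpen_lt (by fun_prop) (by fun_prop)).measurableSet
  have hcomp : ∀ y ∈ ball x (2 * r), ν (ball x (3 * r)) ≤ C ^ 3 * ν (ball y r) := by
    intro y hy
    -- The ball of radius `3r` about `x` lies in that of radius `8r` about `y`: three doublings,
    -- which also explains `R / 4` and `C ^ 3`.
    refine (measure_mono (ball_subset_ball' ?_)).trans
      (DoublingUpTo.measure_ball_two_pow_le hd y hr 3 (by linarith))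
    rw [mem_ball, dist_comm] at hy
    linarith
  have h1 : V (2 * r) * ν (ball x (3 * r)) ≤ C ^ 3 * ∫⁻ y in ball x (2 * r), ν (ball y r) ∂μ := by
    rw [← hV x, mul_comm, ← setLIntegral_const, ← lintegral_const_mul']
    · exact setLIntegral_mono' measurableSet_ball hcomp
    · finiteness
  -- Double counting of pairs at distance less than `r`: by Fubini the inner integral becomes the
  -- `μ`-measure of part of a ball of radius `r`, at most `V r`. With `h1`, the common factor `ν
  -- (ball x (3 * r))` cancels.
  have h2 : ∫⁻ y in ball x (2 * r), ν (ball y r) ∂μ ≤ V r * ν (ball x (3 * r)) := by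
    have e : ∀ y ∈ ball x (2 * r), ν (ball y r) =
        ∫⁻ z in ball x (3 * r), {p : X × X | dist p.2 p.1 < r}.indicator 1 (y, z) ∂ν := by
      intro y hy
      have : (fun z => {p : X × X | dist p.2 p.1 < r}.indicator (1 : X × X → ℝ≥0∞) (y, z)) =
          (ball y r).indicator 1 := by
        ext z; simp [indicator, mem_ball]
      rw [this, lintegral_indicator_one measurableSet_ball,
        Measure.restrict_apply measurableSet_ball, inter_eq_left.2]
      refine ball_subset_ball' ?_
      rw [mem_ball] at hy
      linarith
    rw [setLIntegral_congr_fun measurableSet_ball e, lintegral_lintegral_swap]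
    · rw [← setLIntegral_const]
      refine lintegral_mono fun z => ?_
      have : (fun y => {p : X × X | dist p.2 p.1 < r}.indicator (1 : X × X → ℝ≥0∞) (y, z)) =
          (ball z r).indicator 1 := by
        ext y; simp [indicator, mem_ball, dist_comm]
      rw [this, lintegral_indicator_one measurableSet_ball, ← hV z]
      exact Measure.restrict_apply_le _ _
    · exact (measurable_one.indicator hmeas).aemeasurable
  have h3 := h1.trans (mul_le_mul_right h2 (C ^ 3 : ℝ≥0∞))
  rw [← mul_assoc, ENNReal.mul_le_mul_iff_left (hpos x _ (by positivity)).ne' (hfin _ _).ne] at h3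
  rw [hV, hV, ENNReal.coe_pow]
  exact h3

end InvariantDoubling

/-! ### Level sets of the density: differentiation, stopping radii, covering. -/

section DensityLevels

open Set Filter Metric
open scoped Topology

section Density

variable {X : Type*} [MeasurableSpace X] {μ : Measure X} {W : X → ℝ≥0∞} {E : Set X} {c : ℝ}

theorem measureReal_withDensity_le (hc : 0 ≤ c) (hE : MeasurableSet E) (hμ : μ E ≠ ⊤)
    (h : ∀ x ∈ E, W x ≤ ENNReal.ofReal c) : (μ.withDensity W).real E ≤ c * μ.real E := by
  rw [measureReal_def, measureReal_def, ← ENNReal.toReal_ofReal hc, ← ENNReal.toReal_mul,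
    withDensity_apply _ hE]
  refine ENNReal.toReal_mono (by finiteness) ?_
  rw [← setLIntegral_const]
  exact setLIntegral_mono' hE h

theorem mul_measureReal_le_withDensity (hc : 0 ≤ c) (hE : MeasurableSet E)
    (hν : μ.withDensity W E ≠ ⊤) (h : ∀ x ∈ E, ENNReal.ofReal c ≤ W x) :
    c * μ.real E ≤ (μ.withDensity W).real E := by
  rw [measureReal_def, measureReal_def, ← ENNReal.toReal_ofReal hc, ← ENNReal.toReal_mul]
  refine ENNReal.toReal_mono hν ?_
  rw [withDensity_apply _ hE, ← setLIntegral_const]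
  exact setLIntegral_mono' hE h

/-- If the density has average comparable with `t` on `B`, and the null sets of the two measures are
quantitatively comparable in `B`, then the density is of order `t` on a fixed fraction of `B`. -/
theorem measureReal_le_mul_level_diff (hW : Measurable W) {B : Set X} (hB : MeasurableSet B)
    (hμ : μ B ≠ ⊤) (hν : μ.withDensity W B ≠ ⊤) {α β D t : ℝ} (hα : 0 < α) (hβ : β < 1)
    (hD : 0 < D) (ht : 0 < t) (hν0 : 0 < (μ.withDensity W).real B)
    (hS : ∀ F ⊆ B, MeasurableSet F → (μ.withDensity W).real F ≤ α * (μ.withDensity W).real B →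
      μ.real F ≤ β * μ.real B)
    (h1 : (μ.withDensity W).real B ≤ t * μ.real B) (h2 : t * μ.real B ≤ D * (μ.withDensity W).real B) :
    μ.real B ≤ 4 * D / ((1 - β) * α) * μ.real
      ((B ∩ {x | W x < ENNReal.ofReal (2 * t / (1 - β))}) \
        {x | W x < ENNReal.ofReal (α * t / (2 * D))}) := by
  set ν := μ.withDensity W with hνdef
  have hβ' : 0 < 1 - β := by linarith
  have hlev : ∀ s : ℝ≥0∞, MeasurableSet {x | W x < s} := fun s => measurableSet_lt hW measurable_const
  set P := B ∩ {x | W x < ENNReal.ofReal (2 * t / (1 - β))} with hP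
  set Q := {x | W x < ENNReal.ofReal (α * t / (2 * D))} with hQ
  have hPm : MeasurableSet P := hB.inter (hlev _)
  have hsub : ∀ {F : Set X}, F ⊆ B → μ F ≠ ⊤ := fun h => measure_ne_top_of_subset h hμ
  have hsubν : ∀ {F : Set X}, F ⊆ B → ν F ≠ ⊤ := fun h => measure_ne_top_of_subset h hν
  have hμ0 : 0 < μ.real B := by
    by_contra h
    have : μ.real B = 0 := le_antisymm (not_lt.1 h) measureReal_nonneg
    rw [this, mul_zero] at h1
    linarith
  -- Otherwise `hS` leaves `μ`-measure at least `(1 - β) μ(B)` outside `P`, where the density is at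
  -- least `2t / (1 - β)`; this exceeds the mass `t μ(B)` allowed by `h1`.
  have hPle : α * ν.real B < ν.real P := by
    by_contra h
    have h3 := hS P inter_subset_left hPm (not_lt.1 h)
    have h4 : 2 * t / (1 - β) * μ.real (B \ P) ≤ ν.real (B \ P) := by
      refine mul_measureReal_le_withDensity (by positivity) (hB.diff hPm) (hsubν sdiff_subset) ?_
      rintro x ⟨hx, hxP⟩
      by_contra hlt
      exact hxP ⟨hx, not_le.1 hlt⟩
    have h5 : ν.real (B \ P) ≤ ν.real B := measureReal_mono sdiff_subset hν
    have h6 : μ.real (B \ P) = μ.real B - μ.real P := measureReal_sdiff inter_subset_left hPm hμ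
    have h7 : 2 * t / (1 - β) * ((1 - β) * μ.real B) ≤ t * μ.real B := by
      refine le_trans ?_ (h4.trans (h5.trans h1))
      gcongr
      rw [h6]; linarith
    have h8 : 2 * t / (1 - β) * ((1 - β) * μ.real B) = 2 * (t * μ.real B) := by field_simp
    have := mul_pos ht hμ0
    linarith
  -- The lower level is set so that `Q` carries at most half of the mass just found; the rest lies
  -- in `P \ Q`, where an upper bound for the density turns mass into `μ`-measure.
  have hQle : ν.real (P ∩ Q) ≤ α / 2 * ν.real B := by
    calc ν.real (P ∩ Q) ≤ α * t / (2 * D) * μ.real (P ∩ Q) :=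
          measureReal_withDensity_le (by positivity) (hPm.inter (hlev _))
            (hsub (inter_subset_left.trans inter_subset_left)) fun x hx => (hx.2 : W x < _).le
      _ ≤ α * t / (2 * D) * μ.real B := by
          gcongr
          exact inter_subset_left.trans inter_subset_left
      _ = α / (2 * D) * (t * μ.real B) := by ring
      _ ≤ α / (2 * D) * (D * ν.real B) := by gcongr
      _ = _ := by field_simp
  have h3 : ν.real (P \ Q) ≤ 2 * t / (1 - β) * μ.real (P \ Q) :=
    measureReal_withDensity_le (by positivity) (hPm.diff (hlev _))
      (hsub (sdiff_subset.trans inter_subset_left)) fun x hx => (hx.1.2 : W x < _).le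
  have h4 : ν.real (P ∩ Q) + ν.real (P \ Q) = ν.real P :=
    measureReal_inter_add_sdiff (hlev _) (hsubν inter_subset_left)
  have h5 : α / 2 * ν.real B ≤ 2 * t / (1 - β) * μ.real (P \ Q) := by linarith
  have h6 : α / 2 * (t * μ.real B) ≤ D * (2 * t / (1 - β) * μ.real (P \ Q)) := by
    calc α / 2 * (t * μ.real B) ≤ α / 2 * (D * ν.real B) := by gcongr
      _ = D * (α / 2 * ν.real B) := by ring
      _ ≤ _ := by gcongr
  have h7 : α / 2 * (t * μ.real B) = (α * t / 2) * μ.real B := by ring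
  have h8 : D * (2 * t / (1 - β) * μ.real (P \ Q)) =
      (α * t / 2) * (4 * D / ((1 - β) * α) * μ.real (P \ Q)) := by field_simp; ring
  rw [h7, h8] at h6
  exact le_of_mul_le_mul_left h6 (by positivity)

end Density

variable {X : Type*} [MetricSpace X] [MeasurableSpace X] [BorelSpace X] {μ : Measure X}
  {W : X → ℝ≥0∞}

/-- Lebesgue differentiation concerns closed balls; an open ball is the increasing union of the
smaller concentric closed ones. -/
theorem ae_eventually_withDensity_ball_le [ProperSpace X] [IsUnifLocDoublingMeasure μ]
    [IsFiniteMeasureOnCompacts μ] [μ.IsOpenPosMeasure] (hW : Measurable W)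
    [IsLocallyFiniteMeasure (μ.withDensity W)] :
    ∀ᵐ x ∂μ, ∀ a, W x < a → ∀ᶠ r in 𝓝[>] 0, (μ.withDensity W) (ball x r) ≤ a * μ (ball x r) := by
  have : SigmaFinite μ := inferInstance
  filter_upwards [(IsUnifLocDoublingMeasure.vitaliFamily μ 1).ae_tendsto_rnDeriv
    (μ.withDensity W), Measure.rnDeriv_withDensity μ hW] with x hx hxW a ha
  rw [hxW] at hx
  have hlim := hx.comp (IsUnifLocDoublingMeasure.tendsto_closedBall_filterAt μ (K := 1)
    (fun _ : ℝ => x) (fun r => r) tendsto_id (by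
      filter_upwards [self_mem_nhdsWithin] with r hr
      have : (0 : ℝ) < r := hr
      simpa using this.le))
  obtain ⟨ε, hε, h⟩ := mem_nhdsGT_iff_exists_Ioo_subset.1 (hlim.eventually_lt_const ha)
  filter_upwards [Ioo_mem_nhdsGT hε] with r hr
  have hcl : ∀ s ∈ Ioo 0 r, μ.withDensity W (closedBall x s) ≤ a * μ (closedBall x s) := by
    intro s hs
    have h1 : μ.withDensity W (closedBall x s) / μ (closedBall x s) < a := h ⟨hs.1, hs.2.trans hr.2⟩
    exact (ENNReal.div_le_iff (measure_closedBall_pos μ x hs.1).ne'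
      measure_closedBall_lt_top.ne).1 h1.le
  obtain ⟨u, hu, hur, hlimu⟩ := exists_seq_strictMono_tendsto' hr.1
  have hball : ball x r = ⋃ n, closedBall x (u n) := by
    ext y
    simp only [mem_ball, mem_iUnion, mem_closedBall]
    constructor
    · intro hy
      obtain ⟨n, hn⟩ := (hlimu.eventually_const_lt hy).exists
      exact ⟨n, hn.le⟩
    · rintro ⟨n, hn⟩
      exact hn.trans_lt (hur n).2
  have hmono : Monotone fun n => closedBall x (u n) := fun m n hmn =>
    closedBall_subset_closedBall (hu.monotone hmn)
  rw [hball, hmono.measure_iUnion]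
  refine iSup_le fun n => (hcl _ (hur n)).trans ?_
  gcongr
  exact subset_iUnion (fun n => closedBall x (u n)) n

/-- The decay of the sublevel sets of the density between two consecutive levels. -/
theorem measureReal_level_inter_ball_le [SecondCountableTopology X] (hW : Measurable W)
    (hμ : ∀ x r, μ (ball x r) ≠ ⊤) (hν : ∀ x r, μ.withDensity W (ball x r) ≠ ⊤)
    (hν0 : ∀ x r, 0 < r → 0 < (μ.withDensity W).real (ball x r))
    {α β : ℝ} {D : ℝ≥0} {R : ℝ} (hα : 0 < α) (hα1 : α ≤ 1) (hβ0 : 0 ≤ β) (hβ : β < 1) (hD : 1 ≤ D)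
    (hdμ : ∀ (x : X) (r : ℝ), 0 < r → r ≤ 4 * R → μ (ball x (2 * r)) ≤ D * μ (ball x r))
    (hdν : ∀ (x : X) (r : ℝ), 0 < r → r ≤ 4 * R →
      μ.withDensity W (ball x (2 * r)) ≤ D * μ.withDensity W (ball x r))
    (hS : ∀ (x : X) (r : ℝ), 0 < r → r ≤ R → ∀ F ⊆ ball x r, MeasurableSet F →
      (μ.withDensity W).real F ≤ α * (μ.withDensity W).real (ball x r) →
      μ.real F ≤ β * μ.real (ball x r))
    (hae : ∀ᵐ x ∂μ, ∀ a, W x < a →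
      ∀ᶠ r in 𝓝[>] 0, μ.withDensity W (ball x r) ≤ a * μ (ball x r))
    {x₀ : X} {a ρ t : ℝ} (hρ : 0 < ρ) (hρR : ρ ≤ R) (ht : 0 < t)
    (hbig : ∀ x ∈ ball x₀ a, t * μ.real (ball x ρ) < (μ.withDensity W).real (ball x ρ)) :
    (1 + 4 * D ^ 4 / ((1 - β) * α)) *
        μ.real (ball x₀ a ∩ {x | W x < ENNReal.ofReal (α * t / (2 * D))}) ≤
      4 * D ^ 4 / ((1 - β) * α) *
        μ.real (ball x₀ (a + ρ) ∩ {x | W x < ENNReal.ofReal (2 * t / (1 - β))}) := by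
  set ν := μ.withDensity W with hνdef
  have hD0 : (0 : ℝ) < D := by exact_mod_cast one_pos.trans_le hD
  have hD1 : (1 : ℝ) ≤ D := by exact_mod_cast hD
  have hβ' : 0 < 1 - β := by linarith
  have hlev : ∀ s : ℝ≥0∞, MeasurableSet {x | W x < s} := fun s => measurableSet_lt hW measurable_const
  set P := {x | W x < ENNReal.ofReal (2 * t / (1 - β))} with hP
  set Q := {x | W x < ENNReal.ofReal (α * t / (2 * D))} with hQ
  let T : Set X := {x | x ∈ ball x₀ a ∩ Q ∧ ∀ a, W x < a →
      ∀ᶠ r in 𝓝[>] 0, ν (ball x r) ≤ a * μ (ball x r)}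
  -- Stopping radius: the average of the density exceeds `t` at radius `ρ` and is at most `t` at
  -- some radius `ρ / 2 ^ N`, so it crosses `t` between two consecutive dyadic radii.
  have hT : ∀ x ∈ T, ∃ r, 0 < r ∧ r ≤ ρ ∧ ν.real (ball x r) ≤ t * μ.real (ball x r) ∧
      t * μ.real (ball x (2 * r)) < ν.real (ball x (2 * r)) := by
    rintro x ⟨⟨hxa, hxQ⟩, hx⟩
    have hlt : W x < ENNReal.ofReal t := by
      refine (show W x < _ from hxQ).trans_le (ENNReal.ofReal_le_ofReal ?_)
      rw [div_le_iff₀ (by positivity)]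
      nlinarith
    have hev := hx _ hlt
    have htend : Tendsto (fun n : ℕ => ρ * (1 / 2) ^ n) atTop (𝓝[>] 0) := by
      refine tendsto_nhdsWithin_iff.2 ⟨?_, Eventually.of_forall fun n => by
        show 0 < ρ * (1 / 2) ^ n; positivity⟩
      simpa using (tendsto_pow_atTop_nhds_zero_of_lt_one (r := (1 / 2 : ℝ)) (by norm_num)
        (by norm_num)).const_mul ρ
    obtain ⟨N, hN⟩ := (htend.eventually hev).exists
    have hN' : ν.real (ball x (ρ * (1 / 2) ^ N)) ≤ t * μ.real (ball x (ρ * (1 / 2) ^ N)) := by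
      rw [measureReal_def, measureReal_def, ← ENNReal.toReal_ofReal ht.le, ← ENNReal.toReal_mul]
      exact ENNReal.toReal_mono (ENNReal.mul_ne_top (by simp) (hμ _ _)) hN
    by_contra! hcon
    have hbad : ∀ n : ℕ, t * μ.real (ball x (ρ * (1 / 2) ^ n)) <
        ν.real (ball x (ρ * (1 / 2) ^ n)) := by
      intro n
      induction n with
      | zero => simpa using hbig x hxa
      | succ n ih =>
        by_contra hn
        have e : 2 * (ρ * (1 / 2) ^ (n + 1)) = ρ * (1 / 2) ^ n := by rw [pow_succ]; ring
        have := hcon (ρ * (1 / 2) ^ (n + 1)) (by positivity)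
          (mul_le_of_le_one_right hρ.le (pow_le_one₀ (by norm_num) (by norm_num))) (not_lt.1 hn)
        rw [e] at this
        exact absurd ih (not_lt.2 this)
    exact absurd (hbad N) (not_lt.2 hN')
  choose! r hr0 hrρ hrle hrlt using hT
  obtain ⟨u, huT, hdisj, hcov⟩ := Vitali.exists_disjoint_subfamily_covering_enlargement_ball
    T id r ρ hrρ 5 (by norm_num)
  have hucount : u.Countable := hdisj.countable_of_isOpen (fun _ _ => isOpen_ball)
    fun x hx => ⟨x, mem_ball_self (hr0 x (huT hx))⟩
  have hall : ∀ᵐ x ∂μ, x ∈ ball x₀ a ∩ Q → x ∈ T := by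
    filter_upwards [hae] with x hx hxQ
    exact ⟨hxQ, hx⟩
  -- The selected balls being disjoint, these sets are disjoint, and each fills a fixed fraction of
  -- its fivefold enlargement. The factor `D ^ 4` in `K` is `D ^ 3` for passing to radius `5r ≤ 8r`,
  -- times one `D` from the crossing of `t`.
  let E : X → Set X := fun x => (ball x (r x) ∩ P) \ Q
  have hEm : ∀ x, MeasurableSet (E x) := fun x => (measurableSet_ball.inter (hlev _)).diff (hlev _)
  set K : ℝ := 4 * D ^ 4 / ((1 - β) * α) with hK
  have hK0 : 0 ≤ K := by positivity
  have hball : ∀ x ∈ u, μ (ball x (5 * r x)) ≤ ENNReal.ofReal K * μ (E x) := by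
    intro x hx
    have hxT := huT hx
    have hr := hr0 x hxT
    have hrR := (hrρ x hxT).trans hρR
    have h8 : μ (ball x (5 * r x)) ≤ D ^ 3 * μ (ball x (r x)) :=
      (measure_mono (ball_subset_ball (by linarith))).trans
        (DoublingUpTo.measure_ball_two_pow_le hdμ x hr 3 (by linarith))
    have h2 : t * μ.real (ball x (r x)) ≤ D * ν.real (ball x (r x)) := by
      have e1 : t * μ.real (ball x (r x)) ≤ t * μ.real (ball x (2 * r x)) := by
        gcongr
        · exact hμ _ _
        · linarith
      have e2 : ν.real (ball x (2 * r x)) ≤ D * ν.real (ball x (r x)) := by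
        rw [measureReal_def, measureReal_def, ← ENNReal.coe_toReal, ← ENNReal.toReal_mul]
        exact ENNReal.toReal_mono (ENNReal.mul_ne_top (by simp) (hν _ _))
          (hdν x _ hr (by linarith))
      exact e1.trans ((hrlt x hxT).le.trans e2)
    have h3 := measureReal_le_mul_level_diff hW measurableSet_ball (hμ _ _) (hν _ _) hα hβ hD0 ht
      (hν0 _ _ hr) (hS x _ hr hrR) (hrle x hxT) h2
    have hEfin : μ (E x) ≠ ⊤ :=
      measure_ne_top_of_subset (sdiff_subset.trans inter_subset_left) (hμ x (r x))
    have h4 : μ (ball x (r x)) ≤ ENNReal.ofReal (4 * D / ((1 - β) * α)) * μ (E x) := by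
      rw [← ENNReal.toReal_le_toReal (hμ _ _) (ENNReal.mul_ne_top (by simp) hEfin),
        ENNReal.toReal_mul, ENNReal.toReal_ofReal (by positivity)]
      exact h3
    refine h8.trans ((mul_le_mul_right h4 _).trans_eq ?_)
    rw [← mul_assoc]
    congr 1
    rw [← ENNReal.coe_pow, ← ENNReal.ofReal_coe_nnreal, ← ENNReal.ofReal_mul (by positivity)]
    congr 1
    rw [hK, NNReal.coe_pow]; ring
  have hmain : μ (ball x₀ a ∩ Q) ≤
      ENNReal.ofReal K * μ ((ball x₀ (a + ρ) ∩ P) \ (ball x₀ a ∩ Q)) := by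
    calc μ (ball x₀ a ∩ Q) ≤ μ T := measure_mono_ae hall
      _ ≤ μ (⋃ x ∈ u, ball x (5 * r x)) := by
        refine measure_mono fun x hx => ?_
        obtain ⟨y, hy, hxy⟩ := hcov x hx
        exact mem_iUnion₂.2 ⟨y, hy, hxy (mem_ball_self (hr0 x hx))⟩
      _ ≤ ∑' x : u, μ (ball (x : X) (5 * r x)) := measure_biUnion_le μ hucount _
      _ ≤ ∑' x : u, ENNReal.ofReal K * μ (E x) := ENNReal.tsum_le_tsum fun x => hball x x.2
      _ = ENNReal.ofReal K * μ (⋃ x ∈ u, E x) := by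
        rw [ENNReal.tsum_mul_left, measure_biUnion hucount _ fun x _ => hEm x]
        exact hdisj.mono fun x => sdiff_subset.trans inter_subset_left
      _ ≤ _ := by
        gcongr
        refine iUnion₂_subset fun x hx y hy => ⟨⟨?_, hy.1.2⟩, fun h => hy.2 h.2⟩
        have h1 := hy.1.1
        have h2 : x ∈ ball x₀ a := (huT hx).1.1
        rw [mem_ball] at *
        linarith [dist_triangle y x x₀, hrρ x (huT hx)]
  have hsub : ball x₀ a ∩ Q ⊆ ball x₀ (a + ρ) ∩ P := by
    refine inter_subset_inter (ball_subset_ball (by linarith)) fun x hx => ?_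
    refine (show W x < _ from hx).trans_le (ENNReal.ofReal_le_ofReal ?_)
    have h1 : α * t / (2 * D) ≤ t := by
      rw [div_le_iff₀ (by positivity)]; nlinarith
    refine h1.trans ?_
    rw [le_div_iff₀ hβ']
    nlinarith
  have hfin : μ (ball x₀ (a + ρ) ∩ P) ≠ ⊤ := measure_ne_top_of_subset inter_subset_left (hμ _ _)
  have hfin' := measure_ne_top_of_subset hsub hfin
  -- The lower set is bounded by `K` times the upper set minus the lower one; adding `K` times the
  -- lower set to both sides gives the factor `1 + K`.
  have hreal := ENNReal.toReal_mono
    (ENNReal.mul_ne_top (by simp) (measure_ne_top_of_subset sdiff_subset hfin)) hmain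
  rw [ENNReal.toReal_mul, ENNReal.toReal_ofReal hK0] at hreal
  have hdiff : μ.real ((ball x₀ (a + ρ) ∩ P) \ (ball x₀ a ∩ Q)) =
      μ.real (ball x₀ (a + ρ) ∩ P) - μ.real (ball x₀ a ∩ Q) :=
    measureReal_sdiff hsub (measurableSet_ball.inter (hlev _)) hfin
  simp only [← measureReal_def] at hreal
  rw [hdiff] at hreal
  linarith

end DensityLevels

/-! ### Integrability of a small negative power of the density. -/

section NegativePowers

open Set Filter Metric
open scoped Topology

/-- A discrete layer-cake bound: the first level `s / L ^ k` not above `a` selects the dominating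
term. If there is none then `a` lies below all levels and the series diverges. -/
theorem rpow_neg_le_add_tsum_indicator {s L η : ℝ} (hs : 0 < s) (hL : 1 < L) (hη : 0 < η)
    (a : ℝ≥0∞) : a ^ (-η) ≤ ENNReal.ofReal (s ^ (-η)) +
      ∑' k : ℕ, ENNReal.ofReal ((s / L ^ (k + 1)) ^ (-η)) *
        (Iio (ENNReal.ofReal (s / L ^ k))).indicator 1 a := by
  have hL0 : 0 < L := by linarith
  have key : ∀ c : ℝ, 0 < c → ENNReal.ofReal c ≤ a → a ^ (-η) ≤ ENNReal.ofReal (c ^ (-η)) := by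
    intro c hc hca
    rw [← ENNReal.ofReal_rpow_of_pos hc, ENNReal.rpow_neg, ENNReal.rpow_neg]
    exact ENNReal.inv_le_inv.2 (ENNReal.rpow_le_rpow hca hη.le)
  by_cases h : ∃ k : ℕ, ENNReal.ofReal (s / L ^ k) ≤ a
  · have hspec := Nat.find_spec h
    rcases hn : Nat.find h with _ | k
    · rw [hn] at hspec
      refine (key s hs (by simpa using hspec)).trans le_self_add
    · rw [hn] at hspec
      have hk := not_le.1 (Nat.find_min h (m := k) (by omega))
      refine (key _ (by positivity) hspec).trans (le_trans ?_ le_add_self)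
      refine le_trans ?_ (ENNReal.le_tsum k)
      rw [indicator_of_mem (show a ∈ Iio _ from hk)]
      simp
  · push Not at h
    have : ∑' k : ℕ, ENNReal.ofReal ((s / L ^ (k + 1)) ^ (-η)) *
        (Iio (ENNReal.ofReal (s / L ^ k))).indicator 1 a = ⊤ := by
      rw [eq_top_iff, ← ENNReal.tsum_const_eq_top_of_ne_zero (α := ℕ)
        (c := ENNReal.ofReal (s ^ (-η))) (by simpa using by positivity)]
      refine ENNReal.tsum_le_tsum fun k => ?_
      rw [indicator_of_mem (show a ∈ Iio _ from h k)]
      simp only [Pi.one_apply, mul_one]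
      refine ENNReal.ofReal_le_ofReal (Real.rpow_le_rpow_of_nonpos (by positivity) ?_ (by linarith))
      exact div_le_self hs.le (one_le_pow₀ hL.le)
    rw [this, add_top]
    exact le_top

theorem lintegral_rpow_neg_le {X : Type*} [MeasurableSpace X] {μ : Measure X} {W : X → ℝ≥0∞}
    (hW : Measurable W) {B : Set X} (hμ : μ B ≠ ⊤) {s L η θ M : ℝ}
    (hs : 0 < s) (hL : 1 < L) (hη : 0 < η) (hθ : 0 ≤ θ) (hM : 0 ≤ M) (hq : L ^ η * θ < 1)
    (h : ∀ k : ℕ, μ.real (B ∩ {x | W x < ENNReal.ofReal (s / L ^ k)}) ≤ θ ^ k * M) :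
    ∫⁻ x in B, W x ^ (-η) ∂μ ≤
      ENNReal.ofReal (s ^ (-η) * (μ.real B + L ^ η * M * (1 - L ^ η * θ)⁻¹)) := by
  have hL0 : 0 < L := by linarith
  have hlev : ∀ c : ℝ≥0∞, MeasurableSet {x | W x < c} := fun c => measurableSet_lt hW measurable_const
  have e : ∀ k : ℕ, (fun x => (Iio (ENNReal.ofReal (s / L ^ k))).indicator (1 : ℝ≥0∞ → ℝ≥0∞) (W x)) =
      {x | W x < ENNReal.ofReal (s / L ^ k)}.indicator 1 := fun k => by
    ext x; simp [indicator]
  have hm : ∀ k : ℕ, Measurable fun x =>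
      (Iio (ENNReal.ofReal (s / L ^ k))).indicator (1 : ℝ≥0∞ → ℝ≥0∞) (W x) := fun k => by
    rw [e]; exact measurable_one.indicator (hlev _)
  have hterm : ∀ k : ℕ, ENNReal.ofReal ((s / L ^ (k + 1)) ^ (-η)) *
      ∫⁻ x in B, (Iio (ENNReal.ofReal (s / L ^ k))).indicator 1 (W x) ∂μ ≤
      ENNReal.ofReal (s ^ (-η) * (L ^ η * M) * (L ^ η * θ) ^ k) := by
    intro k
    rw [e, lintegral_indicator_one (hlev _), Measure.restrict_apply (hlev _), inter_comm]
    have h1 : μ (B ∩ {x | W x < ENNReal.ofReal (s / L ^ k)}) ≤ ENNReal.ofReal (θ ^ k * M) := by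
      rw [← ENNReal.ofReal_toReal (measure_ne_top_of_subset inter_subset_left hμ)]
      exact ENNReal.ofReal_le_ofReal (h k)
    refine (mul_le_mul_right h1 _).trans_eq ?_
    rw [← ENNReal.ofReal_mul (by positivity)]
    congr 1
    rw [Real.div_rpow hs.le (by positivity), Real.rpow_neg (x := L ^ (k + 1)) (by positivity),
      ← Real.rpow_natCast L (k + 1), ← Real.rpow_mul hL0.le, mul_comm ((k + 1 : ℕ) : ℝ) η,
      Real.rpow_mul hL0.le, Real.rpow_natCast, div_inv_eq_mul, mul_pow, pow_succ]
    ring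
  have hgeom := (hasSum_geometric_of_lt_one (by positivity) hq).mul_left (s ^ (-η) * (L ^ η * M))
  calc ∫⁻ x in B, W x ^ (-η) ∂μ
      ≤ ∫⁻ x in B, (ENNReal.ofReal (s ^ (-η)) +
          ∑' k : ℕ, ENNReal.ofReal ((s / L ^ (k + 1)) ^ (-η)) *
            (Iio (ENNReal.ofReal (s / L ^ k))).indicator 1 (W x)) ∂μ :=
        lintegral_mono fun x => rpow_neg_le_add_tsum_indicator hs hL hη (W x)
    _ = ENNReal.ofReal (s ^ (-η)) * μ B + ∑' k : ℕ, ENNReal.ofReal ((s / L ^ (k + 1)) ^ (-η)) *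
          ∫⁻ x in B, (Iio (ENNReal.ofReal (s / L ^ k))).indicator 1 (W x) ∂μ := by
        rw [lintegral_add_left measurable_const, setLIntegral_const,
          lintegral_tsum fun k => ((hm k).const_mul _).aemeasurable]
        congr 1
        exact tsum_congr fun k => lintegral_const_mul _ (hm k)
    _ ≤ ENNReal.ofReal (s ^ (-η)) * μ B +
          ∑' k : ℕ, ENNReal.ofReal (s ^ (-η) * (L ^ η * M) * (L ^ η * θ) ^ k) := by
        gcongr with k
        exact hterm k
    _ = _ := by
        rw [← ENNReal.ofReal_tsum_of_nonneg (fun k => by positivity) hgeom.summable, hgeom.tsum_eq,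
          ← ENNReal.ofReal_toReal hμ, ← ENNReal.ofReal_mul (by positivity),
          ← ENNReal.ofReal_add (by positivity)]
        · congr 1
          rw [measureReal_def]; ring
        · have : 0 < 1 - L ^ η * θ := by linarith
          positivity

variable {X : Type*} [MetricSpace X] [MeasurableSpace X] [BorelSpace X] {μ : Measure X}
  {W : X → ℝ≥0∞}

/-- Integrability of a small negative power of the density, with the bound which says that the
density is a Muckenhoupt weight at small scales. -/
theorem exists_lintegral_rpow_neg_ball_le [SecondCountableTopology X] (hW : Measurable W)
    (hμ : ∀ x r, μ (ball x r) ≠ ⊤) (hν : ∀ x r, μ.withDensity W (ball x r) ≠ ⊤)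
    (hμ0 : ∀ x r, 0 < r → 0 < μ.real (ball x r))
    (hν0 : ∀ x r, 0 < r → 0 < (μ.withDensity W).real (ball x r))
    {α β : ℝ} {D : ℝ≥0} {R : ℝ} (hα : 0 < α) (hα1 : α ≤ 1) (hβ0 : 0 ≤ β) (hβ : β < 1) (hD : 1 ≤ D)
    (hdμ : ∀ (x : X) (r : ℝ), 0 < r → r ≤ 4 * R → μ (ball x (2 * r)) ≤ D * μ (ball x r))
    (hdν : ∀ (x : X) (r : ℝ), 0 < r → r ≤ 4 * R →
      μ.withDensity W (ball x (2 * r)) ≤ D * μ.withDensity W (ball x r))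
    (hS : ∀ (x : X) (r : ℝ), 0 < r → r ≤ R → ∀ F ⊆ ball x r, MeasurableSet F →
      (μ.withDensity W).real F ≤ α * (μ.withDensity W).real (ball x r) →
      μ.real F ≤ β * μ.real (ball x r))
    (hae : ∀ᵐ x ∂μ, ∀ a, W x < a →
      ∀ᶠ r in 𝓝[>] 0, μ.withDensity W (ball x r) ≤ a * μ (ball x r)) :
    ∃ η K : ℝ, 0 < η ∧ 0 < K ∧ ∀ (x : X) (r : ℝ), 0 < r → r ≤ R →
      ∫⁻ y in ball x r, W y ^ (-η) ∂μ ≤ ENNReal.ofReal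
        (K * μ.real (ball x r) * (μ.real (ball x r) / (μ.withDensity W).real (ball x r)) ^ η) := by
  set ν := μ.withDensity W with hνdef
  have hD0 : (0 : ℝ) < D := by exact_mod_cast one_pos.trans_le hD
  have hD1 : (1 : ℝ) ≤ D := by exact_mod_cast hD
  have hβ' : 0 < 1 - β := by linarith
  -- `L` is the ratio of the two levels `2t / (1 - β)` and `αt / (2D)` of the decay lemma, and `θ =
  -- K / (1 + K)` its decay factor. As `θ < 1`, a small `η` keeps `L ^ η * θ < 1`.
  set L : ℝ := 4 * D / ((1 - β) * α) with hL
  set K : ℝ := 4 * D ^ 4 / ((1 - β) * α) with hK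
  have hK0 : 0 < K := by positivity
  have hLD : (D : ℝ) ≤ L := by
    rw [hL, le_div_iff₀ (by positivity)]
    have : (1 - β) * α ≤ 1 := mul_le_one₀ (by linarith) hα.le hα1
    nlinarith
  have hL1 : 1 < L := by
    rw [hL, lt_div_iff₀ (by positivity)]
    have : (1 - β) * α ≤ 1 := mul_le_one₀ (by linarith) hα.le hα1
    linarith
  have hL0 : 0 < L := by linarith
  set θ : ℝ := K / (1 + K) with hθ
  have hθ0 : 0 ≤ θ := by positivity
  have hθ1 : θ < 1 := by rw [hθ, div_lt_one (by positivity)]; linarith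
  obtain ⟨η, hηq, hη⟩ : ∃ η : ℝ, L ^ η * θ < 1 ∧ 0 < η := by
    have hlim : Tendsto (fun η : ℝ => L ^ η * θ) (𝓝[>] 0) (𝓝 (L ^ (0 : ℝ) * θ)) :=
      ((Real.continuousAt_const_rpow hL0.ne').mul continuousAt_const).tendsto.mono_left
        nhdsWithin_le_nhds
    rw [Real.rpow_zero, one_mul] at hlim
    exact ((hlim.eventually_lt_const hθ1).and self_mem_nhdsWithin).exists
  have toReal_le : ∀ {m : Measure X} {A B : Set X} (n : ℕ), m B ≠ ⊤ → m A ≤ D ^ n * m B →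
      m.real A ≤ D ^ n * m.real B := by
    intro m A B n hB h
    rw [measureReal_def, measureReal_def, ← ENNReal.coe_toReal D, ← ENNReal.toReal_pow,
      ← ENNReal.toReal_mul]
    exact ENNReal.toReal_mono (ENNReal.mul_ne_top (by simp) hB) h
  -- Each step loses a collar of width `r / 2 ^ (k + 1)`, so the radii shrink from `2r` but remain
  -- above `r`.
  have hdecay : ∀ (x₀ : X) (r : ℝ), 0 < r → r ≤ R → ∀ k : ℕ,
      μ.real (ball x₀ (r + r * (1 / 2) ^ k) ∩
        {x | W x < ENNReal.ofReal (ν.real (ball x₀ r) / (D ^ 5 * μ.real (ball x₀ r)) / L ^ k)}) ≤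
      θ ^ k * (D * μ.real (ball x₀ r)) := by
    intro x₀ r hr hrR k
    set s := ν.real (ball x₀ r) / (D ^ 5 * μ.real (ball x₀ r)) with hs
    have hs0 : 0 < s := div_pos (hν0 _ _ hr) (mul_pos (by positivity) (hμ0 _ _ hr))
    induction k with
    | zero =>
      rw [pow_zero θ, one_mul]
      refine (measureReal_mono inter_subset_left (hμ _ _)).trans ?_
      have e : r + r * (1 / 2) ^ 0 = 2 ^ 1 * r := by ring
      have := toReal_le 1 (hμ _ _)
        (DoublingUpTo.measure_ball_two_pow_le hdμ x₀ hr 1 (by linarith))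
      rw [pow_one (D : ℝ)] at this
      rwa [e]
    | succ k ih =>
      have hpow : (1 / 2 : ℝ) ^ (k + 1) ≤ 1 / 2 := by
        rw [pow_succ]
        have := pow_le_one₀ (n := k) (by norm_num : (0 : ℝ) ≤ 1 / 2) (by norm_num)
        linarith
      have hρ0 : 0 < r * (1 / 2) ^ (k + 1) := by positivity
      have hρr : r * (1 / 2) ^ (k + 1) ≤ r / 2 := by
        calc r * (1 / 2) ^ (k + 1) ≤ r * (1 / 2) := by gcongr
          _ = r / 2 := by ring
      have step := measureReal_level_inter_ball_le hW hμ hν hν0 hα hα1 hβ0 hβ hD hdμ hdν hS hae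
        -- With this `t` the two levels are `s / L ^ k` and `s / L ^ (k + 1)`. Averages at radius
        -- `ρ` may drop by `D ^ (k + 5)`: the factor `D ^ 5` is built into `s`, and `D ^ k` is
        -- absorbed because `D ≤ L`.
        (x₀ := x₀) (a := r + r * (1 / 2) ^ (k + 1)) (ρ := r * (1 / 2) ^ (k + 1))
        (t := (1 - β) * (s / L ^ k) / 2) hρ0 (by linarith) (by positivity) (by
          intro x hx
          rw [mem_ball] at hx
          have h1 : ν.real (ball x₀ r) ≤ D ^ (k + 3) * ν.real (ball x (r * (1 / 2) ^ (k + 1))) := by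
            have e : 2 ^ (k + 3) * (r * (1 / 2) ^ (k + 1)) = 4 * r := by
              rw [pow_add, pow_succ, one_div, inv_pow]; field_simp; ring
            refine (measureReal_mono (ball_subset_ball' ?_) (hν x (4 * r))).trans ?_
            · rw [dist_comm]; linarith
            · rw [← e]
              exact toReal_le _ (hν _ _) (DoublingUpTo.measure_ball_two_pow_le hdν x hρ0 (k + 3)
                (by rw [e]; linarith))
          have h2 : μ.real (ball x (r * (1 / 2) ^ (k + 1))) ≤ D ^ 2 * μ.real (ball x₀ r) := by
            refine (measureReal_mono (ball_subset_ball' ?_) (hμ x₀ (2 ^ 2 * r))).trans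
              (toReal_le _ (hμ _ _) (DoublingUpTo.measure_ball_two_pow_le hdμ x₀ hr 2 (by linarith)))
            linarith
          have hμr := hμ0 x₀ r hr
          have hνr := hν0 x₀ r hr
          calc (1 - β) * (s / L ^ k) / 2 * μ.real (ball x (r * (1 / 2) ^ (k + 1)))
              ≤ (1 - β) * (s / L ^ k) / 2 * (D ^ 2 * μ.real (ball x₀ r)) := by gcongr
            _ = (1 - β) / 2 * (ν.real (ball x₀ r) / (D ^ 3 * L ^ k)) := by
              rw [hs]; field_simp
            _ < 1 * (ν.real (ball x₀ r) / (D ^ 3 * L ^ k)) := by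
              gcongr
              linarith
            _ ≤ 1 * (ν.real (ball x₀ r) / (D ^ 3 * D ^ k)) := by gcongr
            _ = ν.real (ball x₀ r) / D ^ (k + 3) := by rw [one_mul, ← pow_add, add_comm 3 k]
            _ ≤ _ := by
              rw [div_le_iff₀ (by positivity), mul_comm]
              exact h1)
      have e1 : α * ((1 - β) * (s / L ^ k) / 2) / (2 * D) = s / L ^ (k + 1) := by
        rw [pow_succ, hL]; field_simp; norm_num
      have e2 : 2 * ((1 - β) * (s / L ^ k) / 2) / (1 - β) = s / L ^ k := by field_simp
      have e3 : r + r * (1 / 2) ^ (k + 1) + r * (1 / 2) ^ (k + 1) = r + r * (1 / 2) ^ k := by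
        rw [pow_succ]; ring
      rw [e1, e2, e3] at step
      have : (1 + K) * μ.real (ball x₀ (r + r * (1 / 2) ^ (k + 1)) ∩
          {x | W x < ENNReal.ofReal (s / L ^ (k + 1))}) ≤ K * (θ ^ k * (D * μ.real (ball x₀ r))) :=
        step.trans (by gcongr)
      have h3 : θ ^ (k + 1) * (D * μ.real (ball x₀ r)) =
          K * (θ ^ k * (D * μ.real (ball x₀ r))) / (1 + K) := by
        rw [pow_succ, hθ]; ring
      rw [h3, le_div_iff₀ (by positivity), mul_comm]
      exact this
  have hq : 0 < 1 - L ^ η * θ := by linarith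
  refine ⟨η, (D ^ 5 : ℝ) ^ η * (1 + L ^ η * D * (1 - L ^ η * θ)⁻¹), hη, by positivity,
    fun x r hr hrR => ?_⟩
  have hμr := hμ0 x r hr
  have hνr := hν0 x r hr
  have hs0 : 0 < ν.real (ball x r) / (D ^ 5 * μ.real (ball x r)) := by positivity
  refine (lintegral_rpow_neg_le hW (hμ x r) hs0 hL1 hη hθ0
    (M := D * μ.real (ball x r)) (by positivity) hηq fun k => ?_).trans_eq ?_
  · refine (measureReal_mono ?_ ?_).trans (hdecay x r hr hrR k)
    · exact inter_subset_inter_left _ (ball_subset_ball (by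
        have : 0 < r * (1 / 2) ^ k := by positivity
        linarith))
    · exact measure_ne_top_of_subset inter_subset_left (hμ x (r + r * (1 / 2) ^ k))
  · congr 1
    rw [Real.rpow_neg hs0.le, ← Real.inv_rpow hs0.le, inv_div, mul_div_assoc,
      Real.mul_rpow (by positivity) (by positivity)]
    ring

end NegativePowers

/-! ### Relations between the conditions (1)–(4). -/

section MuckenhouptConditions

open Set Filter Metric
open scoped Topology

section Ball

variable {X : Type*} [MeasurableSpace X] {μ : Measure X} {W : X → ℝ≥0∞} {B : Set X}

/-- Integrating `1 ≤ sW + (sW) ^ (-η)` over `F` and optimising in `s` replaces Hölder's inequality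
and avoids separate treatment of points where `W` is `0` or infinite. -/
theorem mul_rpow_measureReal_le {η K : ℝ} (hη : 0 < η) (hK : 0 < K) (hμ : 0 < μ.real B)
    (hν : 0 < (μ.withDensity W).real B) (h : ∫⁻ y in B, W y ^ (-η) ∂μ ≤ ENNReal.ofReal
      (K * μ.real B * (μ.real B / (μ.withDensity W).real B) ^ η)) (hW : Measurable W)
    {F : Set X} (hF : MeasurableSet F) (hFB : F ⊆ B) :
    1 / 2 * (2 * K)⁻¹ ^ (1 / η) * (μ.real F / μ.real B) ^ (1 + 1 / η) ≤
      (μ.withDensity W).real F / (μ.withDensity W).real B := by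
  set ν := μ.withDensity W with hνdef
  have hμB : μ B ≠ ⊤ := fun h => by simp [measureReal_def, h] at hμ
  have hνB : ν B ≠ ⊤ := fun h => by simp [measureReal_def, h] at hν
  have hμF : μ F ≠ ⊤ := measure_ne_top_of_subset hFB hμB
  have hνF : ν F ≠ ⊤ := measure_ne_top_of_subset hFB hνB
  rcases (measureReal_nonneg : 0 ≤ μ.real F).eq_or_lt with h0 | hF0
  · rw [← h0, zero_div, Real.zero_rpow (by positivity), mul_zero]
    positivity
  have hpt : ∀ s : ℝ, 0 < s → ∀ a : ℝ≥0∞,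
      1 ≤ ENNReal.ofReal s * a + ENNReal.ofReal (s ^ (-η)) * a ^ (-η) := by
    intro s hs a
    have hs' : ENNReal.ofReal s ≠ 0 := by simpa using hs
    rcases le_total (ENNReal.ofReal s)⁻¹ a with ha | ha
    · refine le_trans ?_ le_self_add
      calc (1 : ℝ≥0∞) = ENNReal.ofReal s * (ENNReal.ofReal s)⁻¹ :=
            (ENNReal.mul_inv_cancel hs' (by simp)).symm
        _ ≤ _ := by gcongr
    · refine le_trans ?_ le_add_self
      have h1 : (ENNReal.ofReal s) ^ η ≤ a ^ (-η) := by
        rw [ENNReal.rpow_neg, ← ENNReal.inv_rpow]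
        exact ENNReal.rpow_le_rpow (ENNReal.le_inv_iff_le_inv.1 ha) hη.le
      calc (1 : ℝ≥0∞) = ENNReal.ofReal (s ^ (-η)) * (ENNReal.ofReal s) ^ η := by
            rw [ENNReal.ofReal_rpow_of_pos hs, ← ENNReal.ofReal_mul (by positivity),
              ← Real.rpow_add hs]
            simp
        _ ≤ _ := by gcongr
  have hreal : ∀ s : ℝ, 0 < s → μ.real F ≤
      s * ν.real F + s ^ (-η) * (K * μ.real B * (μ.real B / ν.real B) ^ η) := by
    intro s hs
    have : μ F ≤ ENNReal.ofReal s * ν F +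
        ENNReal.ofReal (s ^ (-η)) * ENNReal.ofReal (K * μ.real B * (μ.real B / ν.real B) ^ η) := by
      calc μ F = ∫⁻ _ in F, 1 ∂μ := by simp
        _ ≤ ∫⁻ y in F, (ENNReal.ofReal s * W y + ENNReal.ofReal (s ^ (-η)) * W y ^ (-η)) ∂μ :=
          lintegral_mono fun y => hpt s hs (W y)
        _ = ENNReal.ofReal s * ν F + ENNReal.ofReal (s ^ (-η)) * ∫⁻ y in F, W y ^ (-η) ∂μ := by
          rw [lintegral_add_left (hW.const_mul _), lintegral_const_mul _ hW,
            lintegral_const_mul _ (hW.pow_const _), hνdef, withDensity_apply _ hF]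
        _ ≤ _ := by
          gcongr
          exact (lintegral_mono_set hFB).trans h
    have := ENNReal.toReal_mono (by finiteness) this
    rwa [ENNReal.toReal_add (by finiteness) (by finiteness), ENNReal.toReal_mul, ENNReal.toReal_mul,
      ENNReal.toReal_ofReal hs.le, ENNReal.toReal_ofReal (by positivity),
      ENNReal.toReal_ofReal (by positivity)] at this
  set f := μ.real F / μ.real B with hf
  set g := ν.real F / ν.real B with hg
  have hf0 : 0 < f := by positivity
  -- With `s = σ μ(B) / ν(B)` the negative-power term is exactly half of `μ(F)`.
  set σ := (2 * K / f) ^ (1 / η) with hσ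
  have hσ0 : 0 < σ := by positivity
  have h1 := hreal (σ * (μ.real B / ν.real B)) (by positivity)
  have h2 : σ ^ (-η) = f / (2 * K) := by
    rw [hσ, ← Real.rpow_mul (by positivity), one_div, inv_mul_eq_div, neg_div, div_self hη.ne',
      Real.rpow_neg_one, inv_div]
  have h3 : f ≤ σ * g + f / 2 := by
    rw [hf, div_le_iff₀ hμ]
    refine h1.trans_eq ?_
    rw [Real.mul_rpow hσ0.le (by positivity), h2,
      Real.rpow_neg (x := μ.real B / ν.real B) (by positivity), hg, hf]
    field_simp
  have h4 : f / 2 ≤ σ * g := by linarith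
  have h5 : 1 / 2 * (2 * K)⁻¹ ^ (1 / η) * f ^ (1 + 1 / η) = f / 2 / σ := by
    rw [hσ, Real.rpow_add hf0, Real.rpow_one, Real.div_rpow (by positivity) hf0.le,
      Real.inv_rpow (by positivity)]
    field_simp
  rw [h5, div_le_iff₀ hσ0, mul_comm]
  exact h4

end Ball

variable {X : Type*} [MetricSpace X] [MeasurableSpace X] [BorelSpace X] {μ : Measure X}
  {w : X → ℝ}

/-- If `F` has at most half the measure of the ball, (2) applied to the complement of `F` gives that
complement a fixed share of the weight. The minimum with `1/2` in `κ` only ensures `κ < 1`. -/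
theorem MuckenhouptCond2.cond1 (hν : ∀ x r, weightMeasure μ w (ball x r) ≠ ⊤)
    (hμ : ∀ x r, μ (ball x r) ≠ ⊤) {R : ℝ} (hμ0 : ∀ x r, 0 < r → μ (ball x r) ≠ 0)
    (h : MuckenhouptCond2 ball μ w R) : MuckenhouptCond1 ball μ w R := by
  obtain ⟨hpos, p, C, hp, hC, h⟩ := h
  set κ : ℝ≥0 := min (1 / 2) (C * (1 / 2) ^ p) with hκ
  have hκ0 : 0 < κ := lt_min (by norm_num) (mul_pos hC (NNReal.rpow_pos (by norm_num)))
  have hκ1 : κ < 1 := (min_le_left _ _).trans_lt (by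
    rw [div_lt_one] <;> norm_num)
  refine ⟨1 / 2, 1 - κ, by norm_num, by rw [div_lt_one] <;> norm_num, tsub_pos_of_lt hκ1,
    tsub_lt_self one_pos hκ0, fun x r hr hrR F hF hFB hle => ?_⟩
  have hν0 := (hpos x r hr hrR).ne'
  have hdiff := h x r hr hrR (ball x r \ F) (measurableSet_ball.diff hF) sdiff_subset
  have h1 : (1 / 2 : ℝ≥0∞) ≤ μ (ball x r \ F) / μ (ball x r) := by
    rw [ENNReal.le_div_iff_mul_le (Or.inl (hμ0 x r hr)) (Or.inl (hμ x r)),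
      measure_sdiff hFB hF.nullMeasurableSet (measure_ne_top_of_subset hFB (hμ x r))]
    refine ENNReal.le_sub_of_add_le_right (measure_ne_top_of_subset hFB (hμ x r)) ?_
    calc 1 / 2 * μ (ball x r) + μ F ≤ 1 / 2 * μ (ball x r) + 1 / 2 * μ (ball x r) := by
          gcongr
          refine hle.trans_eq ?_
          norm_num
      _ = μ (ball x r) := by rw [← add_mul, ENNReal.add_halves, one_mul]
  have h2 : (κ : ℝ≥0∞) ≤
      weightMeasure μ w (ball x r \ F) / weightMeasure μ w (ball x r) := by
    refine le_trans ?_ hdiff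
    calc (κ : ℝ≥0∞) ≤ ((C * (1 / 2) ^ p : ℝ≥0) : ℝ≥0∞) := by exact_mod_cast min_le_right _ _
      _ = C * (1 / 2 : ℝ≥0∞) ^ p := by
        rw [ENNReal.coe_mul, ENNReal.coe_rpow_of_nonneg _ (by linarith)]
        norm_num
      _ ≤ _ := by gcongr
  rw [ENNReal.le_div_iff_mul_le (Or.inl hν0) (Or.inl (hν x r))] at h2
  have hκfin : (κ : ℝ≥0∞) * weightMeasure μ w (ball x r) ≠ ⊤ := ENNReal.mul_ne_top (by simp) (hν x r)
  rw [ENNReal.coe_sub, ENNReal.coe_one, ENNReal.sub_mul fun _ _ => hν x r, one_mul]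
  refine ENNReal.le_sub_of_add_le_right hκfin ?_
  have hadd := measure_inter_add_sdiff (μ := weightMeasure μ w) (ball x r) hF
  rw [inter_eq_right.2 hFB] at hadd
  calc weightMeasure μ w F + κ * weightMeasure μ w (ball x r)
      ≤ weightMeasure μ w F + weightMeasure μ w (ball x r \ F) := by gcongr
    _ = _ := hadd

omit [MetricSpace X] [BorelSpace X] in
theorem weightMeasure_eq_withDensity {W : X → ℝ≥0∞} (h : (fun x => ENNReal.ofReal (w x)) =ᵐ[μ] W) :
    weightMeasure μ w = μ.withDensity W := withDensity_congr_ae h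

theorem setLAverage_ofReal_eq (x : X) (r : ℝ) :
    ⨍⁻ z in ball x r, ENNReal.ofReal (w z) ∂μ = weightMeasure μ w (ball x r) / μ (ball x r) := by
  rw [setLAverage_eq, weightMeasure, withDensity_apply _ measurableSet_ball]

/-- The set where the density is below `C (1/2) ^ p` times its average has weight at most that
fraction of the ball, so by (2) it occupies at most half of it. -/
theorem MuckenhouptCond2.cond4 {W : X → ℝ≥0∞} (hW : Measurable W)
    (hwW : (fun x => ENNReal.ofReal (w x)) =ᵐ[μ] W)
    (hν : ∀ x r, weightMeasure μ w (ball x r) ≠ ⊤)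
    (hμ : ∀ x r, μ (ball x r) ≠ ⊤) {R : ℝ} (hμ0 : ∀ x r, 0 < r → μ (ball x r) ≠ 0)
    (h : MuckenhouptCond2 ball μ w R) : MuckenhouptCond4 ball μ w R := by
  obtain ⟨hpos, p, C, hp, hC, h⟩ := h
  refine ⟨C * (1 / 2) ^ p, 1 / 2, mul_pos hC (NNReal.rpow_pos (by norm_num)), by norm_num,
    fun x r hr hrR => ?_⟩
  have hν0 := (hpos x r hr hrR).ne'
  rw [setLAverage_ofReal_eq]
  set ν := weightMeasure μ w with hνdef
  set c : ℝ≥0∞ := ((C * (1 / 2) ^ p : ℝ≥0) : ℝ≥0∞) * (ν (ball x r) / μ (ball x r)) with hc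
  set F := ball x r ∩ {y | W y < c} with hF
  have hFm : MeasurableSet F := measurableSet_ball.inter (measurableSet_lt hW measurable_const)
  have hFB : F ⊆ ball x r := inter_subset_left
  have hFfin : μ F ≠ ⊤ := measure_ne_top_of_subset hFB (hμ x r)
  have h1 : ν F ≤ ((C * (1 / 2) ^ p : ℝ≥0) : ℝ≥0∞) * ν (ball x r) := by
    calc ν F = ∫⁻ y in F, W y ∂μ := by
          rw [hνdef, weightMeasure_eq_withDensity hwW, withDensity_apply _ hFm]
      _ ≤ ∫⁻ _ in F, c ∂μ := setLIntegral_mono' hFm fun y hy => (hy.2 : W y < c).le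
      _ = c * μ F := setLIntegral_const _ _
      _ ≤ c * μ (ball x r) := by gcongr
      _ = _ := by rw [hc, mul_assoc, ENNReal.div_mul_cancel (hμ0 x r hr) (hμ x r)]
  have h2 := (h x r hr hrR F hFm hFB).trans
    ((ENNReal.div_le_iff_le_mul (Or.inl hν0) (Or.inl (hν x r))).2 h1)
  rw [ENNReal.coe_mul, ENNReal.mul_le_mul_iff_right (by simpa using hC.ne') (by simp),
    ENNReal.coe_rpow_of_nonneg _ (by linarith), ENNReal.rpow_le_rpow_iff (by linarith),
    ENNReal.div_le_iff_le_mul (Or.inl (hμ0 x r hr)) (Or.inl (hμ x r))] at h2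
  have h3 : ((1 / 2 : ℝ≥0) : ℝ≥0∞) * μ (ball x r) ≤ μ (ball x r \ F) := by
    rw [measure_sdiff hFB hFm.nullMeasurableSet hFfin]
    refine ENNReal.le_sub_of_add_le_right hFfin ?_
    calc ((1 / 2 : ℝ≥0) : ℝ≥0∞) * μ (ball x r) + μ F
        ≤ ((1 / 2 : ℝ≥0) : ℝ≥0∞) * μ (ball x r) + ((1 / 2 : ℝ≥0) : ℝ≥0∞) * μ (ball x r) := by gcongr
      _ = μ (ball x r) := by
        rw [← add_mul, ← ENNReal.coe_add, add_halves, ENNReal.coe_one, one_mul]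
  refine h3.trans (measure_mono_ae ?_)
  filter_upwards [hwW] with y hy hyF
  refine ⟨hyF.1, ?_⟩
  rw [hy]
  exact not_lt.1 fun hlt => hyF.2 ⟨hyF.1, hlt⟩

/-- On the large-density set `A` of (4), small weight forces small measure; off `A` there is at most
the fraction `1 - c` of the ball. The total is `1 - c / 2`. -/
theorem MuckenhouptCond4.exists_measureReal_le {W : X → ℝ≥0∞} (hW : Measurable W)
    (hwW : (fun x => ENNReal.ofReal (w x)) =ᵐ[μ] W)
    (hν : ∀ x r, μ.withDensity W (ball x r) ≠ ⊤) (hμ : ∀ x r, μ (ball x r) ≠ ⊤) {R : ℝ}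
    (hν0 : ∀ x r, 0 < r → 0 < (μ.withDensity W).real (ball x r))
    (hμ0 : ∀ x r, 0 < r → 0 < μ.real (ball x r)) (h : MuckenhouptCond4 ball μ w R) :
    ∃ α β : ℝ, 0 < α ∧ α ≤ 1 ∧ 0 ≤ β ∧ β < 1 ∧ ∀ (x : X) (r : ℝ), 0 < r → r ≤ R →
      ∀ F ⊆ ball x r, MeasurableSet F →
      (μ.withDensity W).real F ≤ α * (μ.withDensity W).real (ball x r) →
      μ.real F ≤ β * μ.real (ball x r) := by
  obtain ⟨δ, c, hδ, hc, h⟩ := h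
  have hδ' : (0 : ℝ) < δ := hδ
  have hc' : (0 : ℝ) < c := hc
  refine ⟨min 1 (δ * c / 2), max 0 (1 - c / 2), lt_min one_pos (by positivity), min_le_left _ _,
    le_max_left _ _, max_lt one_pos (by linarith), fun x r hr hrR F hFB hF hle => ?_⟩
  have hx := h x r hr hrR
  rw [setLAverage_ofReal_eq, weightMeasure_eq_withDensity hwW] at hx
  set ν := μ.withDensity W with hνdef
  have hμr := hμ0 x r hr
  have hνr := hν0 x r hr
  set a : ℝ := δ * (ν.real (ball x r) / μ.real (ball x r)) with ha
  have ha0 : 0 < a := by positivity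
  have hae : (δ : ℝ≥0∞) * (ν (ball x r) / μ (ball x r)) = ENNReal.ofReal a := by
    rw [ha, ENNReal.ofReal_mul hδ'.le, ENNReal.ofReal_div_of_pos hμr, ENNReal.ofReal_coe_nnreal,
      measureReal_def, measureReal_def, ENNReal.ofReal_toReal (hν _ _), ENNReal.ofReal_toReal (hμ _ _)]
  rw [hae] at hx
  set A := ball x r ∩ {y | ENNReal.ofReal a ≤ W y} with hA
  have hAm : MeasurableSet A := measurableSet_ball.inter (measurableSet_le measurable_const hW)
  have hcA : c * μ.real (ball x r) ≤ μ.real A := by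
    have : (c : ℝ≥0∞) * μ (ball x r) ≤ μ A := by
      refine hx.trans (measure_mono_ae ?_)
      filter_upwards [hwW] with y hy hyF
      refine ⟨hyF.1, ?_⟩
      have := hyF.2
      rwa [hy] at this
    have := ENNReal.toReal_mono (measure_ne_top_of_subset inter_subset_left (hμ x r)) this
    rwa [ENNReal.toReal_mul] at this
  have h1 : a * μ.real (F ∩ A) ≤ ν.real (F ∩ A) :=
    mul_measureReal_le_withDensity ha0.le (hF.inter hAm)
      (measure_ne_top_of_subset (inter_subset_left.trans hFB) (hν x r)) fun y hy => hy.2.2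
  have h2 : ν.real (F ∩ A) ≤ δ * c / 2 * ν.real (ball x r) :=
    (measureReal_mono inter_subset_left (measure_ne_top_of_subset hFB (hν x r))).trans
      (hle.trans (by gcongr; exact min_le_right _ _))
  have h3 : μ.real (F ∩ A) ≤ c / 2 * μ.real (ball x r) := by
    refine le_of_mul_le_mul_left ((h1.trans h2).trans_eq ?_) ha0
    rw [ha]; field_simp
  have h4 : μ.real (F \ A) ≤ μ.real (ball x r \ A) :=
    measureReal_mono (sdiff_subset_sdiff_left hFB) (measure_ne_top_of_subset sdiff_subset (hμ x r))
  have h5 : μ.real (ball x r \ A) = μ.real (ball x r) - μ.real A :=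
    measureReal_sdiff inter_subset_left hAm (hμ x r)
  have h6 : μ.real (F ∩ A) + μ.real (F \ A) = μ.real F :=
    measureReal_inter_add_sdiff hAm (measure_ne_top_of_subset hFB (hμ x r))
  have h7 : (1 - c / 2) * μ.real (ball x r) ≤ max 0 (1 - c / 2 : ℝ) * μ.real (ball x r) := by
    gcongr; exact le_max_right _ _
  linarith

/-- A bound for the averages of a negative power of the density gives the Muckenhoupt condition. -/
theorem muckenhouptCond3_of_lintegral_rpow_neg_le {W : X → ℝ≥0∞}
    (hwW : (fun x => ENNReal.ofReal (w x)) =ᵐ[μ] W) {η K R : ℝ} (hη : 0 < η) (hK : 0 < K)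
    (hμ0 : ∀ x r, 0 < r → 0 < μ.real (ball x r))
    (hν0 : ∀ x r, 0 < r → 0 < (μ.withDensity W).real (ball x r))
    (h : ∀ (x : X) (r : ℝ), 0 < r → r ≤ R → ∫⁻ y in ball x r, W y ^ (-η) ∂μ ≤ ENNReal.ofReal
      (K * μ.real (ball x r) * (μ.real (ball x r) / (μ.withDensity W).real (ball x r)) ^ η)) :
    MuckenhouptCond3 ball μ w R := by
  -- The exponent `p = 1 + 1 / η` is the one for which `p' / p = η`.
  have hp : (1 : ℝ) < 1 + 1 / η := by
    have : 0 < 1 / η := by positivity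
    linarith
  have e1 : Real.conjExponent (1 + 1 / η) / (1 + 1 / η) = η := by
    rw [Real.conjExponent]; field_simp; ring
  have e2 : (1 + 1 / η) / Real.conjExponent (1 + 1 / η) = 1 / η := by
    rw [← inv_div, e1, one_div]
  refine ⟨1 + 1 / η, Real.toNNReal (K ^ (1 / η)), hp, Real.toNNReal_pos.2 (by positivity),
    fun x r hr hrR => ?_⟩
  rw [e1, e2, setLAverage_ofReal_eq, weightMeasure_eq_withDensity hwW, setLAverage_eq]
  have hcongr : ∫⁻ y in ball x r, ENNReal.ofReal (w y) ^ (-η) ∂μ = ∫⁻ y in ball x r, W y ^ (-η) ∂μ :=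
    lintegral_congr_ae (ae_restrict_of_ae (by filter_upwards [hwW] with y hy; rw [hy]))
  rw [hcongr]
  set ν := μ.withDensity W with hνdef
  have hμr := hμ0 x r hr
  have hνr := hν0 x r hr
  have hμf : μ (ball x r) = ENNReal.ofReal (μ.real (ball x r)) :=
    (ENNReal.ofReal_toReal fun h => by simp [measureReal_def, h] at hμr).symm
  have hνf : ν (ball x r) = ENNReal.ofReal (ν.real (ball x r)) :=
    (ENNReal.ofReal_toReal fun h => by simp [measureReal_def, h] at hνr).symm
  rw [hμf, hνf, ← ENNReal.ofReal_div_of_pos hμr]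
  calc ENNReal.ofReal (ν.real (ball x r) / μ.real (ball x r)) *
        ((∫⁻ y in ball x r, W y ^ (-η) ∂μ) / ENNReal.ofReal (μ.real (ball x r))) ^ (1 / η)
      ≤ ENNReal.ofReal (ν.real (ball x r) / μ.real (ball x r)) *
        (ENNReal.ofReal (K * μ.real (ball x r) * (μ.real (ball x r) / ν.real (ball x r)) ^ η) /
          ENNReal.ofReal (μ.real (ball x r))) ^ (1 / η) := by
        gcongr
        exact h x r hr hrR
    _ = ENNReal.ofReal (K ^ (1 / η)) := by
        rw [← ENNReal.ofReal_div_of_pos hμr, ENNReal.ofReal_rpow_of_pos (by positivity),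
          ← ENNReal.ofReal_mul (by positivity)]
        congr 1
        have : K * μ.real (ball x r) * (μ.real (ball x r) / ν.real (ball x r)) ^ η /
            μ.real (ball x r) = K * (μ.real (ball x r) / ν.real (ball x r)) ^ η := by
          field_simp
        rw [this, Real.mul_rpow hK.le (by positivity), ← Real.rpow_mul (by positivity),
          mul_one_div_cancel hη.ne', Real.rpow_one]
        field_simp
    _ = _ := rfl

omit [BorelSpace X] in
theorem muckenhouptCond2_of_lintegral_rpow_neg_le {W : X → ℝ≥0∞} (hW : Measurable W)
    (hwW : (fun x => ENNReal.ofReal (w x)) =ᵐ[μ] W) {η K R : ℝ} (hη : 0 < η) (hK : 0 < K)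
    (hμ0 : ∀ x r, 0 < r → 0 < μ.real (ball x r))
    (hν0 : ∀ x r, 0 < r → 0 < (μ.withDensity W).real (ball x r))
    (h : ∀ (x : X) (r : ℝ), 0 < r → r ≤ R → ∫⁻ y in ball x r, W y ^ (-η) ∂μ ≤ ENNReal.ofReal
      (K * μ.real (ball x r) * (μ.real (ball x r) / (μ.withDensity W).real (ball x r)) ^ η)) :
    MuckenhouptCond2 ball μ w R := by
  refine ⟨fun x r hr _ => ?_, 1 + 1 / η, Real.toNNReal (1 / 2 * (2 * K)⁻¹ ^ (1 / η)), ?_,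
    Real.toNNReal_pos.2 (by positivity), fun x r hr hrR F hF hFB => ?_⟩
  · rw [weightMeasure_eq_withDensity hwW]
    exact (ENNReal.toReal_pos_iff.1 (hν0 x r hr)).1
  · have : 0 < 1 / η := by positivity
    linarith
  have hμr := hμ0 x r hr
  have hνr := hν0 x r hr
  have key := mul_rpow_measureReal_le hη hK hμr hνr (h x r hr hrR) hW hF hFB
  rw [weightMeasure_eq_withDensity hwW]
  set ν := μ.withDensity W with hνdef
  have hμB : μ (ball x r) ≠ ⊤ := fun h => by simp [measureReal_def, h] at hμr
  have hνB : ν (ball x r) ≠ ⊤ := fun h => by simp [measureReal_def, h] at hνr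
  have hf : μ F / μ (ball x r) = ENNReal.ofReal (μ.real F / μ.real (ball x r)) := by
    rw [ENNReal.ofReal_div_of_pos hμr, measureReal_def, measureReal_def,
      ENNReal.ofReal_toReal (measure_ne_top_of_subset hFB hμB), ENNReal.ofReal_toReal hμB]
  have hg : ν F / ν (ball x r) = ENNReal.ofReal (ν.real F / ν.real (ball x r)) := by
    rw [ENNReal.ofReal_div_of_pos hνr, measureReal_def, measureReal_def,
      ENNReal.ofReal_toReal (measure_ne_top_of_subset hFB hνB), ENNReal.ofReal_toReal hνB]
  rw [hf, hg, ENNReal.ofReal_rpow_of_nonneg (by positivity) (by positivity)]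
  refine le_trans (le_of_eq ?_) (ENNReal.ofReal_le_ofReal key)
  rw [ENNReal.ofReal_mul (by positivity)]
  rfl

end MuckenhouptConditions

/-! ### All scales, on connected groups with a proper left-invariant metric. -/

section InvariantWeights

open Set Filter Metric
open scoped Topology

variable {X : Type*} [MetricSpace X] [MeasurableSpace X] [BorelSpace X] [Group X]
  [IsIsometricSMul X X] [ProperSpace X] [ConnectedSpace X] {μ : Measure X} {W : X → ℝ≥0∞}

omit [BorelSpace X] in
/-- The Muckenhoupt bound at small scales implies the one at all scales. -/
theorem exists_lintegral_rpow_neg_ball_le_of_le [ContinuousMul X]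
    (hμV : ∀ x r, μ.real (ball x r) = μ.real (ball 1 r))
    (hμ : ∀ x r, μ (ball x r) ≠ ⊤) (hν : ∀ x r, μ.withDensity W (ball x r) ≠ ⊤)
    (hν0 : ∀ x r, 0 < r → 0 < (μ.withDensity W).real (ball x r))
    (hd : LocallyDoubling ball (μ.withDensity W)) {η K s : ℝ} (hs : 0 < s) (hη : 0 < η) (hK : 0 < K)
    (h : ∀ (x : X) (r : ℝ), 0 < r → r ≤ s → ∫⁻ y in ball x r, W y ^ (-η) ∂μ ≤ ENNReal.ofReal
      (K * μ.real (ball x r) * (μ.real (ball x r) / (μ.withDensity W).real (ball x r)) ^ η))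
    (R : ℝ) : ∃ K' : ℝ, 0 < K' ∧
    ∀ (x : X) (r : ℝ), 0 < r → r ≤ R → ∫⁻ y in ball x r, W y ^ (-η) ∂μ ≤ ENNReal.ofReal
      (K' * μ.real (ball x r) * (μ.real (ball x r) / (μ.withDensity W).real (ball x r)) ^ η) := by
  set ν := μ.withDensity W with hνdef
  obtain ⟨F, hF, hcov⟩ := exists_finset_ball_subset_iUnion (X := X) hs R
  obtain ⟨C, -, hC⟩ := hd s hs
  obtain ⟨M, hM⟩ := exists_measure_ball_le_mul hs (fun x => hC x s hs le_rfl) (2 * R)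
  have hKM : 0 ≤ F.card * (K * (M : ℝ) ^ η) := by positivity
  refine ⟨K + F.card * (K * (M : ℝ) ^ η), by positivity, fun x r hr hrR => ?_⟩
  rcases le_total r s with hrs | hrs
  · refine (h x r hr hrs).trans (ENNReal.ofReal_le_ofReal ?_)
    have := hν0 x r hr
    gcongr
    linarith
  · have hνr := hν0 x r hr
    -- For `s ≤ r ≤ R` the ball is covered by a fixed number of balls of radius `s`. Invariance of
    -- `μ` and comparability of `ν`-balls put the large ball in place of the small one in the bound.
    have hterm : ∀ y ∈ F, ∫⁻ z in ball (x * y) s, W z ^ (-η) ∂μ ≤ ENNReal.ofReal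
        (K * (M : ℝ) ^ η * (μ.real (ball x r) * (μ.real (ball x r) / ν.real (ball x r)) ^ η)) := by
      intro y hy
      refine (h _ s hs le_rfl).trans (ENNReal.ofReal_le_ofReal ?_)
      have h1 : μ.real (ball (x * y) s) ≤ μ.real (ball x r) := by
        rw [hμV, hμV x]
        exact measureReal_mono (ball_subset_ball hrs) (hμ _ _)
      have hd' : dist (x * y) x ≤ R := by
        have := dist_mul_left x y 1
        rw [mul_one] at this
        rw [this]; exact hF y hy
      have h2 : ν.real (ball x r) ≤ M * ν.real (ball (x * y) s) := by
        have : ν (ball x r) ≤ M * ν (ball (x * y) s) :=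
          (measure_mono (ball_subset_ball' (by rw [dist_comm]; linarith))).trans (hM _)
        rw [measureReal_def, measureReal_def, ← ENNReal.coe_toReal, ← ENNReal.toReal_mul]
        exact ENNReal.toReal_mono (ENNReal.mul_ne_top (by simp) (hν _ _)) this
      have hνy := hν0 (x * y) s hs
      have h3 : μ.real (ball (x * y) s) / ν.real (ball (x * y) s) ≤
          M * (μ.real (ball x r) / ν.real (ball x r)) := by
        rw [div_le_iff₀ hνy]
        calc μ.real (ball (x * y) s) ≤ μ.real (ball x r) * 1 := by rwa [mul_one]
          _ ≤ μ.real (ball x r) * (M * ν.real (ball (x * y) s) / ν.real (ball x r)) := by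
              gcongr
              rwa [le_div_iff₀ hνr, one_mul]
          _ = _ := by ring
      calc K * μ.real (ball (x * y) s) *
            (μ.real (ball (x * y) s) / ν.real (ball (x * y) s)) ^ η
          ≤ K * μ.real (ball x r) * (M * (μ.real (ball x r) / ν.real (ball x r))) ^ η := by gcongr
        _ = _ := by
          rw [Real.mul_rpow (by positivity) (by positivity)]; ring
    calc ∫⁻ y in ball x r, W y ^ (-η) ∂μ
        ≤ ∫⁻ z in ⋃ y ∈ F, ball (x * y) s, W z ^ (-η) ∂μ :=
          lintegral_mono_set ((ball_subset_ball hrR).trans (hcov x))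
      _ ≤ ∑ y ∈ F, ∫⁻ z in ball (x * y) s, W z ^ (-η) ∂μ := by
          classical
          clear hF hcov hKM hterm
          induction F using Finset.induction_on with
          | empty => simp
          | insert a F ha ih =>
            rw [Finset.sum_insert ha, Finset.set_biUnion_insert]
            exact (lintegral_union_le _ _ _).trans (by gcongr)
      _ ≤ ∑ y ∈ F, _ := Finset.sum_le_sum hterm
      _ ≤ _ := by
          rw [Finset.sum_const, nsmul_eq_mul, ← ENNReal.ofReal_natCast,
            ← ENNReal.ofReal_mul (by positivity)]
          refine ENNReal.ofReal_le_ofReal ?_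
          have : 0 ≤ K * (μ.real (ball x r) * (μ.real (ball x r) / ν.real (ball x r)) ^ η) := by
            positivity
          linarith

/-- Equivalence of the Muckenhoupt conditions at all scales, on a connected group with a proper
left-invariant distance. -/
theorem AInftyLocTilde.locallyDoubling_and_muckenhoupt [IsTopologicalGroup X] [μ.IsHaarMeasure]
    {w : X → ℝ} (hw : AInftyLocTilde ball μ w) :
    LocallyDoubling ball (weightMeasure μ w) ∧
      ∀ R : ℝ, 0 < R →
        MuckenhouptCond1 ball μ w R ∧ MuckenhouptCond2 ball μ w R ∧
        MuckenhouptCond3 ball μ w R ∧ MuckenhouptCond4 ball μ w R := by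
  have hwm : AEMeasurable w μ := hw.locallyIntegrable.aestronglyMeasurable.aemeasurable
  -- The weight is only almost everywhere measurable; a Borel version gives measurable level sets
  -- and the same measure.
  set W : X → ℝ≥0∞ := fun x => ENNReal.ofReal (hwm.mk w x) with hWdef
  have hW : Measurable W := hwm.measurable_mk.ennreal_ofReal
  have hwW : (fun x => ENNReal.ofReal (w x)) =ᵐ[μ] W := by
    filter_upwards [hwm.ae_eq_mk] with x hx
    exact congrArg ENNReal.ofReal hx
  have hνW := weightMeasure_eq_withDensity hwW
  obtain ⟨R₁, hR₁, hdν⟩ := hw.doubling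
  obtain ⟨R₄, hR₄, h4⟩ := hw.cond4
  rw [hνW] at hdν
  set ν := μ.withDensity W with hνdef
  have hμ : ∀ x r, μ (ball x r) ≠ ⊤ := fun x r => measure_ball_lt_top.ne
  have hν : ∀ x r, ν (ball x r) ≠ ⊤ := by
    intro x r
    have hint : IntegrableOn w (closedBall x r) μ :=
      hw.locallyIntegrable.integrableOn_isCompact (isCompact_closedBall x r)
    have := (hint.mono_set ball_subset_closedBall).lintegral_lt_top
    rw [hνdef, withDensity_apply _ measurableSet_ball, ← lintegral_congr_ae (ae_restrict_of_ae hwW)]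
    exact this.ne
  have hνne : ν ≠ 0 := by
    intro h0
    apply hw.ne_zero
    rw [hνdef, withDensity_eq_zero_iff hW.aemeasurable] at h0
    filter_upwards [h0, hwW, hw.nonneg] with x h1 h2 h3
    rw [← h2] at h1
    exact le_antisymm (ENNReal.ofReal_eq_zero.1 h1) h3
  have hνpos : ∀ x r, 0 < r → 0 < ν (ball x r) := fun x r hr => hdν.measure_ball_pos hR₁ hνne x hr
  have hν0 : ∀ x r, 0 < r → 0 < ν.real (ball x r) := fun x r hr =>
    ENNReal.toReal_pos (hνpos x r hr).ne' (hν x r)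
  have hμpos : ∀ x r, 0 < r → μ (ball x r) ≠ 0 := fun x r hr => (measure_ball_pos μ x hr).ne'
  have hμ0 : ∀ x r, 0 < r → 0 < μ.real (ball x r) := fun x r hr =>
    ENNReal.toReal_pos (hμpos x r hr) (hμ x r)
  have hV : ∀ x r, μ (ball x r) = μ (ball 1 r) := by
    intro x r
    rw [← measure_preimage_mul μ x (ball x r)]
    congr 1
    ext y
    have := dist_mul_left x y 1
    rw [mul_one] at this
    rw [mem_preimage, mem_ball, mem_ball, this]
  have hνloc : IsLocallyFiniteMeasure ν :=
    ⟨fun x => ⟨ball x 1, ball_mem_nhds x one_pos, (hν x 1).lt_top⟩⟩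
  have hLDν : LocallyDoubling ball ν := hdν.locallyDoubling hR₁
  have hLDμ : LocallyDoubling ball μ :=
    (hdν.of_measure_ball_eq hνpos (fun x r => (hν x r).lt_top) hV).locallyDoubling (by positivity)
  -- This makes the Lebesgue differentiation theorem available for `μ`. The doubling of `μ` comes
  -- from that of `ν`.
  have hunif : IsUnifLocDoublingMeasure μ := by
    obtain ⟨C, -, hC⟩ := hLDμ 2 two_pos
    refine ⟨C ^ 2, ?_⟩
    filter_upwards [Ioo_mem_nhdsGT (one_pos (α := ℝ))] with r hr x
    calc μ (closedBall x (2 * r)) ≤ μ (ball x (2 ^ 2 * r)) :=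
          measure_mono (closedBall_subset_ball (by linarith [hr.1]))
      _ ≤ C ^ 2 * μ (ball x r) :=
          DoublingUpTo.measure_ball_two_pow_le hC x hr.1 2 (by linarith [hr.2])
      _ ≤ _ := by
          rw [ENNReal.coe_pow]
          gcongr
          exact ball_subset_closedBall
  obtain ⟨α, β, hα, hα1, hβ0, hβ, hS⟩ := h4.exists_measureReal_le hW hwW hν hμ hν0 hμ0
  obtain ⟨C₁, -, hC₁⟩ := hLDμ (4 * R₄) (by positivity)
  obtain ⟨C₂, -, hC₂⟩ := hLDν (4 * R₄) (by positivity)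
  set D : ℝ≥0 := max 1 (max C₁ C₂) with hD
  have hD₁ : C₁ ≤ D := (le_max_left _ _).trans (le_max_right _ _)
  have hD₂ : C₂ ≤ D := (le_max_right _ _).trans (le_max_right _ _)
  obtain ⟨η, K, hη, hK, hsmall⟩ := exists_lintegral_rpow_neg_ball_le hW hμ hν hμ0 hν0 hα hα1 hβ0 hβ
    (le_max_left 1 (max C₁ C₂))
    (fun x r hr hrR => (hC₁ x r hr hrR).trans (mul_le_mul_left (by exact_mod_cast hD₁) _))
    (fun x r hr hrR => (hC₂ x r hr hrR).trans (mul_le_mul_left (by exact_mod_cast hD₂) _))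
    hS (ae_eventually_withDensity_ball_le hW)
  rw [hνW]
  refine ⟨hLDν, fun R hR => ?_⟩
  obtain ⟨K', hK', hlarge⟩ := exists_lintegral_rpow_neg_ball_le_of_le
    (fun x r => by rw [measureReal_def, hV, measureReal_def]) hμ hν hν0 hLDν hR₄ hη hK hsmall R
  have h2 : MuckenhouptCond2 ball μ w R :=
    muckenhouptCond2_of_lintegral_rpow_neg_le hW hwW hη hK' hμ0 hν0 hlarge
  have hν' : ∀ x r, weightMeasure μ w (ball x r) ≠ ⊤ := by rwa [hνW]
  exact ⟨h2.cond1 hν' hμ hμpos, h2,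
    muckenhouptCond3_of_lintegral_rpow_neg_le hwW hη hK' hμ0 hν0 hlarge,
    h2.cond4 hW hwW hν' hμ hμpos⟩

end InvariantWeights

/-! ### Conclusion for the Carnot–Carathéodory distance. -/

theorem proposition6p2
    {E : Type*} [NormedAddCommGroup E] [NormedSpace ℝ E] [FiniteDimensional ℝ E]
    {G : Type*} [TopologicalSpace G] [ChartedSpace E G] [Group G] [LieGroup 𝓘(ℝ, E) ∞ G]
    [T2Space G] [SecondCountableTopology G] [ConnectedSpace G] [NoncompactSpace G]
    [MeasurableSpace G] [BorelSpace G]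
    (ip : InnerProductSpace.Core ℝ (GroupLieAlgebra 𝓘(ℝ, E) G))
    (𝓗 : Submodule ℝ (GroupLieAlgebra 𝓘(ℝ, E) G))
    (h𝓗 : LieSubalgebra.lieSpan ℝ (GroupLieAlgebra 𝓘(ℝ, E) G)
      (𝓗 : Set (GroupLieAlgebra 𝓘(ℝ, E) G)) = ⊤)
    (μ : Measure G) [μ.IsHaarMeasure]
    (w : G → ℝ) (hw : AInftyLocTilde (ccBall ip 𝓗) μ w) :
    LocallyDoubling (ccBall ip 𝓗) (weightMeasure μ w) ∧
      ∀ R : ℝ, 0 < R →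
        MuckenhouptCond1 (ccBall ip 𝓗) μ w R ∧
        MuckenhouptCond2 (ccBall ip 𝓗) μ w R ∧
        MuckenhouptCond3 (ccBall ip 𝓗) μ w R ∧
        MuckenhouptCond4 (ccBall ip 𝓗) μ w R := by
  have hG : IsTopologicalGroup G := topologicalGroup_of_lieGroup 𝓘(ℝ, E) ∞
  obtain ⟨m, ht, hinv, hcpt, hball⟩ := exists_metricSpace_ccBall ip h𝓗
  have hball' : ccBall ip 𝓗 = fun x r => Metric.ball x r := by
    funext x r
    exact (hball x r).symm
  rw [hball'] at hw ⊢
  clear hball hball'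
  -- The topology of `G` is replaced by that of the metric, so that the metric theorem applies with
  -- a single topology.
  subst ht
  have : ProperSpace G := ⟨hcpt⟩
  have : IsIsometricSMul G G := ⟨fun g => Isometry.of_dist_eq fun x y => hinv g x y⟩
  exact hw.locallyDoubling_and_muckenhoupt
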